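/- **Setting.** Let $d,n,k\ge 1$ be integers, $\Lambda>0$, $\varepsilon>0$. A data set $P$ is a finite list of points of the open Euclidean ball $B(0,\Lambda)\subset\mathbb R^d$; two data sets are neighbors if one arises from the other by adding one point. For $k$ centers $C=(c_1,\dots,c_k)$ put $\mathrm{cost}(P,C)=\sum_{p\in P}\min_i\|p-c_i\|$ and $\mathrm{OPT}=\inf_C \mathrm{cost}(P,C)$. The number $n$ is a public parameter of the algorithm. *Quadtree.* A quadtree $T$ is a binary tree of boxes. Its root contains $[-\Lambda,\Lambda]^d$ and has side lengths at most $4\Lambda$. A cell at depth $di+j$ ($0\le j<d$) whose $j$-th side is $[m,M]$ is cut at some $x\in[m+\frac{M-m}{3},M-\frac{M-m}{3}]$ into the parts with $j$-th coordinate $\le x$ and $>x$. The *randomly shifted quadtree* has root $\prod_j[s_j-2\Lambda,s_j+2\Lambda]$ with $s$ uniform in $[-\Lambda,\Lambda]^d$, and all its cells are cut in the middle. Let $\alpha=\lceil\log_{3/2}(4n\sqrt d)\rceil=\Theta(\log (2nd))$; cells at depth at least $d\alpha$ have diameter at most $\Lambda/n$. Put $b=d\alpha/\varepsilon$. *Algorithm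 DP-kMedian.* (1) Draw a random quadtree $T$, independently of the data. (2) MakePrivate: start with $w=0$ on all cells; starting from the root, each reached cell $c$ with $\mathrm{diam}(c)>\Lambda/n$ gets $w(c)=|T(c)\cap P|+\mathrm{Lap}(b)$ (independent Laplace noise with density $\frac1{2b}e^{-|x|/b}$, points counted with multiplicity), and if $w(c)>2b$, its two children are reached as well. (3) Dynamic program, starting from the root: each cell $c$ gets values $v_{k'}$ and solutions $S_{k'}$ for $0\le k'\le k$, with $v_0=w(c)\,\mathrm{diam}(c)$, $S_0=\emptyset$. For $k'\ge1$: if $w(c)<2b$, then $v_{k'}=0$ and $S_{k'}$ is $k'$ copies of the center of $c$; otherwise $v_{k'}$ is the minimum of $v^1_{k_1}+v^2_{k_2}$ over $k_1+k_2=k'$, where $v^1,v^2$ belong to the two children, and $S_{k'}=S^1_{k_1}\cup S^2_{k_2}$ for a minimizing pair. (4) Return the $k$ centers $S_k$ of the root. **Theorem.** 1. *Privacy.* For every law of the random quadtree, the algorithm is $\varepsilon$-differentially private: for all neighboring data sets $P,P'$ and all measurable sets $B$ of outputs, $\Pr[\mathcal A(P)\in B]\le e^{\varepsilon}\Pr[\mathcal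 A(P')\in B]$. 2. *Cost.* There is an absolute constant $C$ such that, for the randomly shifted quadtree and every $P$ with $|P|=n\ge2$, the output $S$ satisfies $$\mathbb E[\mathrm{cost}(P,S)]\le C\,d^{3/2}\log n\cdot \mathrm{OPT}+C\,d^2\log^2 n\cdot k\Bigl(1+\frac1\varepsilon\Bigr)\cdot\Lambda .$$ In particular, for $\varepsilon\le 1$ this is $O(d^{3/2}\log n)\cdot\mathrm{OPT}+O\bigl(\frac{d^2\log^2 n\cdot k}{\varepsilon}\bigr)\cdot\Lambda$. 3. *Running time.* There are absolute constants $C$ and $a\in\mathbb N$ such that, for every law of the random quadtree and every $P$ with $|P|=n$, the expected number of steps (on a real-number RAM in which one arithmetic operation, comparison, square root, memory access or random draw costs one step) is at most $C\,n d k^2\,(1+\log(ndk))^a$, that is, $\tilde O(ndk^2)$. -/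

import Mathlib

open MeasureTheory ProbabilityTheory

namespace DPKMedian

/-! ## Step-counting programs -/

/-- The result of a program together with the number of elementary steps it used.
The machine is a real-number RAM: one arithmetic operation or comparison on reals or integers,
one square root, one read or write of a memory word (a number or a pointer) and one draw of a
random number each cost one step. -/
structure Timed (α : Type) where
  val : α
  steps : ℕ

/-- Charge `t` steps. -/
def tick (t : ℕ) : Timed Unit := ⟨(), t⟩

instance : Monad Timed where
  pure a := ⟨a, 0⟩
  bind x f := ⟨(f x.val).val, x.steps + (f x.val).steps⟩

/-- Cost of reading one entry, or of writing one entry while keeping the old version, of a vector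
of length `d` stored as a balanced search tree (a persistent array). -/
def accessCost (d : ℕ) : ℕ := Nat.log 2 d + 1

/-- Fill an array with entries `f 0, …, f k`. -/
def tabulate {α : Type} (k : ℕ) (f : ℕ → Timed α) : Timed (ℕ → α) :=
  ⟨fun i => (f i).val, ∑ i ∈ Finset.range (k + 1), ((f i).steps + 1)⟩

/-- Compute an index `i ≤ m` that minimizes `f i`, together with the minimum. Each value `f i` is
evaluated once; the charge per index covers that evaluation (two reads, one subtraction of
indices, one addition), the comparison and the bookkeeping. -/
noncomputable def argmin (f : ℕ → ℝ) : ℕ → Timed (ℕ × ℝ)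
  | 0 => ⟨(0, f 0), 8⟩
  | m + 1 => do
    let best ← argmin f m
    tick 8
    if f (m + 1) < best.2 then pure (m + 1, f (m + 1)) else pure best

/-! ## Quadtrees -/

/-- Points of `d`-dimensional Euclidean space. -/
abbrev Pt (d : ℕ) := EuclideanSpace ℝ (Fin d)

/-- A binary quadtree, given by its root cell `∏ j, [lo j, hi j]` and, for each node, the relative
position of the cut: a cell whose active side is `[m, M]` is cut at `x = m + cut * (M - m)`.
A node is named by the list of turns leading to it, latest turn first
(`false` for the child below the cut, `true` for the other one). -/
structure Quadtree (d : ℕ) where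
  lo : Fin d → ℝ
  hi : Fin d → ℝ
  cut : List Bool → ℝ

instance (d : ℕ) : MeasurableSpace (Quadtree d) :=
  MeasurableSpace.comap (fun T : Quadtree d => (T.lo, T.hi, T.cut)) inferInstance

/-- The root cell contains the cube `[-Λ, Λ]^d` and has side lengths at most `4 Λ`, and every cut
lies in the middle third `[m + (M - m) / 3, M - (M - m) / 3]` of the active side. -/
structure Quadtree.Valid {d : ℕ} (T : Quadtree d) (Λ : ℝ) : Prop where
  lo_le : ∀ j, T.lo j ≤ -Λ
  le_hi : ∀ j, Λ ≤ T.hi j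
  side_le : ∀ j, T.hi j - T.lo j ≤ 4 * Λ
  cut_mem : ∀ c, T.cut c ∈ Set.Icc (1 / 3 : ℝ) (2 / 3)

/-- A cell of a quadtree: its name, its depth, its box, and the square of its diameter. -/
structure Cell (d : ℕ) where
  name : List Bool
  depth : ℕ
  lo : Fin d → ℝ
  hi : Fin d → ℝ
  diamSq : ℝ

noncomputable def Cell.diam {d : ℕ} (c : Cell d) : ℝ := √c.diamSq

/-- The center of the box of a cell. -/
noncomputable def Cell.center {d : ℕ} (c : Cell d) : Pt d :=
  WithLp.toLp 2 fun j => (c.lo j + c.hi j) / 2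

/-- The root cell; all sides are written down and its diameter is computed. -/
noncomputable def Quadtree.root {d : ℕ} (T : Quadtree d) : Timed (Cell d) := do
  tick (d * (2 * accessCost d + 4) + 5)
  pure ⟨[], 0, T.lo, T.hi, ∑ j, (T.hi j - T.lo j) ^ 2⟩

/-- Cut the cell `c` perpendicularly to the coordinate `depth mod d`. Returns that coordinate, the
position of the cut and the two children. Four accesses to the sides of the cell and a bounded
number of other operations (the squared diameter is updated, not recomputed). -/
noncomputable def Quadtree.split {d : ℕ} [NeZero d] (T : Quadtree d) (c : Cell d) :
    Timed (Fin d × ℝ × Cell d × Cell d) := do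
  tick (4 * accessCost d + 30)
  let j := Fin.ofNat d c.depth
  let m := c.lo j
  let M := c.hi j
  let x := m + T.cut c.name * (M - m)
  pure (j, x,
    ⟨false :: c.name, c.depth + 1, c.lo, Function.update c.hi j x,
      c.diamSq - (M - m) ^ 2 + (x - m) ^ 2⟩,
    ⟨true :: c.name, c.depth + 1, Function.update c.lo j x, c.hi,
      c.diamSq - (M - m) ^ 2 + (M - x) ^ 2⟩)

/-! ## The algorithm -/

/-- The number of rounds (of `d` levels each) of the quadtree, i.e. the least `i` with
`(2 / 3) ^ i * (4 * Λ * √d) ≤ Λ / n`: below depth `d * rounds d n` every cell of a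
valid quadtree has diameter at most `Λ / n`. -/
noncomputable def rounds (d n : ℕ) : ℕ := ⌈Real.logb (3 / 2) (4 * √(d : ℝ) * n)⌉₊

/-- The scale of the Laplace noise: the number of noisy levels, divided by `ε`. -/
noncomputable def noiseScale (d n : ℕ) (ε : ℝ) : ℝ := d * rounds d n / ε

/-- The number of points in a list. -/
def countPoints {d : ℕ} : List (Pt d) → Timed ℕ
  | [] => ⟨0, 1⟩
  | _ :: ps => do
    tick 2
    let m ← countPoints ps
    pure (m + 1)

/-- Separate the points whose `j`-th coordinate is at most `x` from the others. -/
noncomputable def partitionPoints {d : ℕ} (j : Fin d) (x : ℝ) :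
    List (Pt d) → Timed (List (Pt d) × List (Pt d))
  | [] => ⟨([], []), 1⟩
  | p :: ps => do
    tick 4
    let r ← partitionPoints j x ps
    if p j ≤ x then pure (p :: r.1, r.2) else pure (r.1, p :: r.2)

/-- The part of a quadtree on which the noisy counts `w` live. A cell `pruned c` was not given a
count, so its weight is the initial value `0`; a cell `node c w l r` has noisy count `w`. -/
inductive CountTree (d : ℕ) where
  | pruned (c : Cell d)
  | node (c : Cell d) (w : ℝ) (l r : CountTree d)

/-- MakePrivate, started at a cell `c` whose set of input points is `P`: if the diameter of `c`
exceeds `Λ / n`, give `c` its number of points plus fresh Laplace noise as weight, and go on with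
the children if this weight exceeds `2 b`. The first argument is the number of levels left. -/
noncomputable def makePrivate {d : ℕ} [NeZero d] (n : ℕ) (Λ b : ℝ) (T : Quadtree d)
    (noise : List Bool → ℝ) : ℕ → Cell d → List (Pt d) → Timed (CountTree d)
  | 0, c, _ => ⟨.pruned c, 1⟩
  | m + 1, c, P => do
    tick 3
    if Λ / n < c.diam then
      let N ← countPoints P
      tick 3
      let w := (N : ℝ) + noise c.name
      let s ← T.split c
      tick 3
      if 2 * b < w then
        let Q ← partitionPoints s.1 s.2.1 P
        let l ← makePrivate n Λ b T noise m s.2.2.1 Q.1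
        let r ← makePrivate n Λ b T noise m s.2.2.2 Q.2
        pure (.node c w l r)
      else
        pure (.node c w (.pruned s.2.2.1) (.pruned s.2.2.2))
    else
      pure (.pruned c)

/-- Table of a cell `c` that is not subdivided: without center its points cost `w * diam c`; with
`k' ≥ 1` centers the value is `0`, for `k'` copies of (a pointer to) the center of `c`. -/
noncomputable def leafTable {d : ℕ} (k : ℕ) (c : Cell d) (w : ℝ) :
    Timed (ℕ → ℝ × List (Cell d)) :=
  tabulate k fun k' =>
    if k' = 0 then ⟨(w * c.diam, []), 6⟩ else ⟨(0, List.replicate k' c), k' + 3⟩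

/-- Table of a cell `c` that is subdivided, from the tables of its two children. -/
noncomputable def innerTable {d : ℕ} (k : ℕ) (c : Cell d) (w : ℝ)
    (V₁ V₂ : ℕ → ℝ × List (Cell d)) : Timed (ℕ → ℝ × List (Cell d)) :=
  tabulate k fun k' =>
    if k' = 0 then ⟨(w * c.diam, []), 6⟩
    else do
      let best ← argmin (fun i => (V₁ i).1 + (V₂ (k' - i)).1) k'
      tick (2 * (V₁ best.1).2.length + 6)
      pure (best.2, (V₁ best.1).2 ++ (V₂ (k' - best.1)).2)

/-- DynamicProgram-kMedian: for each `k' ≤ k` a value and a solution with `k'` centers. -/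
noncomputable def dynamicProgram {d : ℕ} (k : ℕ) (b : ℝ) :
    CountTree d → Timed (ℕ → ℝ × List (Cell d))
  | .pruned c => do
    tick 3
    leafTable k c 0
  | .node c w l r => do
    tick 3
    if w < 2 * b then leafTable k c w
    else
      let V₁ ← dynamicProgram k b l
      let V₂ ← dynamicProgram k b r
      innerTable k c w V₁ V₂

/-- Write out the coordinates of the centers of a list of cells. -/
noncomputable def writeCenters {d : ℕ} : List (Cell d) → Timed (List (Pt d))
  | [] => ⟨[], 1⟩
  | c :: cs => do
    tick (d * (2 * accessCost d + 3) + 2)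
    let r ← writeCenters cs
    pure (c.center :: r)

/-- DP-kMedian on the data `P`, for a given quadtree and given values of the noise. The number `n`
is a public parameter. The numbers `rounds d n`, `b` and `Λ / n` are computed first. -/
noncomputable def dpKMedian {d : ℕ} [NeZero d] (n k : ℕ) (Λ ε : ℝ) (T : Quadtree d)
    (noise : List Bool → ℝ) (P : List (Pt d)) : Timed (List (Pt d)) := do
  tick (2 * rounds d n + 20)
  let b := noiseScale d n ε
  let r ← T.root
  let t ← makePrivate n Λ b T noise (d * rounds d n) r P
  let V ← dynamicProgram k b t
  tick 2
  writeCenters (V k).2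

theorem argmin_le (f : ℕ → ℝ) (m : ℕ) : (argmin f m).val.1 ≤ m := by
  induction m with
  | zero => exact le_rfl
  | succ m ih =>
    change (ite _ _ _ : Timed (ℕ × ℝ)).val.1 ≤ _
    split_ifs
    · exact le_rfl
    · exact ih.trans m.le_succ

theorem leafTable_length {d : ℕ} (k : ℕ) (c : Cell d) (w : ℝ) (k' : ℕ) :
    ((leafTable k c w).val k').2.length = k' := by
  by_cases h : k' = 0 <;> simp [leafTable, tabulate, h]

theorem dynamicProgram_length {d : ℕ} (k : ℕ) (b : ℝ) (t : CountTree d) (k' : ℕ) :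
    ((dynamicProgram k b t).val k').2.length = k' := by
  induction t generalizing k' with
  | pruned c => exact leafTable_length k c 0 k'
  | node c w l r hl hr =>
    by_cases hw : w < 2 * b
    · have : (dynamicProgram k b (.node c w l r)).val = (leafTable k c w).val := by
        rw [dynamicProgram, if_pos hw]; rfl
      rw [this]; exact leafTable_length k c w k'
    · have : (dynamicProgram k b (.node c w l r)).val =
          (innerTable k c w (dynamicProgram k b l).val (dynamicProgram k b r).val).val := by
        rw [dynamicProgram, if_neg hw]; rfl
      rw [this]
      by_cases h : k' = 0
      · simp [innerTable, tabulate, h]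
      · simp only [innerTable, tabulate, if_neg h]
        change ((_ : List (Cell d)) ++ _).length = k'
        rw [List.length_append, hl, hr]
        exact Nat.add_sub_cancel' (argmin_le _ _)

theorem writeCenters_length {d : ℕ} (cs : List (Cell d)) :
    (writeCenters cs).val.length = cs.length := by
  induction cs with
  | nil => rfl
  | cons c cs ih => exact congrArg Nat.succ ih

/-- The algorithm returns exactly `k` centers. -/
theorem dpKMedian_length {d : ℕ} [NeZero d] (n k : ℕ) (Λ ε : ℝ) (T : Quadtree d)
    (noise : List Bool → ℝ) (P : List (Pt d)) :
    (dpKMedian n k Λ ε T noise P).val.length = k :=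
  (writeCenters_length _).trans (dynamicProgram_length _ _ _ _)

/-- The `k` centers returned by the algorithm. -/
noncomputable def centers {d : ℕ} [NeZero d] (n k : ℕ) (Λ ε : ℝ) (P : List (Pt d))
    (ω : Quadtree d × (List Bool → ℝ)) : Fin k → Pt d :=
  fun i => (dpKMedian n k Λ ε ω.1 ω.2 P).val.get (i.cast (dpKMedian_length ..).symm)

/-- The number of steps of the algorithm. -/
noncomputable def runningTime {d : ℕ} [NeZero d] (n k : ℕ) (Λ ε : ℝ) (P : List (Pt d))
    (ω : Quadtree d × (List Bool → ℝ)) : ℕ :=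
  (dpKMedian n k Λ ε ω.1 ω.2 P).steps

/-! ## Randomness -/

/-- The Laplace distribution `Lap(b)`, with density `exp (-|x| / b) / (2 b)`
(the point mass at `0` for `b ≤ 0`). -/
noncomputable def laplace (b : ℝ) : Measure ℝ :=
  open Classical in
  if 0 < b then
    volume.withDensity fun x => ENNReal.ofReal (1 / (2 * b) * Real.exp (-|x| / b))
  else Measure.dirac 0

instance (b : ℝ) : IsProbabilityMeasure (laplace b) := by
  unfold laplace
  split_ifs with hb
  · constructor
    have hval : ∫ x : ℝ, Real.exp (-|x| / b) = 2 * b := by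
      rw [integral_comp_abs (f := fun x => Real.exp (-x / b))]
      have := integral_exp_mul_Ioi (a := -1 / b)
        (div_neg_of_neg_of_pos (by norm_num) hb) 0
      have h2 : (fun x : ℝ => Real.exp (-x / b)) = fun x => Real.exp (-1 / b * x) := by
        funext x; congr 1; ring
      rw [h2, this]
      field_simp
      simp
    have hint : Integrable fun x : ℝ => Real.exp (-|x| / b) :=
      not_imp_comm.mp integral_undef (by rw [hval]; positivity)
    rw [withDensity_apply _ MeasurableSet.univ, Measure.restrict_univ,
      ← ofReal_integral_eq_lintegral_ofReal (hint.const_mul _)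
        (Filter.Eventually.of_forall fun x => by positivity),
      integral_const_mul, hval]
    rw [one_div_mul_cancel (by positivity), ENNReal.ofReal_one]
  · infer_instance

/-- The joint law of the quadtree (with law `τ`) and of independent `Lap(b)` noise, one value for
each potential node. -/
noncomputable def randomness {d : ℕ} (τ : Measure (Quadtree d)) (b : ℝ) :
    Measure (Quadtree d × (List Bool → ℝ)) :=
  τ.prod (Measure.infinitePi fun _ : List Bool => laplace b)

/-- The quadtree with root cell `∏ j, [s j - 2 Λ, s j + 2 Λ]` in which all cells are halved. -/
noncomputable def shiftedQuadtree {d : ℕ} (Λ : ℝ) (s : Fin d → ℝ) : Quadtree d :=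
  ⟨fun j => s j - 2 * Λ, fun j => s j + 2 * Λ, fun _ => 1 / 2⟩

/-- The law of the randomly shifted quadtree: the shift is uniform in `[-Λ, Λ]^d`. -/
noncomputable def shiftedLaw (d : ℕ) (Λ : ℝ) : Measure (Quadtree d) :=
  (cond volume (Set.Icc (fun _ : Fin d => -Λ) fun _ => Λ)).map (shiftedQuadtree Λ)

theorem measurable_shiftedQuadtree {d : ℕ} (Λ : ℝ) :
    Measurable (shiftedQuadtree Λ : (Fin d → ℝ) → Quadtree d) := by
  refine measurable_comap_iff.mpr ?_
  unfold Function.comp shiftedQuadtree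
  fun_prop

theorem isProbabilityMeasure_shiftedLaw (d : ℕ) {Λ : ℝ} (hΛ : 0 < Λ) :
    IsProbabilityMeasure (shiftedLaw d Λ) := by
  have hv : volume (Set.Icc (fun _ : Fin d => -Λ) fun _ => Λ) ≠ 0 := by
    rw [Real.volume_Icc_pi]
    refine Finset.prod_ne_zero_iff.mpr fun i _ => ?_
    simpa using by linarith
  have : IsProbabilityMeasure (cond volume (Set.Icc (fun _ : Fin d => -Λ) fun _ => Λ)) :=
    cond_isProbabilityMeasure_of_finite hv isCompact_Icc.measure_lt_top.ne
  exact Measure.isProbabilityMeasure_map (measurable_shiftedQuadtree Λ).aemeasurable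

/-- The randomly shifted quadtree is a quadtree in the above sense. -/
theorem shiftedQuadtree_valid {d : ℕ} {Λ : ℝ} {s : Fin d → ℝ}
    (hs : s ∈ Set.Icc (fun _ : Fin d => -Λ) fun _ => Λ) : (shiftedQuadtree Λ s).Valid Λ where
  lo_le j := by have := hs.2 j; simp only [shiftedQuadtree]; linarith
  le_hi j := by have := hs.1 j; simp only [shiftedQuadtree]; linarith
  side_le j := by simp only [shiftedQuadtree]; linarith
  cut_mem c := by constructor <;> norm_num [shiftedQuadtree]

/-! ## Privacy and cost -/

/-- Two data sets are neighbors if one is obtained from the other by adding one point. -/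
def Neighbors {X : Type} (P P' : List X) : Prop :=
  ∃ p, P'.Perm (p :: P) ∨ P.Perm (p :: P')

/-- The randomized algorithm `A`, with randomness `μ`, is `ε`-differentially private on data sets
of points from `D`. -/
def IsDifferentiallyPrivate {X Ω Y : Type} [MeasurableSpace Ω] [MeasurableSpace Y] (ε : ℝ)
    (D : Set X) (μ : Measure Ω) (A : List X → Ω → Y) : Prop :=
  (∀ P, Measurable (A P)) ∧
  ∀ P P' : List X, (∀ p ∈ P, p ∈ D) → (∀ p ∈ P', p ∈ D) → Neighbors P P' →
    ∀ B : Set Y, MeasurableSet B →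
      μ {ω | A P ω ∈ B} ≤ ENNReal.ofReal (Real.exp ε) * μ {ω | A P' ω ∈ B}

/-- The `k`-median cost of the centers `C`. -/
noncomputable def cost {d k : ℕ} (P : List (Pt d)) (C : Fin k → Pt d) : ℝ :=
  (P.map fun p => ⨅ i, dist p (C i)).sum

/-- The optimal `k`-median cost. -/
noncomputable def opt {d : ℕ} (k : ℕ) (P : List (Pt d)) : ℝ :=
  ⨅ C : Fin k → Pt d, cost P C

end DPKMedian

/-!
*Privacy.* Fix the quadtree. The output is a function of the vector of noisy counts `count + noise`
only: on which cells are reached, and on the tables, the data have no other influence. Adding one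
point raises by one the counts of the cells containing it; these form a path with at most
`d * rounds d n` noisy levels, so translating the noise by one along this path turns a run on one
data set into a run on the other. A Laplace variable translated by one changes its density by a
factor at most `exp (1 / b)`, and the product of these factors is at most `exp ε`
(`laplace_translate`, `infinitePi_laplace_add_spikes`, `isDifferentiallyPrivate_centers`).

*Cost.* Let `S` and `v` be the solution and the value of the dynamic program at the root.

* `v` is at most the value, for the noisy counts, of distributing any given centers `C` over the
  cells (`table_value_le_comparator`). Whether a cell is reached depends only on the noise above
  it, so the noise of a cell without centers still has mean zero when the cell is reached. In
  expectation this value is therefore at most the sum, over the points, of the diameter of the cell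
  in which the point is cut from its center (`comparator_expectation`), and for a random shift this
  is `O(d * rounds d n)` times the distance to the center (`integral_sum_crossingCost_le`).
* The true cost of `S` may exceed `2 v`, because the dynamic program picks the centers after seeing
  the noise. Apart from the `2 * Λ` due to cells of diameter at most `Λ / n`, the excess is a sum
  of noise terms, one for each cell without centers and one for each cell that is not subdivided,
  maximized over all ways to distribute `k` centers. Its exponential moment, with weight `z ^ k'`
  for `k'` centers, is dominated by a product-like recursion over the tree (`le_expError`). Because
  of the threshold `2 b`, empty cells are rarely subdivided and contribute little; along a nonempty
  cell the exponential moments of the noise multiply, but the squared diameters decrease at least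
  by a factor `1 - 3 / (4 d)` per level, so that `diamSq` serves as a potential that keeps the
  product bounded (`expError_expectation`). Taking logarithms, the expected excess is
  `O(k * log (1 / z) * b * d * Λ)` with `1 / z` polynomially bounded in `n` and `d`
  (`expectation_cost_shift_le`).

If `d` exceeds `n`, the term `log d` hidden in `rounds d n` is not bounded by `log n`, but then the
trivial bound `4 * n * √d * Λ` on the cost is good enough.

*Running time.* For each fixed quadtree, an empty cell is subdivided with probability
`exp (-2) / 2`, so the cells reached below an empty cell form a subcritical branching process of
bounded expected size. There are at most `n` nonempty cells at each of the `d * rounds d n` levels;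
each reached cell costs `O(k ^ 2)` for its table, `O(log d)` per access to its sides, and `O(1)`
per point in it (`integral_runningTime_le`).
-/

namespace DPKMedian

/-! ### Functions of disjoint sets of coordinates -/

section Product

variable {ι : Type*} {X : ι → Type*} [∀ i, MeasurableSpace (X i)]
  (μ : (i : ι) → Measure (X i)) [∀ i, IsProbabilityMeasure (μ i)]

/-- Resampling the coordinates outside `S` does not change an infinite product measure. -/
theorem measurePreserving_piecewise (S : Set ι) [DecidablePred (· ∈ S)] :
    MeasurePreserving (fun p : (∀ i, X i) × (∀ i, X i) => S.piecewise p.1 p.2)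
      ((Measure.infinitePi μ).prod (Measure.infinitePi μ)) (Measure.infinitePi μ) := by
  have hm : Measurable (fun p : (∀ i, X i) × (∀ i, X i) => S.piecewise p.1 p.2) := by
    refine measurable_pi_lambda _ fun i => ?_
    by_cases hi : i ∈ S <;> simp only [hi, Set.piecewise, if_true, if_false] <;> fun_prop
  refine ⟨hm, ?_⟩
  refine Measure.eq_infinitePi μ fun s t ht => ?_
  rw [Measure.map_apply hm (MeasurableSet.pi s.countable_toSet fun i _ => ht i)]
  have : (fun p : (∀ i, X i) × (∀ i, X i) => S.piecewise p.1 p.2) ⁻¹' (Set.pi s t) =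
      (Set.pi (s.filter (· ∈ S) : Finset ι) t) ×ˢ (Set.pi (s.filter (· ∉ S) : Finset ι) t) := by
    ext p
    simp only [Set.mem_preimage, Set.mem_pi, Set.mem_prod, Finset.coe_filter, Set.mem_ofPred_eq,
      Finset.mem_coe]
    constructor
    · intro h
      refine ⟨fun i hi => ?_, fun i hi => ?_⟩ <;> simpa [Set.piecewise, hi.2] using h i hi.1
    · rintro ⟨h₁, h₂⟩ i hi
      by_cases hS : i ∈ S
      · simpa [Set.piecewise, hS] using h₁ i ⟨hi, hS⟩
      · simpa [Set.piecewise, hS] using h₂ i ⟨hi, hS⟩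
  rw [this, Measure.prod_prod, Measure.infinitePi_pi _ fun i _ => ht i,
    Measure.infinitePi_pi _ fun i _ => ht i, Finset.prod_filter_mul_prod_filter_not]

/-- Functions of disjoint sets of coordinates are independent. -/
theorem indepFun_of_dependsOn {β γ : Type*} [MeasurableSpace β] [MeasurableSpace γ]
    {f : (∀ i, X i) → β} {g : (∀ i, X i) → γ} {S S' : Set ι} (hS : Disjoint S S')
    (hf : Measurable f) (hg : Measurable g) (hfS : DependsOn f S) (hgS : DependsOn g S') :
    IndepFun f g (Measure.infinitePi μ) := by
  classical
  rw [indepFun_iff_measure_inter_preimage_eq_mul]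
  intro A B hA hB
  rw [← (measurePreserving_piecewise μ S).measure_preimage
    ((hf hA).inter (hg hB)).nullMeasurableSet, ← Measure.prod_prod]
  congr 1
  ext p
  have h₁ : f (S.piecewise p.1 p.2) = f p.1 := hfS fun i hi => by simp [Set.piecewise, hi]
  have h₂ : g (S.piecewise p.1 p.2) = g p.2 := hgS fun i hi => by
    have : i ∉ S := fun h => hS.le_bot ⟨h, hi⟩
    simp [Set.piecewise, this]
  simp [h₁, h₂]

/-- The expectation of `f ω i + g ω i * G ω` where `G` does not depend on the coordinate `i`. -/
theorem integral_add_mul_of_dependsOn {i : ι} {f g : X i → ℝ} {G : (∀ i, X i) → ℝ}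
    (hf : Integrable f (μ i)) (hg : Integrable g (μ i)) (hgm : Measurable g)
    (hG : Integrable G (Measure.infinitePi μ)) (hGm : Measurable G) (hGi : DependsOn G {i}ᶜ) :
    Integrable (fun ω => f (ω i) + g (ω i) * G ω) (Measure.infinitePi μ) ∧
      ∫ ω, f (ω i) + g (ω i) * G ω ∂Measure.infinitePi μ =
        (∫ x, f x ∂μ i) + (∫ x, g x ∂μ i) * ∫ ω, G ω ∂Measure.infinitePi μ := by
  have hp := measurePreserving_eval_infinitePi μ i
  have hf' : Integrable (fun ω => f (ω i)) (Measure.infinitePi μ) :=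
    hp.integrable_comp_of_integrable hf
  have hg' : Integrable (fun ω => g (ω i)) (Measure.infinitePi μ) :=
    hp.integrable_comp_of_integrable hg
  have hind : IndepFun (fun ω => g (ω i)) G (Measure.infinitePi μ) :=
    indepFun_of_dependsOn μ (disjoint_compl_right (a := ({i} : Set ι)))
      (hgm.comp (measurable_pi_apply i)) hGm
      (fun x y h => by simp only [h i rfl]) hGi
  have hI := hind.integrable_mul hg' hG
  refine ⟨hf'.add hI, ?_⟩
  have e₁ : ∫ ω, f (ω i) ∂Measure.infinitePi μ = ∫ x, f x ∂μ i := by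
    rw [← hp.map_eq] at hf ⊢
    exact (integral_map hp.measurable.aemeasurable hf.aestronglyMeasurable).symm
  have e₂ : ∫ ω, g (ω i) ∂Measure.infinitePi μ = ∫ x, g x ∂μ i := by
    rw [← hp.map_eq] at hg ⊢
    exact (integral_map hp.measurable.aemeasurable hg.aestronglyMeasurable).symm
  have e₃ := hind.integral_mul_eq_mul_integral hg'.aestronglyMeasurable hG.aestronglyMeasurable
  rw [← e₁, ← e₂, ← e₃]
  exact integral_add hf' hI

end Product

/-! ### The Laplace distribution -/

theorem laplace_of_pos {b : ℝ} (hb : 0 < b) :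
    laplace b =
      volume.withDensity fun x => ENNReal.ofReal (1 / (2 * b) * Real.exp (-|x| / b)) := by
  unfold laplace; rw [if_pos hb]

theorem integrable_laplace_iff {b : ℝ} (hb : 0 < b) {f : ℝ → ℝ} :
    Integrable f (laplace b) ↔
      Integrable (fun x => 1 / (2 * b) * Real.exp (-|x| / b) * f x) := by
  rw [laplace_of_pos hb, integrable_withDensity_iff_integrable_smul' (by fun_prop)
    (Filter.Eventually.of_forall fun x => ENNReal.ofReal_lt_top)]
  simp only [smul_eq_mul]
  refine integrable_congr (Filter.Eventually.of_forall fun x => ?_)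
  simp only
  rw [ENNReal.toReal_ofReal (by positivity)]

theorem integral_laplace {b : ℝ} (hb : 0 < b) (f : ℝ → ℝ) :
    ∫ x, f x ∂laplace b = ∫ x, 1 / (2 * b) * Real.exp (-|x| / b) * f x := by
  rw [laplace_of_pos hb, integral_withDensity_eq_integral_toReal_smul (by fun_prop)
    (Filter.Eventually.of_forall fun x => ENNReal.ofReal_lt_top)]
  refine integral_congr_ae (Filter.Eventually.of_forall fun x => ?_)
  simp only [smul_eq_mul]
  rw [ENNReal.toReal_ofReal (by positivity)]

/-- The moment generating function of the Laplace distribution. -/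
theorem integral_exp_laplace {b t : ℝ} (hb : 0 < b) (ht : |t| * b < 1) :
    Integrable (fun x => Real.exp (t * x)) (laplace b) ∧
      ∫ x, Real.exp (t * x) ∂laplace b = 1 / (1 - t ^ 2 * b ^ 2) := by
  have hlt := abs_lt.mp ((lt_div_iff₀ hb).mpr ht)
  have h1 : 0 < t + 1 / b := by linarith
  have h2 : t - 1 / b < 0 := by linarith
  set φ : ℝ → ℝ := fun x => 1 / (2 * b) * Real.exp (-|x| / b) * Real.exp (t * x)
  have eI : Set.EqOn (fun x => 1 / (2 * b) * Real.exp ((t + 1 / b) * x)) φ (Set.Iic 0) := by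
    intro x hx
    simp only [φ, abs_of_nonpos (Set.mem_Iic.mp hx), mul_assoc, ← Real.exp_add]
    congr 2; ring
  have eJ : Set.EqOn (fun x => 1 / (2 * b) * Real.exp ((t - 1 / b) * x)) φ (Set.Ioi 0) := by
    intro x hx
    simp only [φ, abs_of_pos (Set.mem_Ioi.mp hx), mul_assoc, ← Real.exp_add]
    congr 2; ring
  have iI : IntegrableOn φ (Set.Iic 0) :=
    IntegrableOn.congr_fun ((integrableOn_exp_mul_Iic h1 0).const_mul _) eI measurableSet_Iic
  have iJ : IntegrableOn φ (Set.Ioi 0) :=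
    IntegrableOn.congr_fun ((integrableOn_exp_mul_Ioi h2 0).const_mul _) eJ measurableSet_Ioi
  refine ⟨(integrable_laplace_iff hb).mpr ?_, ?_⟩
  · have := iI.union iJ
    rwa [Set.Iic_union_Ioi, integrableOn_univ] at this
  · rw [integral_laplace hb]
    change ∫ x, φ x = _
    rw [← intervalIntegral.integral_Iic_add_Ioi iI iJ, ← setIntegral_congr_fun measurableSet_Iic eI,
      ← setIntegral_congr_fun measurableSet_Ioi eJ, integral_const_mul, integral_const_mul,
      integral_exp_mul_Iic h1, integral_exp_mul_Ioi h2]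
    simp only [mul_zero, Real.exp_zero]
    have h3 : t * b + 1 ≠ 0 := by
      have := mul_pos h1 hb; field_simp at this; exact this.ne'
    have h4 : t * b - 1 ≠ 0 := by
      have := mul_neg_of_neg_of_pos h2 hb; field_simp at this; exact this.ne
    have h5 : 1 - t ^ 2 * b ^ 2 ≠ 0 := by
      rw [show 1 - t ^ 2 * b ^ 2 = -((t * b + 1) * (t * b - 1)) by ring]
      exact neg_ne_zero.mpr (mul_ne_zero h3 h4)
    have h6 : t + 1 / b = (t * b + 1) / b := by field_simp
    have h7 : t - 1 / b = (t * b - 1) / b := by field_simp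
    rw [h6, h7, show 1 - t ^ 2 * b ^ 2 = -((t * b + 1) * (t * b - 1)) by ring]
    rw [show 1 / (2 * b) * (1 / ((t * b + 1) / b)) + 1 / (2 * b) * (-1 / ((t * b - 1) / b)) =
      1 / 2 * (1 / (t * b + 1) - 1 / (t * b - 1)) by field_simp; ring, div_sub_div _ _ h3 h4]
    field_simp
    ring

theorem exp_laplace_le {b t : ℝ} (hb : 0 < b) (ht : t ^ 2 * b ^ 2 ≤ 1 / 2) :
    Integrable (fun x => Real.exp (t * x)) (laplace b) ∧
      ∫ x, Real.exp (t * x) ∂laplace b ≤ Real.exp (2 * (t ^ 2 * b ^ 2)) := by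
  have h : |t| * b < 1 := by
    refine abs_lt_of_sq_lt_sq' (a := |t| * b) (b := 1) ?_ zero_le_one |>.2
    rw [mul_pow, sq_abs]; linarith
  obtain ⟨h₁, h₂⟩ := integral_exp_laplace hb h
  refine ⟨h₁, h₂.trans_le ?_⟩
  set u := t ^ 2 * b ^ 2
  have hu : 0 ≤ u := by positivity
  refine le_trans ?_ (Real.add_one_le_exp _)
  rw [div_le_iff₀ (by linarith)]
  nlinarith

theorem integrable_id_laplace {b : ℝ} (hb : 0 < b) : Integrable (fun x => x) (laplace b) := by
  have h1 := (integral_exp_laplace (t := 1 / (2 * b)) hb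
    (by rw [abs_of_pos (by positivity)]; field_simp; norm_num)).1
  have h2 := (integral_exp_laplace (t := -(1 / (2 * b))) hb
    (by rw [abs_neg, abs_of_pos (by positivity)]; field_simp; norm_num)).1
  refine ((h1.add h2).const_mul (2 * b)).mono' (by fun_prop) (Filter.Eventually.of_forall ?_)
  intro x
  simp only [Pi.add_apply, Real.norm_eq_abs]
  have e1 := Real.add_one_le_exp (1 / (2 * b) * x)
  have e2 := Real.add_one_le_exp (-(1 / (2 * b)) * x)
  have p1 := Real.exp_pos (1 / (2 * b) * x)
  have p2 := Real.exp_pos (-(1 / (2 * b)) * x)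
  obtain ⟨y, hy⟩ : ∃ y, y = 1 / (2 * b) * x := ⟨_, rfl⟩
  have hx : x = 2 * b * y := by rw [hy]; field_simp
  rw [neg_mul] at e2 p2 ⊢
  rw [← hy] at e1 e2 p1 p2 ⊢
  rw [hx, abs_mul, abs_of_pos (by positivity : 0 < 2 * b)]
  refine mul_le_mul_of_nonneg_left (abs_le.mpr ⟨?_, ?_⟩) (by positivity) <;> linarith

/-- The Laplace distribution is symmetric. -/
theorem integral_id_laplace {b : ℝ} (hb : 0 < b) : ∫ x, x ∂laplace b = 0 := by
  rw [integral_laplace hb]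
  have := integral_neg_eq_self (fun x : ℝ => 1 / (2 * b) * Real.exp (-|x| / b) * x) volume
  simp only [abs_neg, mul_neg] at this
  rw [integral_neg] at this
  linarith

/-- The tail `Lap(b) > 2 b` has probability `exp (-2) / 2`. -/
theorem laplace_tail {b : ℝ} (hb : 0 < b) :
    ∫ x, (Set.Ioi (2 * b)).indicator (fun _ => (1 : ℝ)) x ∂laplace b ≤ 7 / 100 := by
  rw [integral_laplace hb]
  have h2 : -1 / b < 0 := div_neg_of_neg_of_pos (by norm_num) hb
  have : (fun x => 1 / (2 * b) * Real.exp (-|x| / b) *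
      (Set.Ioi (2 * b)).indicator (fun _ => (1 : ℝ)) x) =
      (Set.Ioi (2 * b)).indicator fun x => 1 / (2 * b) * Real.exp (-1 / b * x) := by
    funext x
    by_cases hx : x ∈ Set.Ioi (2 * b)
    · have : 0 < x := lt_trans (by positivity) (Set.mem_Ioi.mp hx)
      simp only [hx, Set.indicator_of_mem, mul_one, abs_of_pos this]
      congr 2; ring
    · simp [hx]
  rw [this, integral_indicator measurableSet_Ioi, integral_const_mul, integral_exp_mul_Ioi h2]
  have e : -1 / b * (2 * b) = -(1 + 1) := by field_simp; norm_num
  have e1 := Real.exp_one_gt_d9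
  have e2 : 7.3 < Real.exp (1 + 1) := by rw [Real.exp_add]; nlinarith
  have e3 : Real.exp (-(1 + 1)) < 14 / 100 := by
    rw [Real.exp_neg, inv_lt_comm₀ (by positivity) (by norm_num)]
    exact lt_trans (by norm_num) e2
  have e4 : 1 / (2 * b) * (-Real.exp (-1 / b * (2 * b)) / (-1 / b)) =
      Real.exp (-(1 + 1)) / 2 := by
    rw [e]; field_simp
  rw [e4]; linarith

/-- Translating the Laplace distribution changes its density by a factor of at most
`exp (|δ| / b)`. -/
theorem laplace_translate {b : ℝ} (hb : 0 < b) (δ : ℝ) {A : Set ℝ} (hA : MeasurableSet A) :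
    laplace b ((fun x => x + δ) ⁻¹' A) ≤ ENNReal.ofReal (Real.exp (|δ| / b)) * laplace b A := by
  have hA' : MeasurableSet ((fun x => x + δ) ⁻¹' A) := hA.preimage (by fun_prop)
  rw [laplace_of_pos hb, withDensity_apply _ hA', withDensity_apply _ hA,
    ← lintegral_indicator hA', ← lintegral_indicator hA,
    ← lintegral_const_mul _ (Measurable.indicator (by fun_prop) hA),
    ← lintegral_add_right_eq_self (fun x => ENNReal.ofReal (Real.exp (|δ| / b)) * _) δ]
  refine lintegral_mono fun x => ?_
  by_cases hx : x + δ ∈ A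
  · rw [Set.indicator_of_mem (by exact hx), Set.indicator_of_mem hx,
      ← ENNReal.ofReal_mul (by positivity)]
    refine ENNReal.ofReal_le_ofReal ?_
    rw [mul_left_comm, ← Real.exp_add]
    refine mul_le_mul_of_nonneg_left (Real.exp_le_exp.mpr ?_) (by positivity)
    rw [← add_div, div_le_div_iff_of_pos_right hb]
    linarith [abs_add_le x δ]
  · rw [Set.indicator_of_notMem (by exact hx)]
    exact zero_le

/-! ### Values and step counts of the subroutines -/

section Unfold

variable {d : ℕ}

theorem countPoints_val (P : List (Pt d)) : (countPoints P).val = P.length := by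
  induction P with
  | nil => rfl
  | cons p P ih => exact congrArg Nat.succ ih

theorem countPoints_steps (P : List (Pt d)) : (countPoints P).steps = 2 * P.length + 1 := by
  induction P with
  | nil => rfl
  | cons p P ih =>
    change 2 + ((countPoints P).steps + 0) = _
    rw [ih, List.length_cons]; ring

theorem partitionPoints_val (j : Fin d) (x : ℝ) (P : List (Pt d)) :
    (partitionPoints j x P).val =
      (P.filter fun p => (!decide (p j ≤ x)) == false,
        P.filter fun p => (!decide (p j ≤ x)) == true) := by
  induction P with
  | nil => rfl
  | cons p P ih =>
    change (ite _ _ _ : Timed _).val = _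
    rw [ih]
    by_cases h : p j ≤ x
    · rw [if_pos h]; simp [h, pure]
    · rw [if_neg h]; simp [h, pure]

theorem partitionPoints_steps (j : Fin d) (x : ℝ) (P : List (Pt d)) :
    (partitionPoints j x P).steps = 4 * P.length + 1 := by
  induction P with
  | nil => rfl
  | cons p P ih =>
    have h : ∀ r : List (Pt d) × List (Pt d),
        (if p j ≤ x then pure (p :: r.1, r.2) else pure (r.1, p :: r.2) :
          Timed (List (Pt d) × List (Pt d))).steps = 0 := by
      intro r; split_ifs <;> rfl
    change 4 + ((partitionPoints j x P).steps + (ite _ _ _ : Timed _).steps) = _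
    rw [h, ih, List.length_cons]; ring

theorem argmin_spec (f : ℕ → ℝ) (m : ℕ) :
    (argmin f m).val.2 = f (argmin f m).val.1 ∧ ∀ i ≤ m, (argmin f m).val.2 ≤ f i := by
  induction m with
  | zero =>
    refine ⟨rfl, fun i hi => ?_⟩
    rw [Nat.le_zero.mp hi]; exact le_rfl
  | succ m ih =>
    have e : (argmin f (m + 1)).val =
        if f (m + 1) < (argmin f m).val.2 then (m + 1, f (m + 1)) else (argmin f m).val := by
      change (ite _ _ _ : Timed _).val = _
      split_ifs <;> rfl
    rw [e]
    split_ifs with h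
    · refine ⟨rfl, fun i hi => ?_⟩
      rcases Nat.le_succ_iff.mp hi with hi | rfl
      · exact h.le.trans (ih.2 i hi)
      · exact le_rfl
    · refine ⟨ih.1, fun i hi => ?_⟩
      rcases Nat.le_succ_iff.mp hi with hi | rfl
      · exact ih.2 i hi
      · exact not_lt.mp h

theorem argmin_steps (f : ℕ → ℝ) (m : ℕ) : (argmin f m).steps = 8 * (m + 1) := by
  induction m with
  | zero => rfl
  | succ m ih =>
    change (argmin f m).steps + (8 + (ite _ _ _ : Timed _).steps) = _
    rw [ih]
    split_ifs <;> change _ + (8 + 0) = _ <;> ring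

theorem leafTable_val_zero (k : ℕ) (c : Cell d) (w : ℝ) :
    (leafTable k c w).val 0 = (w * c.diam, []) := rfl

theorem leafTable_val (k : ℕ) (c : Cell d) (w : ℝ) {k' : ℕ} (hk : k' ≠ 0) :
    (leafTable k c w).val k' = (0, List.replicate k' c) := by
  simp [leafTable, tabulate, hk]

theorem innerTable_val_zero (k : ℕ) (c : Cell d) (w : ℝ) (V₁ V₂ : ℕ → ℝ × List (Cell d)) :
    (innerTable k c w V₁ V₂).val 0 = (w * c.diam, []) := rfl

theorem innerTable_val (k : ℕ) (c : Cell d) (w : ℝ) (V₁ V₂ : ℕ → ℝ × List (Cell d))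
    {k' : ℕ} (hk : k' ≠ 0) :
    (innerTable k c w V₁ V₂).val k' =
      ((argmin (fun i => (V₁ i).1 + (V₂ (k' - i)).1) k').val.2,
        (V₁ (argmin (fun i => (V₁ i).1 + (V₂ (k' - i)).1) k').val.1).2 ++
        (V₂ (k' - (argmin (fun i => (V₁ i).1 + (V₂ (k' - i)).1) k').val.1)).2) := by
  simp only [innerTable, tabulate, if_neg hk]; rfl

theorem leafTable_steps (k : ℕ) (c : Cell d) (w : ℝ) :
    (leafTable k c w).steps = 7 + ∑ i ∈ Finset.range k, (i + 5) := by
  simp only [leafTable, tabulate]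
  rw [Finset.sum_range_succ', add_comm]
  simp [add_assoc]

theorem innerTable_steps (k : ℕ) (c : Cell d) (w : ℝ) (V₁ V₂ : ℕ → ℝ × List (Cell d)) :
    (innerTable k c w V₁ V₂).steps = 7 + ∑ i ∈ Finset.range k, (8 * (i + 2) +
      2 * (V₁ (argmin (fun j => (V₁ j).1 + (V₂ (i + 1 - j)).1) (i + 1)).val.1).2.length + 7) := by
  simp only [innerTable, tabulate]
  rw [Finset.sum_range_succ', add_comm]
  congr 1
  refine Finset.sum_congr rfl fun i _ => ?_
  rw [if_neg (Nat.succ_ne_zero i)]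
  change (argmin _ _).steps + (2 * _ + 6 + 0) + 1 = _
  rw [argmin_steps]
  ring

theorem dynamicProgram_pruned (k : ℕ) (b : ℝ) (c : Cell d) :
    dynamicProgram k b (.pruned c) = ⟨(leafTable k c 0).val, 3 + (leafTable k c 0).steps⟩ := rfl

theorem dynamicProgram_node_of_lt (k : ℕ) (b : ℝ) (c : Cell d) (w : ℝ) (l r : CountTree d)
    (h : w < 2 * b) :
    dynamicProgram k b (.node c w l r) =
      ⟨(leafTable k c w).val, 3 + (leafTable k c w).steps⟩ := by
  rw [dynamicProgram, if_pos h]; rfl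

theorem dynamicProgram_node_of_le (k : ℕ) (b : ℝ) (c : Cell d) (w : ℝ) (l r : CountTree d)
    (h : ¬ w < 2 * b) :
    dynamicProgram k b (.node c w l r) =
      ⟨(innerTable k c w (dynamicProgram k b l).val (dynamicProgram k b r).val).val,
        3 + ((dynamicProgram k b l).steps + ((dynamicProgram k b r).steps +
        (innerTable k c w (dynamicProgram k b l).val (dynamicProgram k b r).val).steps))⟩ := by
  rw [dynamicProgram, if_neg h]; rfl

theorem writeCenters_val (cs : List (Cell d)) :
    (writeCenters cs).val = cs.map Cell.center := by
  induction cs with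
  | nil => rfl
  | cons c cs ih => exact congrArg (c.center :: ·) ih

theorem writeCenters_steps (cs : List (Cell d)) :
    (writeCenters cs).steps = cs.length * (d * (2 * accessCost d + 3) + 2) + 1 := by
  induction cs with
  | nil => simp [writeCenters]
  | cons c cs ih =>
    change d * (2 * accessCost d + 3) + 2 + ((writeCenters cs).steps + 0) = _
    rw [ih, List.length_cons]; ring

/-! ### The recursion for the tables of the dynamic program -/

variable [NeZero d]

/-- The coordinate perpendicular to which a cell is cut. -/
def Cell.axis (c : Cell d) : Fin d := Fin.ofNat d c.depth

/-- The position at which a cell is cut. -/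
noncomputable def Quadtree.cutPos (T : Quadtree d) (c : Cell d) : ℝ :=
  c.lo c.axis + T.cut c.name * (c.hi c.axis - c.lo c.axis)

/-- The two children of a cell: `false` for the part below the cut, `true` for the other one. -/
noncomputable def Quadtree.child (T : Quadtree d) (c : Cell d) : Bool → Cell d
  | false => ⟨false :: c.name, c.depth + 1, c.lo, Function.update c.hi c.axis (T.cutPos c),
      c.diamSq - (c.hi c.axis - c.lo c.axis) ^ 2 + (T.cutPos c - c.lo c.axis) ^ 2⟩
  | true => ⟨true :: c.name, c.depth + 1, Function.update c.lo c.axis (T.cutPos c), c.hi,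
      c.diamSq - (c.hi c.axis - c.lo c.axis) ^ 2 + (c.hi c.axis - T.cutPos c) ^ 2⟩

/-- The side of the cut of the cell `c` on which the point `p` lies, i.e. the child it goes to. -/
noncomputable def Quadtree.side (T : Quadtree d) (c : Cell d) (p : Pt d) : Bool :=
  !decide (p c.axis ≤ T.cutPos c)

/-- The points of a list that go to the child `a` of the cell `c`. -/
noncomputable def Quadtree.part (T : Quadtree d) (c : Cell d) (P : List (Pt d)) (a : Bool) :
    List (Pt d) :=
  P.filter fun p => T.side c p == a

@[simp] theorem child_name (T : Quadtree d) (c : Cell d) (a : Bool) :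
    (T.child c a).name = a :: c.name := by cases a <;> rfl

@[simp] theorem child_depth (T : Quadtree d) (c : Cell d) (a : Bool) :
    (T.child c a).depth = c.depth + 1 := by cases a <;> rfl

variable (n k : ℕ) (Λ b : ℝ) (T : Quadtree d) (noise : List Bool → ℝ)

theorem makePrivate_of_diam_le (m : ℕ) (c : Cell d) (P : List (Pt d)) (h : ¬ Λ / n < c.diam) :
    makePrivate n Λ b T noise (m + 1) c P = ⟨.pruned c, 3⟩ := by
  rw [makePrivate, if_neg h]; rfl

/-- The noisy count of a cell. -/
noncomputable def weight (noise : List Bool → ℝ) (c : Cell d) (P : List (Pt d)) : ℝ :=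
  (P.length : ℝ) + noise c.name

theorem makePrivate_of_weight_le (m : ℕ) (c : Cell d) (P : List (Pt d)) (h : Λ / n < c.diam)
    (hw : ¬ 2 * b < weight noise c P) :
    makePrivate n Λ b T noise (m + 1) c P =
      ⟨.node c (weight noise c P) (.pruned (T.child c false)) (.pruned (T.child c true)),
        40 + 2 * P.length + 4 * accessCost d⟩ := by
  rw [makePrivate, if_pos h]
  change Timed.mk (ite _ _ _ : Timed _).val (3 + ((countPoints P).steps + (3 +
    ((4 * accessCost d + 30 + 0) + (3 + (ite _ _ _ : Timed _).steps))))) = _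
  rw [countPoints_val, countPoints_steps]
  have hw' : ¬ 2 * b < (P.length : ℝ) + noise c.name := hw
  rw [if_neg hw']
  congr 1
  change 3 + ((2 * P.length + 1) + (3 + ((4 * accessCost d + 30 + 0) + (3 + 0)))) = _
  ring

theorem makePrivate_of_lt_weight (m : ℕ) (c : Cell d) (P : List (Pt d)) (h : Λ / n < c.diam)
    (hw : 2 * b < weight noise c P) :
    makePrivate n Λ b T noise (m + 1) c P =
      ⟨.node c (weight noise c P)
          (makePrivate n Λ b T noise m (T.child c false) (T.part c P false)).val
          (makePrivate n Λ b T noise m (T.child c true) (T.part c P true)).val,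
        41 + 6 * P.length + 4 * accessCost d +
          (makePrivate n Λ b T noise m (T.child c false) (T.part c P false)).steps +
          (makePrivate n Λ b T noise m (T.child c true) (T.part c P true)).steps⟩ := by
  rw [makePrivate, if_pos h]
  change Timed.mk (ite _ _ _ : Timed _).val (3 + ((countPoints P).steps + (3 +
    ((4 * accessCost d + 30 + 0) + (3 + (ite _ _ _ : Timed _).steps))))) = _
  rw [countPoints_val, countPoints_steps]
  have hw' : 2 * b < (P.length : ℝ) + noise c.name := hw
  rw [if_pos hw']
  have e := partitionPoints_val c.axis (T.cutPos c) P
  have e₁ : (partitionPoints c.axis (T.cutPos c) P).val.1 = T.part c P false := by rw [e]; rfl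
  have e₂ : (partitionPoints c.axis (T.cutPos c) P).val.2 = T.part c P true := by rw [e]; rfl
  change Timed.mk (CountTree.node c (weight noise c P)
      (makePrivate n Λ b T noise m (T.child c false)
        (partitionPoints c.axis (T.cutPos c) P).val.1).val
      (makePrivate n Λ b T noise m (T.child c true)
        (partitionPoints c.axis (T.cutPos c) P).val.2).val)
    (3 + ((2 * P.length + 1) + (3 + ((4 * accessCost d + 30 + 0) + (3 +
      ((partitionPoints c.axis (T.cutPos c) P).steps +
      ((makePrivate n Λ b T noise m (T.child c false)
        (partitionPoints c.axis (T.cutPos c) P).val.1).steps +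
      ((makePrivate n Λ b T noise m (T.child c true)
        (partitionPoints c.axis (T.cutPos c) P).val.2).steps + 0)))))))) = _
  rw [e₁, e₂, partitionPoints_steps]
  congr 1
  ring

/-- The table computed for a cell by the private counts followed by the dynamic program. -/
noncomputable def table (m : ℕ) (c : Cell d) (P : List (Pt d)) : ℕ → ℝ × List (Cell d) :=
  (dynamicProgram k b (makePrivate n Λ b T noise m c P).val).val

/-- The number of steps spent on a cell and its descendants. -/
noncomputable def tableSteps (m : ℕ) (c : Cell d) (P : List (Pt d)) : ℕ :=
  (makePrivate n Λ b T noise m c P).steps +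
    (dynamicProgram k b (makePrivate n Λ b T noise m c P).val).steps

theorem table_zero (c : Cell d) (P : List (Pt d)) :
    table n k Λ b T noise 0 c P = (leafTable k c 0).val := rfl

theorem table_of_diam_le (m : ℕ) (c : Cell d) (P : List (Pt d)) (h : ¬ Λ / n < c.diam) :
    table n k Λ b T noise (m + 1) c P = (leafTable k c 0).val := by
  rw [table, makePrivate_of_diam_le n Λ b T noise m c P h]; rfl

theorem table_of_weight_lt (m : ℕ) (c : Cell d) (P : List (Pt d)) (h : Λ / n < c.diam)
    (hw : weight noise c P < 2 * b) :
    table n k Λ b T noise (m + 1) c P = (leafTable k c (weight noise c P)).val := by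
  rw [table, makePrivate_of_weight_le n Λ b T noise m c P h hw.not_gt,
    dynamicProgram_node_of_lt k b _ _ _ _ hw]

theorem table_of_weight_eq (m : ℕ) (c : Cell d) (P : List (Pt d)) (h : Λ / n < c.diam)
    (hw : weight noise c P = 2 * b) :
    table n k Λ b T noise (m + 1) c P =
      (innerTable k c (weight noise c P) (leafTable k (T.child c false) 0).val
        (leafTable k (T.child c true) 0).val).val := by
  rw [table, makePrivate_of_weight_le n Λ b T noise m c P h hw.not_gt,
    dynamicProgram_node_of_le k b _ _ _ _ hw.not_lt]
  rfl

theorem table_of_lt_weight (m : ℕ) (c : Cell d) (P : List (Pt d)) (h : Λ / n < c.diam)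
    (hw : 2 * b < weight noise c P) :
    table n k Λ b T noise (m + 1) c P =
      (innerTable k c (weight noise c P)
        (table n k Λ b T noise m (T.child c false) (T.part c P false))
        (table n k Λ b T noise m (T.child c true) (T.part c P true))).val := by
  rw [table, makePrivate_of_lt_weight n Λ b T noise m c P h hw,
    dynamicProgram_node_of_le k b _ _ _ _ hw.not_gt]
  rfl

theorem table_length (m : ℕ) (c : Cell d) (P : List (Pt d)) (k' : ℕ) :
    (table n k Λ b T noise m c P k').2.length = k' :=
  dynamicProgram_length _ _ _ _

theorem tableSteps_zero (c : Cell d) (P : List (Pt d)) :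
    tableSteps n k Λ b T noise 0 c P = 4 + (leafTable k c 0).steps := by
  change 1 + (3 + (leafTable k c 0).steps) = _; ring

theorem tableSteps_of_diam_le (m : ℕ) (c : Cell d) (P : List (Pt d)) (h : ¬ Λ / n < c.diam) :
    tableSteps n k Λ b T noise (m + 1) c P = 6 + (leafTable k c 0).steps := by
  rw [tableSteps, makePrivate_of_diam_le n Λ b T noise m c P h]
  change 3 + (3 + (leafTable k c 0).steps) = _; ring

theorem tableSteps_of_weight_lt (m : ℕ) (c : Cell d) (P : List (Pt d)) (h : Λ / n < c.diam)
    (hw : weight noise c P < 2 * b) :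
    tableSteps n k Λ b T noise (m + 1) c P =
      43 + 2 * P.length + 4 * accessCost d + (leafTable k c (weight noise c P)).steps := by
  rw [tableSteps, makePrivate_of_weight_le n Λ b T noise m c P h hw.not_gt,
    dynamicProgram_node_of_lt k b _ _ _ _ hw]
  ring

theorem tableSteps_of_weight_eq (m : ℕ) (c : Cell d) (P : List (Pt d)) (h : Λ / n < c.diam)
    (hw : weight noise c P = 2 * b) :
    tableSteps n k Λ b T noise (m + 1) c P =
      49 + 2 * P.length + 4 * accessCost d + (leafTable k (T.child c false) 0).steps +
        (leafTable k (T.child c true) 0).steps +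
      (innerTable k c (weight noise c P) (leafTable k (T.child c false) 0).val
        (leafTable k (T.child c true) 0).val).steps := by
  rw [tableSteps, makePrivate_of_weight_le n Λ b T noise m c P h hw.not_gt,
    dynamicProgram_node_of_le k b _ _ _ _ hw.not_lt, dynamicProgram_pruned, dynamicProgram_pruned]
  ring

theorem tableSteps_of_lt_weight (m : ℕ) (c : Cell d) (P : List (Pt d)) (h : Λ / n < c.diam)
    (hw : 2 * b < weight noise c P) :
    tableSteps n k Λ b T noise (m + 1) c P =
      44 + 6 * P.length + 4 * accessCost d +
        tableSteps n k Λ b T noise m (T.child c false) (T.part c P false) +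
        tableSteps n k Λ b T noise m (T.child c true) (T.part c P true) +
      (innerTable k c (weight noise c P)
        (table n k Λ b T noise m (T.child c false) (T.part c P false))
        (table n k Λ b T noise m (T.child c true) (T.part c P true))).steps := by
  simp only [tableSteps, table]
  rw [makePrivate_of_lt_weight n Λ b T noise m c P h hw,
    dynamicProgram_node_of_le k b _ _ _ _ hw.not_gt]
  ring

/-- The root cell of a quadtree. -/
def Quadtree.rootCell (T : Quadtree d) : Cell d :=
  ⟨[], 0, T.lo, T.hi, ∑ j, (T.hi j - T.lo j) ^ 2⟩

theorem dpKMedian_val (ε : ℝ) (P : List (Pt d)) :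
    (dpKMedian n k Λ ε T noise P).val =
      (table n k Λ (noiseScale d n ε) T noise (d * rounds d n) T.rootCell P k).2.map
        Cell.center :=
  writeCenters_val _

theorem dpKMedian_steps (ε : ℝ) (P : List (Pt d)) :
    (dpKMedian n k Λ ε T noise P).steps =
      2 * rounds d n + 28 + d * (2 * accessCost d + 4) +
        tableSteps n k Λ (noiseScale d n ε) T noise (d * rounds d n) T.rootCell P +
        k * (d * (2 * accessCost d + 3) + 2) := by
  change 2 * rounds d n + 20 + ((d * (2 * accessCost d + 4) + 5 + 0) +
    ((makePrivate n Λ (noiseScale d n ε) T noise (d * rounds d n) T.rootCell P).steps +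
    ((dynamicProgram k (noiseScale d n ε)
      (makePrivate n Λ (noiseScale d n ε) T noise (d * rounds d n) T.rootCell P).val).steps +
    (2 + (writeCenters (table n k Λ (noiseScale d n ε) T noise (d * rounds d n)
      T.rootCell P k).2).steps)))) = _
  rw [writeCenters_steps, table_length, tableSteps]
  ring

theorem centers_apply (ε : ℝ) (P : List (Pt d)) (ω : Quadtree d × (List Bool → ℝ)) (i : Fin k) :
    centers n k Λ ε P ω i =
      ((table n k Λ (noiseScale d n ε) ω.1 ω.2 (d * rounds d n) ω.1.rootCell P k).2.get
        (i.cast (table_length ..).symm)).center := by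
  simp only [centers, List.get_eq_getElem]
  simp [dpKMedian_val]

theorem part_length (c : Cell d) (P : List (Pt d)) :
    (T.part c P false).length + (T.part c P true).length = P.length := by
  induction P with
  | nil => rfl
  | cons p P ih =>
    unfold Quadtree.part at ih ⊢
    cases h : T.side c p <;> simp [h] at ih ⊢ <;> omega

end Unfold

/-! ### Measurability of the algorithm -/

section Measurability

variable {Ω : Type*} [MeasurableSpace Ω] {d : ℕ}

/-- A function that is chosen among measurable ones by a parameter with countably many values is
measurable. -/
theorem measurable_of_countable_parameter {α β : Type*} [MeasurableSpace β] {Q : Ω → α}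
    {R : Set α} (hR : R.Countable) (hQR : ∀ ω, Q ω ∈ R) (hQ : ∀ a, MeasurableSet {ω | Q ω = a})
    {f : α → Ω → β} (hf : ∀ a, Measurable (f a)) : Measurable fun ω => f (Q ω) ω := by
  intro B hB
  have : (fun ω => f (Q ω) ω) ⁻¹' B = ⋃ a ∈ R, {ω | Q ω = a} ∩ f a ⁻¹' B := by
    ext ω
    simp only [Set.mem_preimage, Set.mem_iUnion, Set.mem_inter_iff, Set.mem_ofPred_eq]
    constructor
    · intro h; exact ⟨Q ω, hQR ω, rfl, h⟩
    · rintro ⟨a, _, rfl, h⟩; exact h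
  rw [this]
  exact MeasurableSet.biUnion hR fun a _ => (hQ a).inter (hf a hB)

theorem measurable_argmin {f : Ω → ℕ → ℝ} (hf : ∀ i, Measurable fun ω => f ω i) (m : ℕ) :
    Measurable fun ω => (argmin (f ω) m).val := by
  induction m with
  | zero => exact measurable_const.prodMk (hf 0)
  | succ m ih =>
    have : (fun ω => (argmin (f ω) (m + 1)).val) = fun ω =>
        if f ω (m + 1) < (argmin (f ω) m).val.2 then (m + 1, f ω (m + 1))
        else (argmin (f ω) m).val := by
      funext ω
      change (ite _ _ _ : Timed _).val = _
      split_ifs <;> rfl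
    rw [this]
    exact Measurable.ite (measurableSet_lt (hf _) ih.snd) (measurable_const.prodMk (hf _)) ih

/-- A random cell with a fixed name and depth, whose box and diameter are measurable. -/
structure MeasurableCell (c : Ω → Cell d) : Prop where
  name : ∃ s, ∀ ω, (c ω).name = s
  depth : ∃ t, ∀ ω, (c ω).depth = t
  lo : Measurable fun ω => (c ω).lo
  hi : Measurable fun ω => (c ω).hi
  diamSq : Measurable fun ω => (c ω).diamSq

theorem MeasurableCell.diam {c : Ω → Cell d} (hc : MeasurableCell c) :
    Measurable fun ω => (c ω).diam := hc.diamSq.sqrt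

theorem MeasurableCell.center {c : Ω → Cell d} (hc : MeasurableCell c) :
    Measurable fun ω => (c ω).center := by
  refine (WithLp.measurable_toLp 2 _).comp (measurable_pi_lambda _ fun j => ?_)
  exact (((measurable_pi_apply j).comp hc.lo).add ((measurable_pi_apply j).comp hc.hi)).div_const 2

/-- A random table of the dynamic program whose values and whose centers are measurable. -/
structure MeasurableTable (V : Ω → ℕ → ℝ × List (Cell d)) : Prop where
  value : ∀ i, Measurable fun ω => (V ω i).1
  length : ∀ i ω, (V ω i).2.length = i
  center : ∀ i l, Measurable fun ω => ((V ω i).2.map Cell.center).getD l 0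

theorem MeasurableTable.ite {V W : Ω → ℕ → ℝ × List (Cell d)} {p : Ω → Prop} [DecidablePred p]
    (hp : MeasurableSet {ω | p ω}) (hV : MeasurableTable V) (hW : MeasurableTable W) :
    MeasurableTable fun ω => if p ω then V ω else W ω := by
  refine ⟨fun i => ?_, fun i ω => ?_, fun i l => ?_⟩
  · have : (fun ω => ((if p ω then V ω else W ω) i).1) =
        fun ω => if p ω then (V ω i).1 else (W ω i).1 := by
      funext ω; split_ifs <;> rfl
    rw [this]; exact Measurable.ite hp (hV.value i) (hW.value i)
  · split_ifs
    · exact hV.length i ω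
    · exact hW.length i ω
  · have : (fun ω => (((if p ω then V ω else W ω) i).2.map Cell.center).getD l 0) =
        fun ω => if p ω then ((V ω i).2.map Cell.center).getD l 0
          else ((W ω i).2.map Cell.center).getD l 0 := by
      funext ω; split_ifs <;> rfl
    rw [this]; exact Measurable.ite hp (hV.center i l) (hW.center i l)

theorem MeasurableTable.of_countable_parameter {α : Type*} {Q : Ω → α} {R : Set α}
    (hR : R.Countable) (hQR : ∀ ω, Q ω ∈ R) (hQ : ∀ a, MeasurableSet {ω | Q ω = a})
    {V : α → Ω → ℕ → ℝ × List (Cell d)} (hV : ∀ a, MeasurableTable (V a)) :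
    MeasurableTable fun ω => V (Q ω) ω :=
  ⟨fun i => measurable_of_countable_parameter (f := fun a ω => (V a ω i).1) hR hQR hQ
      fun a => (hV a).value i,
    fun i ω => (hV (Q ω)).length i ω,
    fun i l => measurable_of_countable_parameter
      (f := fun a ω => ((V a ω i).2.map Cell.center).getD l 0) hR hQR hQ
      fun a => (hV a).center i l⟩

theorem measurableTable_leafTable (k : ℕ) {c : Ω → Cell d} (hc : MeasurableCell c) {w : Ω → ℝ}
    (hw : Measurable w) : MeasurableTable fun ω => (leafTable k (c ω) (w ω)).val := by
  refine ⟨fun i => ?_, fun i ω => leafTable_length _ _ _ _, fun i l => ?_⟩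
  · rcases eq_or_ne i 0 with rfl | hi
    · exact hw.mul hc.diam
    · simp only [leafTable_val _ _ _ hi]; exact measurable_const
  · rcases eq_or_ne i 0 with rfl | hi
    · simp only [leafTable_val_zero]; exact measurable_const
    · simp only [leafTable_val _ _ _ hi, List.map_replicate]
      by_cases hl : l < i
      · have : ∀ ω, (List.replicate i (c ω).center).getD l 0 = (c ω).center := fun ω => by
          simp [List.getD_eq_getElem?_getD, hl]
        simp only [this]; exact hc.center
      · have : ∀ ω, (List.replicate i (c ω).center).getD l 0 = 0 := fun ω => by
          simp [List.getD_eq_getElem?_getD, hl]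
        simp only [this]; exact measurable_const

theorem measurableTable_innerTable (k : ℕ) {c : Ω → Cell d} (hc : MeasurableCell c) {w : Ω → ℝ}
    (hw : Measurable w) {V₁ V₂ : Ω → ℕ → ℝ × List (Cell d)} (h₁ : MeasurableTable V₁)
    (h₂ : MeasurableTable V₂) :
    MeasurableTable fun ω => (innerTable k (c ω) (w ω) (V₁ ω) (V₂ ω)).val := by
  have hbest : ∀ i, Measurable fun ω =>
      (argmin (fun j => (V₁ ω j).1 + (V₂ ω (i - j)).1) i).val := fun i =>
    measurable_argmin (fun j => (h₁.value j).add (h₂.value (i - j))) i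
  refine ⟨fun i => ?_, fun i ω => ?_, fun i l => ?_⟩
  · rcases eq_or_ne i 0 with rfl | hi
    · exact hw.mul hc.diam
    · simp only [innerTable_val _ _ _ _ _ hi]; exact (hbest i).snd
  · rcases eq_or_ne i 0 with rfl | hi
    · rfl
    · simp only [innerTable_val _ _ _ _ _ hi, List.length_append, h₁.length, h₂.length]
      exact Nat.add_sub_cancel' (argmin_le _ _)
  · rcases eq_or_ne i 0 with rfl | hi
    · simp only [innerTable_val_zero]; exact measurable_const
    · simp only [innerTable_val _ _ _ _ _ hi, List.map_append]
      refine measurable_of_countable_parameter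
        (Q := fun ω => (argmin (fun j => (V₁ ω j).1 + (V₂ ω (i - j)).1) i).val.1)
        (f := fun a ω => (((V₁ ω a).2.map Cell.center) ++
          ((V₂ ω (i - a)).2.map Cell.center)).getD l 0)
        Set.countable_univ (fun _ => Set.mem_univ _)
        (fun a => (hbest i).fst (measurableSet_singleton a)) fun a => ?_
      by_cases hl : l < a
      · have : ∀ ω, (((V₁ ω a).2.map Cell.center) ++
            ((V₂ ω (i - a)).2.map Cell.center)).getD l 0 =
            ((V₁ ω a).2.map Cell.center).getD l 0 := fun ω =>
          List.getD_append _ _ _ _ (by simpa [h₁.length] using hl)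
        simp only [this]; exact h₁.center a l
      · have : ∀ ω, (((V₁ ω a).2.map Cell.center) ++
            ((V₂ ω (i - a)).2.map Cell.center)).getD l 0 =
            ((V₂ ω (i - a)).2.map Cell.center).getD (l - a) 0 := fun ω => by
          rw [List.getD_append_right _ _ _ _ (by simpa [h₁.length] using hl)]
          simp [h₁.length]
        simp only [this]; exact h₂.center (i - a) (l - a)

theorem measurable_innerTable_steps (k : ℕ) {c : Ω → Cell d} {w : Ω → ℝ}
    {V₁ V₂ : Ω → ℕ → ℝ × List (Cell d)} (h₁ : MeasurableTable V₁) (h₂ : MeasurableTable V₂) :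
    Measurable fun ω => (innerTable k (c ω) (w ω) (V₁ ω) (V₂ ω)).steps := by
  simp only [innerTable_steps, h₁.length]
  refine measurable_const.add (Finset.measurable_sum _ fun i _ => ?_)
  have := (measurable_argmin (f := fun ω j => (V₁ ω j).1 + (V₂ ω (i + 1 - j)).1)
    (fun j => (h₁.value j).add (h₂.value (i + 1 - j))) (i + 1)).fst
  exact (measurable_const.add (this.const_mul 2)).add measurable_const

theorem measurable_quadtree {T : Ω → Quadtree d} (hT : Measurable T) :
    Measurable (fun ω => (T ω).lo) ∧ Measurable (fun ω => (T ω).hi) ∧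
      Measurable fun ω => (T ω).cut := by
  have h : Measurable fun T : Quadtree d => (T.lo, T.hi, T.cut) := comap_measurable _
  exact ⟨(h.comp hT).fst, (h.comp hT).snd.fst, (h.comp hT).snd.snd⟩

theorem measurableSet_filter_eq {α : Type*} {f : Ω → α → Bool}
    (hf : ∀ p, MeasurableSet {ω | f ω p = true}) (P L : List α) :
    MeasurableSet {ω | P.filter (f ω) = L} := by
  induction P generalizing L with
  | nil =>
    simp only [List.filter_nil]
    exact MeasurableSet.const _
  | cons p P ih =>
    have : {ω | (p :: P).filter (f ω) = L} =
        {ω | f ω p = true} ∩ {ω | p :: P.filter (f ω) = L} ∪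
          {ω | f ω p = true}ᶜ ∩ {ω | P.filter (f ω) = L} := by
      ext ω
      cases h : f ω p <;> simp [h]
    rw [this]
    refine ((hf p).inter ?_).union ((hf p).compl.inter (ih L))
    cases L with
    | nil => simp
    | cons a L =>
      by_cases h : p = a
      · simpa [h] using ih L
      · simp [h]

theorem countable_sublists (P : List (Pt d)) : {L | L ∈ P.sublists}.Countable :=
  (List.finite_toSet _).countable

theorem measurableCell_rootCell :
    MeasurableCell fun ω : Quadtree d × (List Bool → ℝ) => ω.1.rootCell := by
  obtain ⟨h₁, h₂, -⟩ := measurable_quadtree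
    (measurable_fst : Measurable fun ω : Quadtree d × (List Bool → ℝ) => ω.1)
  refine ⟨⟨[], fun _ => rfl⟩, ⟨0, fun _ => rfl⟩, h₁, h₂, ?_⟩
  refine Finset.measurable_sum Finset.univ (f := fun j (ω : Quadtree d × (List Bool → ℝ)) =>
    (ω.1.hi j - ω.1.lo j) ^ 2) fun j _ =>
    (((measurable_pi_apply j).comp h₂).sub ((measurable_pi_apply j).comp h₁)).pow_const 2

variable [NeZero d]

theorem MeasurableCell.axis {c : Ω → Cell d} (hc : MeasurableCell c) :
    ∃ j, ∀ ω, (c ω).axis = j := by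
  obtain ⟨t, ht⟩ := hc.depth
  exact ⟨Fin.ofNat d t, fun ω => by rw [Cell.axis, ht]⟩

theorem MeasurableCell.cutPos {c : Ω → Cell d} (hc : MeasurableCell c) {T : Ω → Quadtree d}
    (hT : Measurable T) : Measurable fun ω => (T ω).cutPos (c ω) := by
  obtain ⟨j, hj⟩ := hc.axis
  obtain ⟨s, hs⟩ := hc.name
  have h₁ := (measurable_pi_apply j).comp hc.lo
  have h₂ := (measurable_pi_apply j).comp hc.hi
  have h₃ := (measurable_pi_apply s).comp (measurable_quadtree hT).2.2
  simp only [Quadtree.cutPos, hj, hs]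
  exact h₁.add (h₃.mul (h₂.sub h₁))

theorem MeasurableCell.child {c : Ω → Cell d} (hc : MeasurableCell c) {T : Ω → Quadtree d}
    (hT : Measurable T) (a : Bool) : MeasurableCell fun ω => (T ω).child (c ω) a := by
  obtain ⟨j, hj⟩ := hc.axis
  obtain ⟨s, hs⟩ := hc.name
  obtain ⟨t, ht⟩ := hc.depth
  have h₁ : Measurable fun ω => (c ω).lo j := (measurable_pi_apply j).comp hc.lo
  have h₂ : Measurable fun ω => (c ω).hi j := (measurable_pi_apply j).comp hc.hi
  have h₃ := hc.cutPos hT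
  have hu : ∀ {g : Ω → Fin d → ℝ}, Measurable g →
      Measurable fun ω => Function.update (g ω) j ((T ω).cutPos (c ω)) := by
    intro g hg
    refine measurable_pi_lambda _ fun i => ?_
    by_cases hi : i = j
    · subst hi; simpa using h₃
    · simp only [Function.update_of_ne hi]
      exact (measurable_pi_apply i).comp hg
  refine ⟨⟨a :: s, fun ω => by simp [hs]⟩, ⟨t + 1, fun ω => by simp [ht]⟩, ?_, ?_, ?_⟩ <;>
    cases a <;> simp only [Quadtree.child, hj]
  · exact hc.lo
  · exact hu hc.lo
  · exact hu hc.hi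
  · exact hc.hi
  · exact (hc.diamSq.sub ((h₂.sub h₁).pow_const 2)).add ((h₃.sub h₁).pow_const 2)
  · exact (hc.diamSq.sub ((h₂.sub h₁).pow_const 2)).add ((h₂.sub h₃).pow_const 2)

theorem MeasurableCell.measurableSet_part_eq {c : Ω → Cell d} (hc : MeasurableCell c)
    {T : Ω → Quadtree d} (hT : Measurable T) (P L : List (Pt d)) (a : Bool) :
    MeasurableSet {ω | (T ω).part (c ω) P a = L} := by
  refine measurableSet_filter_eq (f := fun ω p => (T ω).side (c ω) p == a) (fun p => ?_) P L
  obtain ⟨j, hj⟩ := hc.axis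
  have h : MeasurableSet {ω | p j ≤ (T ω).cutPos (c ω)} :=
    measurableSet_le measurable_const (hc.cutPos hT)
  cases a
  · simpa [Quadtree.side, hj] using h
  · convert h.compl using 1
    ext ω
    simp [Quadtree.side, hj]

theorem part_mem_sublists (T : Quadtree d) (c : Cell d) (P : List (Pt d)) (a : Bool) :
    T.part c P a ∈ {L | L ∈ P.sublists} :=
  List.mem_sublists.mpr List.filter_sublist

variable (n k : ℕ) (Λ b : ℝ)

/-- The table and the number of steps are measurable functions of the quadtree and the noise. -/
theorem measurable_table {T : Ω → Quadtree d} (hT : Measurable T) {noise : Ω → List Bool → ℝ}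
    (hN : Measurable noise) (m : ℕ) {c : Ω → Cell d} (hc : MeasurableCell c) (P : List (Pt d)) :
    MeasurableTable (fun ω => table n k Λ b (T ω) (noise ω) m (c ω) P) ∧
      Measurable fun ω => tableSteps n k Λ b (T ω) (noise ω) m (c ω) P := by
  induction m generalizing c P with
  | zero =>
    refine ⟨measurableTable_leafTable k hc measurable_const, ?_⟩
    simp only [tableSteps_zero, leafTable_steps]
    exact measurable_const
  | succ m ih =>
    have hw : Measurable fun ω => weight (noise ω) (c ω) P := by
      obtain ⟨s, hs⟩ := hc.name
      simp only [weight, hs]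
      exact measurable_const.add ((measurable_pi_apply s).comp hN)
    have s₁ : MeasurableSet {ω | Λ / n < (c ω).diam} := measurableSet_lt measurable_const hc.diam
    have s₂ : MeasurableSet {ω | weight (noise ω) (c ω) P < 2 * b} :=
      measurableSet_lt hw measurable_const
    have s₃ : MeasurableSet {ω | weight (noise ω) (c ω) P = 2 * b} :=
      measurableSet_eq_fun hw measurable_const
    have hleaf := measurableTable_leafTable k hc hw
    have hleaf₀ := measurableTable_leafTable k hc (measurable_const (a := (0 : ℝ)))
    have hch : ∀ a, MeasurableTable fun ω =>
        (leafTable k ((T ω).child (c ω) a) 0).val := fun a =>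
      measurableTable_leafTable k (hc.child hT a) measurable_const
    have hsub : ∀ a, MeasurableTable fun ω =>
        table n k Λ b (T ω) (noise ω) m ((T ω).child (c ω) a) ((T ω).part (c ω) P a) := fun a =>
      MeasurableTable.of_countable_parameter
        (V := fun L ω => table n k Λ b (T ω) (noise ω) m ((T ω).child (c ω) a) L)
        (countable_sublists P) (fun ω => part_mem_sublists _ _ _ a)
        (fun L => hc.measurableSet_part_eq hT P L a) fun L => (ih (hc.child hT a) L).1
    have hsub' : ∀ a, Measurable fun ω =>
        tableSteps n k Λ b (T ω) (noise ω) m ((T ω).child (c ω) a) ((T ω).part (c ω) P a) :=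
      fun a => measurable_of_countable_parameter
        (f := fun L ω => tableSteps n k Λ b (T ω) (noise ω) m ((T ω).child (c ω) a) L)
        (countable_sublists P) (fun ω => part_mem_sublists _ _ _ a)
        (fun L => hc.measurableSet_part_eq hT P L a) fun L => (ih (hc.child hT a) L).2
    constructor
    · have e : (fun ω => table n k Λ b (T ω) (noise ω) (m + 1) (c ω) P) = fun ω =>
          if Λ / n < (c ω).diam then
            if weight (noise ω) (c ω) P < 2 * b then
              (leafTable k (c ω) (weight (noise ω) (c ω) P)).val
            else if weight (noise ω) (c ω) P = 2 * b then
              (innerTable k (c ω) (weight (noise ω) (c ω) P)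
                (leafTable k ((T ω).child (c ω) false) 0).val
                (leafTable k ((T ω).child (c ω) true) 0).val).val
            else (innerTable k (c ω) (weight (noise ω) (c ω) P)
              (table n k Λ b (T ω) (noise ω) m ((T ω).child (c ω) false)
                ((T ω).part (c ω) P false))
              (table n k Λ b (T ω) (noise ω) m ((T ω).child (c ω) true)
                ((T ω).part (c ω) P true))).val
          else (leafTable k (c ω) 0).val := by
        funext ω
        split_ifs with h₁ h₂ h₃
        · exact table_of_weight_lt _ _ _ _ _ _ _ _ _ h₁ h₂
        · exact table_of_weight_eq _ _ _ _ _ _ _ _ _ h₁ h₃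
        · exact table_of_lt_weight _ _ _ _ _ _ _ _ _ h₁
            (lt_of_le_of_ne (not_lt.mp h₂) (Ne.symm h₃))
        · exact table_of_diam_le _ _ _ _ _ _ _ _ _ h₁
      rw [e]
      exact .ite s₁ (.ite s₂ hleaf (.ite s₃
        (measurableTable_innerTable k hc hw (hch false) (hch true))
        (measurableTable_innerTable k hc hw (hsub false) (hsub true)))) hleaf₀
    · have e : (fun ω => tableSteps n k Λ b (T ω) (noise ω) (m + 1) (c ω) P) = fun ω =>
          if Λ / n < (c ω).diam then
            if weight (noise ω) (c ω) P < 2 * b then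
              43 + 2 * P.length + 4 * accessCost d +
                (leafTable k (c ω) (weight (noise ω) (c ω) P)).steps
            else if weight (noise ω) (c ω) P = 2 * b then
              49 + 2 * P.length + 4 * accessCost d +
                (leafTable k ((T ω).child (c ω) false) 0).steps +
                (leafTable k ((T ω).child (c ω) true) 0).steps +
              (innerTable k (c ω) (weight (noise ω) (c ω) P)
                (leafTable k ((T ω).child (c ω) false) 0).val
                (leafTable k ((T ω).child (c ω) true) 0).val).steps
            else 44 + 6 * P.length + 4 * accessCost d +
              tableSteps n k Λ b (T ω) (noise ω) m ((T ω).child (c ω) false)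
                ((T ω).part (c ω) P false) +
              tableSteps n k Λ b (T ω) (noise ω) m ((T ω).child (c ω) true)
                ((T ω).part (c ω) P true) +
              (innerTable k (c ω) (weight (noise ω) (c ω) P)
                (table n k Λ b (T ω) (noise ω) m ((T ω).child (c ω) false)
                  ((T ω).part (c ω) P false))
                (table n k Λ b (T ω) (noise ω) m ((T ω).child (c ω) true)
                  ((T ω).part (c ω) P true))).steps
          else 6 + (leafTable k (c ω) 0).steps := by
        funext ω
        split_ifs with h₁ h₂ h₃
        · exact tableSteps_of_weight_lt _ _ _ _ _ _ _ _ _ h₁ h₂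
        · exact tableSteps_of_weight_eq _ _ _ _ _ _ _ _ _ h₁ h₃
        · exact tableSteps_of_lt_weight _ _ _ _ _ _ _ _ _ h₁
            (lt_of_le_of_ne (not_lt.mp h₂) (Ne.symm h₃))
        · exact tableSteps_of_diam_le _ _ _ _ _ _ _ _ _ h₁
      rw [e]
      simp only [leafTable_steps]
      exact .ite s₁ (.ite s₂ measurable_const (.ite s₃
        (measurable_const.add (measurable_innerTable_steps k (hch false) (hch true)))
        (((measurable_const.add (hsub' false)).add (hsub' true)).add
          (measurable_innerTable_steps k (hsub false) (hsub true))))) measurable_const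

theorem measurable_centers (ε : ℝ) (P : List (Pt d)) :
    Measurable (centers n k Λ ε P : Quadtree d × (List Bool → ℝ) → Fin k → Pt d) := by
  refine measurable_pi_lambda _ fun i => ?_
  have h := (measurable_table n k Λ (noiseScale d n ε) measurable_fst measurable_snd
    (d * rounds d n) measurableCell_rootCell P).1.center k i
  convert h using 2 with ω
  rw [centers_apply, List.getD_eq_getElem _ _ (by simp [table_length])]
  simp

theorem measurable_runningTime (ε : ℝ) (P : List (Pt d)) :
    Measurable (runningTime n k Λ ε P : Quadtree d × (List Bool → ℝ) → ℕ) := by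
  have h := (measurable_table n k Λ (noiseScale d n ε) measurable_fst measurable_snd
    (d * rounds d n) measurableCell_rootCell P).2
  unfold runningTime
  simp only [dpKMedian_steps]
  exact (measurable_const.add h).add measurable_const

end Measurability

/-! ### Privacy -/

section Privacy

variable {d : ℕ} [NeZero d] (n k : ℕ) (Λ b : ℝ) (T : Quadtree d)

theorem part_perm (c : Cell d) {P P' : List (Pt d)} (h : P.Perm P') (a : Bool) :
    (T.part c P a).Perm (T.part c P' a) := h.filter _

theorem part_cons_self (c : Cell d) (p : Pt d) (P : List (Pt d)) :
    T.part c (p :: P) (T.side c p) = p :: T.part c P (T.side c p) := by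
  simp [Quadtree.part]

theorem part_cons_of_ne (c : Cell d) (p : Pt d) (P : List (Pt d)) {a : Bool}
    (h : a ≠ T.side c p) : T.part c (p :: P) a = T.part c P a := by
  simp [Quadtree.part, h.symm]

theorem makePrivate_val_succ (noise : List Bool → ℝ) (m : ℕ) (c : Cell d) (P : List (Pt d)) :
    (makePrivate n Λ b T noise (m + 1) c P).val =
      open Classical in
      if Λ / n < c.diam then
        if 2 * b < weight noise c P then
          .node c (weight noise c P)
            (makePrivate n Λ b T noise m (T.child c false) (T.part c P false)).val
            (makePrivate n Λ b T noise m (T.child c true) (T.part c P true)).val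
        else .node c (weight noise c P) (.pruned (T.child c false)) (.pruned (T.child c true))
      else .pruned c := by
  split_ifs with h hw
  · rw [makePrivate_of_lt_weight n Λ b T noise m c P h hw]
  · rw [makePrivate_of_weight_le n Λ b T noise m c P h hw]
  · rw [makePrivate_of_diam_le n Λ b T noise m c P h]

theorem makePrivate_val_perm (noise : List Bool → ℝ) (m : ℕ) (c : Cell d) {P P' : List (Pt d)}
    (h : P.Perm P') :
    (makePrivate n Λ b T noise m c P).val = (makePrivate n Λ b T noise m c P').val := by
  induction m generalizing c P P' with
  | zero => rfl
  | succ m ih =>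
    rw [makePrivate_val_succ, makePrivate_val_succ, ih _ (part_perm T c h false),
      ih _ (part_perm T c h true), weight, weight, h.length_eq]

/-- The counts below a cell depend only on the noise of its descendants. -/
theorem makePrivate_val_congr {noise noise' : List Bool → ℝ} (m : ℕ) (c : Cell d)
    (P : List (Pt d)) (h : ∀ i, c.name <:+ i → noise i = noise' i) :
    (makePrivate n Λ b T noise m c P).val = (makePrivate n Λ b T noise' m c P).val := by
  induction m generalizing c P with
  | zero => rfl
  | succ m ih =>
    have h' : ∀ a i, (T.child c a).name <:+ i → noise i = noise' i := fun a i hi =>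
      h i ((List.suffix_cons a c.name).trans (by simpa using hi))
    rw [makePrivate_val_succ, makePrivate_val_succ, ih _ _ (h' false), ih _ _ (h' true),
      weight, weight, h _ List.suffix_rfl]

/-- The noise vector with value `δ` at each of the given names (with multiplicity). -/
noncomputable def spikes (δ : ℝ) (L : List (List Bool)) : List Bool → ℝ :=
  (L.map fun i => Pi.single i δ).sum

theorem spikes_apply_of_notMem (δ : ℝ) {L : List (List Bool)} {i : List Bool} (h : i ∉ L) :
    spikes δ L i = 0 := by
  induction L with
  | nil => rfl
  | cons j L ih =>
    simp only [List.mem_cons, not_or] at h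
    have : spikes δ (j :: L) = Pi.single j δ + spikes δ L := by simp [spikes]
    rw [this, Pi.add_apply, ih h.2, Pi.single_eq_of_ne h.1, add_zero]

theorem spikes_neg (δ : ℝ) (L : List (List Bool)) : spikes (-δ) L = -spikes δ L := by
  induction L with
  | nil => simp [spikes]
  | cons j L ih =>
    have : ∀ δ, spikes δ (j :: L) = Pi.single j δ + spikes δ L := fun δ => by simp [spikes]
    rw [this, this, ih, Pi.single_neg, neg_add]

/-- An additional point has the same effect as raising the noise by one at the cells on its
path, of which at most `m` are given a count. -/
theorem exists_spikes (m : ℕ) (c : Cell d) (p : Pt d) (P : List (Pt d)) :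
    ∃ L : List (List Bool), L.length ≤ m ∧ (∀ i ∈ L, c.name <:+ i) ∧ ∀ noise,
      (makePrivate n Λ b T noise m c (p :: P)).val =
        (makePrivate n Λ b T (noise + spikes 1 L) m c P).val := by
  induction m generalizing c P with
  | zero => exact ⟨[], le_rfl, by simp, fun _ => rfl⟩
  | succ m ih =>
    obtain ⟨L, hLm, hL, hLP⟩ := ih (T.child c (T.side c p)) (T.part c P (T.side c p))
    have hname : ∀ a b : Bool, ∀ i, (T.child c a).name <:+ i → (T.child c b).name <:+ i →
        a = b := by
      intro a b i h₁ h₂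
      rw [child_name] at h₁ h₂
      have := (List.suffix_of_suffix_length_le h₁ h₂ (by simp)).eq_of_length (by simp)
      exact (List.cons.inj this).1
    have hc : ∀ a, ∀ i, (T.child c a).name <:+ i → i ≠ c.name := by
      rintro a i h rfl
      have := h.length_le
      simp at this
    refine ⟨c.name :: L, by simpa using hLm, ?_, fun noise => ?_⟩
    · intro i hi
      rcases List.mem_cons.mp hi with rfl | hi
      · exact List.suffix_rfl
      · exact (List.suffix_cons _ c.name).trans (by simpa using hL i hi)
    · set noise' := noise + spikes 1 (c.name :: L)
      have e : noise' = noise + (Pi.single c.name 1 + spikes 1 L) := by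
        simp [noise', spikes]
      have hw : weight noise c (p :: P) = weight noise' c P := by
        have : c.name ∉ L := fun h => hc _ _ (hL _ h) rfl
        simp only [weight, e, List.length_cons, Pi.add_apply, Pi.single_eq_same,
          spikes_apply_of_notMem 1 this]
        push_cast; ring
      have hsub : ∀ a, (makePrivate n Λ b T noise m (T.child c a) (T.part c (p :: P) a)).val =
          (makePrivate n Λ b T noise' m (T.child c a) (T.part c P a)).val := by
        intro a
        by_cases ha : a = T.side c p
        · subst ha
          rw [part_cons_self, hLP]
          refine makePrivate_val_congr n Λ b T m _ _ fun i hi => ?_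
          rw [e]
          simp [Pi.single_eq_of_ne (hc _ i hi)]
        · rw [part_cons_of_ne T c p P ha]
          refine makePrivate_val_congr n Λ b T m _ _ fun i hi => ?_
          have : i ∉ L := fun h => ha (hname _ _ i hi (hL i h))
          rw [e]
          simp [Pi.single_eq_of_ne (hc _ i hi), spikes_apply_of_notMem 1 this]
      rw [makePrivate_val_succ, makePrivate_val_succ, hw, hsub, hsub]

variable {b}

/-- Shifting one coordinate of independent Laplace noise by `δ`. -/
theorem infinitePi_laplace_add_single {ι : Type*} [DecidableEq ι] (hb : 0 < b) (δ : ℝ) (i : ι)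
    {B : Set (ι → ℝ)} (hB : MeasurableSet B) :
    Measure.infinitePi (fun _ : ι => laplace b) {x | x + Pi.single i δ ∈ B} ≤
      ENNReal.ofReal (Real.exp (|δ| / b)) * Measure.infinitePi (fun _ : ι => laplace b) B := by
  set μ := Measure.infinitePi (fun _ : ι => laplace b)
  have hp := measurePreserving_piecewise (fun _ : ι => laplace b) {i}
  have hS : MeasurableSet {x : ι → ℝ | x + Pi.single i δ ∈ B} :=
    hB.preimage (measurable_id.add_const _)
  rw [← hp.measure_preimage hS.nullMeasurableSet, ← hp.measure_preimage hB.nullMeasurableSet,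
    Measure.prod_apply_symm (hp.measurable hS), Measure.prod_apply_symm (hp.measurable hB),
    ← lintegral_const_mul _ (measurable_measure_prodMk_right (hp.measurable hB))]
  refine lintegral_mono fun y => ?_
  have hu : Measurable fun t : ℝ => Function.update y i t := measurable_update y
  have he := measurePreserving_eval_infinitePi (fun _ : ι => laplace b) i
  have hpw : ∀ x : ι → ℝ, ({i} : Set ι).piecewise x y = Function.update y i (x i) := by
    intro x; ext j
    by_cases hj : j = i
    · subst hj; simp
    · simp [hj]
  have e₁ : (fun x : ι → ℝ => (x, y)) ⁻¹' ((fun p : (ι → ℝ) × (ι → ℝ) =>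
      ({i} : Set ι).piecewise p.1 p.2) ⁻¹' {x | x + Pi.single i δ ∈ B}) =
      Function.eval i ⁻¹' ((fun t => t + δ) ⁻¹' ((fun t => Function.update y i t) ⁻¹' B)) := by
    ext x
    have : Function.update y i (x i) + Pi.single i δ = Function.update y i (x i + δ) := by
      ext j
      by_cases hj : j = i
      · subst hj; simp
      · simp [hj]
    simp only [Set.mem_preimage, Set.mem_ofPred_eq, hpw, this, Function.eval]
  have e₂ : (fun x : ι → ℝ => (x, y)) ⁻¹' ((fun p : (ι → ℝ) × (ι → ℝ) =>
      ({i} : Set ι).piecewise p.1 p.2) ⁻¹' B) =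
      Function.eval i ⁻¹' ((fun t => Function.update y i t) ⁻¹' B) := by
    ext x
    simp only [Set.mem_preimage, hpw, Function.eval]
  rw [e₁, e₂, he.measure_preimage ((hu hB).preimage (measurable_add_const δ)).nullMeasurableSet,
    he.measure_preimage (hu hB).nullMeasurableSet]
  exact laplace_translate hb δ (hu hB)

theorem infinitePi_laplace_add_spikes (hb : 0 < b) (δ : ℝ) (L : List (List Bool))
    {B : Set (List Bool → ℝ)} (hB : MeasurableSet B) :
    Measure.infinitePi (fun _ : List Bool => laplace b) {x | x + spikes δ L ∈ B} ≤
      ENNReal.ofReal (Real.exp (L.length * (|δ| / b))) *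
        Measure.infinitePi (fun _ : List Bool => laplace b) B := by
  induction L with
  | nil => simp [spikes]
  | cons i L ih =>
    have e : {x | x + spikes δ (i :: L) ∈ B} =
        {x | x + Pi.single i δ ∈ {x | x + spikes δ L ∈ B}} := by
      ext x
      simp [spikes, add_assoc]
    have hS : MeasurableSet {x : List Bool → ℝ | x + spikes δ L ∈ B} :=
      hB.preimage (measurable_id.add_const _)
    rw [e]
    refine (infinitePi_laplace_add_single hb δ i hS).trans ?_
    refine (mul_le_mul_right ih _).trans_eq ?_
    rw [← mul_assoc, ← ENNReal.ofReal_mul (by positivity), ← Real.exp_add]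
    congr 3
    push_cast [List.length_cons]; ring

theorem rounds_pos {n : ℕ} (hn : 1 ≤ n) : 1 ≤ rounds d n := by
  refine Nat.one_le_ceil_iff.mpr (Real.logb_pos (by norm_num) ?_)
  have hd : (1 : ℝ) ≤ √(d : ℝ) := Real.one_le_sqrt.mpr (by exact_mod_cast NeZero.one_le)
  have hn' : (1 : ℝ) ≤ n := by exact_mod_cast hn
  nlinarith

theorem noiseScale_pos {n : ℕ} (hn : 1 ≤ n) {ε : ℝ} (hε : 0 < ε) : 0 < noiseScale d n ε := by
  have h₁ : (0 : ℝ) < d := by exact_mod_cast Nat.pos_of_neZero d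
  have h₂ : (0 : ℝ) < rounds d n := by exact_mod_cast rounds_pos hn
  unfold noiseScale; positivity

theorem centers_congr {n k : ℕ} {Λ ε : ℝ} {P P' : List (Pt d)} {T : Quadtree d}
    {noise noise' : List Bool → ℝ}
    (h : (makePrivate n Λ (noiseScale d n ε) T noise (d * rounds d n) T.rootCell P).val =
      (makePrivate n Λ (noiseScale d n ε) T noise' (d * rounds d n) T.rootCell P').val) :
    centers n k Λ ε P (T, noise) = centers n k Λ ε P' (T, noise') := by
  have e : (dpKMedian n k Λ ε T noise P).val = (dpKMedian n k Λ ε T noise' P').val := by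
    rw [dpKMedian_val, dpKMedian_val, table, table, h]
  funext i
  simp only [centers, List.get_eq_getElem, e]
  rfl

/-- For a fixed quadtree, replacing `P` by `P'` costs at most a factor `exp ε`, whenever the
two data sets are related by a shift of the noise at `d * rounds d n` cells by `1` or `-1`. -/
theorem measure_centers_le_of_spikes {n : ℕ} (hn : 1 ≤ n) {Λ ε : ℝ} (hε : 0 < ε)
    {P P' : List (Pt d)} {T : Quadtree d} {δ : ℝ} (hδ : |δ| = 1) {L : List (List Bool)}
    (hL : L.length ≤ d * rounds d n)
    (h : ∀ noise, centers n k Λ ε P (T, noise) = centers n k Λ ε P' (T, noise + spikes δ L))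
    {B : Set (Fin k → Pt d)} (hB : MeasurableSet B) :
    Measure.infinitePi (fun _ : List Bool => laplace (noiseScale d n ε))
        {x | centers n k Λ ε P (T, x) ∈ B} ≤
      ENNReal.ofReal (Real.exp ε) *
        Measure.infinitePi (fun _ : List Bool => laplace (noiseScale d n ε))
          {x | centers n k Λ ε P' (T, x) ∈ B} := by
  have hb := noiseScale_pos (d := d) hn hε
  have hM : MeasurableSet {x | centers n k Λ ε P' (T, x) ∈ B} :=
    ((measurable_centers n k Λ ε P').comp measurable_prodMk_left) hB
  have := infinitePi_laplace_add_spikes hb δ L hM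
  simp only [Set.mem_ofPred_eq, ← h] at this
  refine this.trans (mul_le_mul_left (ENNReal.ofReal_le_ofReal (Real.exp_le_exp.mpr ?_)) _)
  rw [hδ, mul_one_div, div_le_iff₀ hb, noiseScale, mul_div_cancel₀ _ hε.ne']
  exact_mod_cast hL

theorem isDifferentiallyPrivate_centers {n : ℕ} (hn : 1 ≤ n) {Λ ε : ℝ} (hε : 0 < ε)
    (τ : Measure (Quadtree d)) (D : Set (Pt d)) :
    IsDifferentiallyPrivate ε D (randomness τ (noiseScale d n ε)) (centers n k Λ ε) := by
  refine ⟨fun P => measurable_centers n k Λ ε P, fun P P' _ _ hN B hB => ?_⟩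
  have hm : ∀ Q, MeasurableSet {ω | centers n k Λ ε Q ω ∈ B} := fun Q =>
    measurable_centers n k Λ ε Q hB
  have key : ∀ T : Quadtree d,
      Measure.infinitePi (fun _ : List Bool => laplace (noiseScale d n ε))
        {x | centers n k Λ ε P (T, x) ∈ B} ≤
      ENNReal.ofReal (Real.exp ε) *
        Measure.infinitePi (fun _ : List Bool => laplace (noiseScale d n ε))
          {x | centers n k Λ ε P' (T, x) ∈ B} := by
    intro T
    obtain ⟨p, h | h⟩ := hN
    · obtain ⟨L, hL, -, e⟩ :=
        exists_spikes n Λ (noiseScale d n ε) T (d * rounds d n) T.rootCell p P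
      refine measure_centers_le_of_spikes k hn hε (δ := -1) (by simp) hL (fun noise => ?_) hB
      refine centers_congr ?_
      rw [makePrivate_val_perm n Λ _ T _ _ _ h, e, spikes_neg, neg_add_cancel_right]
    · obtain ⟨L, hL, -, e⟩ :=
        exists_spikes n Λ (noiseScale d n ε) T (d * rounds d n) T.rootCell p P'
      refine measure_centers_le_of_spikes k hn hε (δ := 1) (by simp) hL (fun noise => ?_) hB
      refine centers_congr ?_
      rw [makePrivate_val_perm n Λ _ T _ _ _ h, e]
  rw [randomness, Measure.prod_apply (hm P), Measure.prod_apply (hm P'),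
    ← lintegral_const_mul _ (measurable_measure_prodMk_left (hm P'))]
  exact lintegral_mono key

end Privacy

/-! ### Expectations along the tree -/

section NoiseVariable

/-- The joint law of the noise. -/
noncomputable abbrev noiseLaw (b : ℝ) : Measure (List Bool → ℝ) :=
  Measure.infinitePi fun _ : List Bool => laplace b

/-- The names of the nodes below a given node, including the node itself. -/
def descendants (s : List Bool) : Set (List Bool) := {i | s <:+ i}

theorem descendants_cons_subset (a : Bool) (s : List Bool) :
    descendants (a :: s) ⊆ descendants s \ {s} := by
  intro i hi
  refine ⟨(List.suffix_cons a s).trans hi, ?_⟩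
  rintro rfl
  have : (a :: i) <:+ i := hi
  simpa using this.length_le

theorem disjoint_descendants (s : List Bool) :
    Disjoint (descendants (false :: s)) (descendants (true :: s)) := by
  rw [Set.disjoint_left]
  intro i h₁ h₂
  have := (List.suffix_of_suffix_length_le h₁ h₂ (by simp)).eq_of_length (by simp)
  simp at this

/-- An integrable random variable that depends only on the noise at the nodes in `S`. -/
structure NoiseVariable (b : ℝ) (S : Set (List Bool)) (F : (List Bool → ℝ) → ℝ) : Prop where
  measurable : Measurable F
  integrable : Integrable F (noiseLaw b)
  dependsOn : DependsOn F S

variable {b : ℝ} {S S' : Set (List Bool)} {F F' : (List Bool → ℝ) → ℝ}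

theorem NoiseVariable.mono (h : NoiseVariable b S F) (hS : S ⊆ S') : NoiseVariable b S' F :=
  ⟨h.measurable, h.integrable, h.dependsOn.mono hS⟩

theorem NoiseVariable.const (S : Set (List Bool)) (r : ℝ) : NoiseVariable b S fun _ => r :=
  ⟨measurable_const, integrable_const r, fun _ _ _ => rfl⟩

theorem NoiseVariable.add (h : NoiseVariable b S F) (h' : NoiseVariable b S F') :
    NoiseVariable b S fun x => F x + F' x :=
  ⟨h.measurable.add h'.measurable, h.integrable.add h'.integrable, fun x y hxy => by
    simp only [h.dependsOn hxy, h'.dependsOn hxy]⟩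

theorem NoiseVariable.mul (h : NoiseVariable b S F) (h' : NoiseVariable b S' F')
    (hS : Disjoint S S') :
    NoiseVariable b (S ∪ S') (fun x => F x * F' x) ∧
      ∫ x, F x * F' x ∂noiseLaw b = (∫ x, F x ∂noiseLaw b) * ∫ x, F' x ∂noiseLaw b := by
  have hi := indepFun_of_dependsOn (fun _ : List Bool => laplace b) hS h.measurable h'.measurable
    h.dependsOn h'.dependsOn
  refine ⟨⟨h.measurable.mul h'.measurable, hi.integrable_mul h.integrable h'.integrable,
    fun x y hxy => ?_⟩, hi.integral_mul_eq_mul_integral h.integrable.aestronglyMeasurable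
      h'.integrable.aestronglyMeasurable⟩
  simp only [h.dependsOn fun i hi => hxy i (Or.inl hi), h'.dependsOn fun i hi => hxy i (Or.inr hi)]

/-- The expectation of a variable that is determined by the noise of a node and, with a factor
depending on this noise, by the noise of the proper descendants of the node. -/
theorem NoiseVariable.node {s : List Bool} {f g : ℝ → ℝ} {G : (List Bool → ℝ) → ℝ}
    (hf : Integrable f (laplace b)) (hfm : Measurable f) (hg : Integrable g (laplace b))
    (hgm : Measurable g) (hG : NoiseVariable b (descendants s \ {s}) G) :
    NoiseVariable b (descendants s) (fun x => f (x s) + g (x s) * G x) ∧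
      ∫ x, f (x s) + g (x s) * G x ∂noiseLaw b =
        (∫ t, f t ∂laplace b) + (∫ t, g t ∂laplace b) * ∫ x, G x ∂noiseLaw b := by
  obtain ⟨h₁, h₂⟩ := integral_add_mul_of_dependsOn (fun _ : List Bool => laplace b) (i := s)
    hf hg hgm hG.integrable hG.measurable (hG.dependsOn.mono fun i hi => hi.2)
  refine ⟨⟨?_, h₁, fun x y hxy => ?_⟩, h₂⟩
  · have := hG.measurable
    exact (hfm.comp (measurable_pi_apply s)).add ((hgm.comp (measurable_pi_apply s)).mul this)
  · simp only [hxy s List.suffix_rfl, hG.dependsOn fun i hi => hxy i hi.1]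

/-- The indicator of the event that a node with `N` points has a noisy count above `2 b`. -/
noncomputable def splitIndicator (b : ℝ) (N : ℕ) : ℝ → ℝ :=
  (Set.Ioi (2 * b - N)).indicator fun _ => 1

theorem splitIndicator_of_lt {N : ℕ} {t : ℝ} (h : 2 * b < N + t) : splitIndicator b N t = 1 :=
  Set.indicator_of_mem (by simp only [Set.mem_Ioi]; linarith) _

theorem splitIndicator_of_not_lt {N : ℕ} {t : ℝ} (h : ¬ 2 * b < N + t) :
    splitIndicator b N t = 0 :=
  Set.indicator_of_notMem (by simp only [Set.mem_Ioi]; intro h'; exact h (by linarith)) _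

theorem splitIndicator_nonneg (N : ℕ) (t : ℝ) : 0 ≤ splitIndicator b N t :=
  Set.indicator_nonneg (fun _ _ => zero_le_one) _

theorem measurable_splitIndicator (N : ℕ) : Measurable (splitIndicator b N) :=
  measurable_const.indicator measurableSet_Ioi

theorem integrable_splitIndicator (N : ℕ) : Integrable (splitIndicator b N) (laplace b) :=
  (integrable_const 1).indicator measurableSet_Ioi

theorem integral_splitIndicator_nonneg (N : ℕ) : 0 ≤ ∫ t, splitIndicator b N t ∂laplace b :=
  integral_nonneg (splitIndicator_nonneg N)

theorem integral_splitIndicator_le_one (N : ℕ) : ∫ t, splitIndicator b N t ∂laplace b ≤ 1 := by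
  refine (integral_mono (integrable_splitIndicator N) (integrable_const 1) fun t => ?_).trans_eq
    (by simp)
  exact Set.indicator_le_self' (fun _ _ => zero_le_one) _

theorem integral_splitIndicator_zero (hb : 0 < b) :
    ∫ t, splitIndicator b 0 t ∂laplace b ≤ 7 / 100 := by
  have := laplace_tail hb
  unfold splitIndicator
  simpa using this

end NoiseVariable

/-! ### Running time -/

section RunningTime

theorem leafTable_steps_le {d : ℕ} {k : ℕ} (hk : 1 ≤ k) (c : Cell d) (w : ℝ) :
    (leafTable k c w).steps ≤ 12 * k ^ 2 := by
  rw [leafTable_steps]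
  have : ∑ i ∈ Finset.range k, (i + 5) ≤ k * (k + 4) := by
    refine (Finset.sum_le_card_nsmul _ _ (k + 4) fun i hi => ?_).trans_eq (by simp)
    have := Finset.mem_range.mp hi; omega
  nlinarith

theorem innerTable_steps_le {d : ℕ} {k : ℕ} (hk : 1 ≤ k) (c : Cell d) (w : ℝ)
    {V₁ V₂ : ℕ → ℝ × List (Cell d)} (hV : ∀ i, (V₁ i).2.length = i) :
    (innerTable k c w V₁ V₂).steps ≤ 32 * k ^ 2 := by
  rw [innerTable_steps]
  simp only [hV]
  have : ∑ i ∈ Finset.range k, (8 * (i + 2) +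
      2 * (argmin (fun j => (V₁ j).1 + (V₂ (i + 1 - j)).1) (i + 1)).val.1 + 7) ≤ k * (25 * k) := by
    refine (Finset.sum_le_card_nsmul _ _ (25 * k) fun i hi => ?_).trans_eq (by simp)
    have := Finset.mem_range.mp hi
    have := argmin_le (fun j => (V₁ j).1 + (V₂ (i + 1 - j)).1) (i + 1)
    omega
  nlinarith

variable {d : ℕ} [NeZero d] (n k : ℕ) (Λ b : ℝ) (T : Quadtree d)

/-- An upper bound for the number of steps below a cell, when all work at one cell that is not
proportional to its number of points costs at most `A`. -/
noncomputable def stepBound (A : ℝ) : ℕ → Cell d → List (Pt d) → (List Bool → ℝ) → ℝ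
  | 0, _, _, _ => A
  | m + 1, c, P, x => (A + 6 * P.length) + splitIndicator b P.length (x c.name) *
      (stepBound A m (T.child c false) (T.part c P false) x +
        stepBound A m (T.child c true) (T.part c P true) x)

theorem stepBound_nonneg {A : ℝ} (hA : 0 ≤ A) (m : ℕ) (c : Cell d) (P : List (Pt d))
    (x : List Bool → ℝ) : 0 ≤ stepBound b T A m c P x := by
  induction m generalizing c P with
  | zero => exact hA
  | succ m ih =>
    have := mul_nonneg (splitIndicator_nonneg (b := b) P.length (x c.name))
      (add_nonneg (ih (T.child c false) (T.part c P false)) (ih (T.child c true) (T.part c P true)))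
    rw [stepBound]
    positivity

theorem tableSteps_le_stepBound {k : ℕ} (hk : 1 ≤ k) (x : List Bool → ℝ) (m : ℕ) (c : Cell d)
    (P : List (Pt d)) :
    (tableSteps n k Λ b T x m c P : ℝ) ≤
      stepBound b T (50 + 4 * accessCost d + 56 * k ^ 2) m c P x := by
  set A : ℝ := 50 + 4 * accessCost d + 56 * k ^ 2 with hA
  have hA0 : 0 ≤ A := by positivity
  have hleaf : ∀ (c : Cell d) w, ((leafTable k c w).steps : ℝ) ≤ 12 * k ^ 2 := fun c w => by
    exact_mod_cast leafTable_steps_le hk c w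
  have hk0 : (0 : ℝ) ≤ (k : ℝ) ^ 2 := by positivity
  have ha0 : (0 : ℝ) ≤ (accessCost d : ℝ) := by positivity
  have hP0 : (0 : ℝ) ≤ (P.length : ℝ) := by positivity
  induction m generalizing c P with
  | zero =>
    rw [tableSteps_zero, stepBound]
    push_cast
    linarith [hleaf c 0]
  | succ m ih =>
    have hG := mul_nonneg (splitIndicator_nonneg (b := b) P.length (x c.name))
      (add_nonneg (stepBound_nonneg b T hA0 m (T.child c false) (T.part c P false) x)
        (stepBound_nonneg b T hA0 m (T.child c true) (T.part c P true) x))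
    rw [stepBound]
    by_cases h : Λ / n < c.diam
    swap
    · rw [tableSteps_of_diam_le _ _ _ _ _ _ _ _ _ h]
      push_cast
      linarith [hleaf c 0]
    rcases lt_trichotomy (weight x c P) (2 * b) with hw | hw | hw
    · rw [tableSteps_of_weight_lt _ _ _ _ _ _ _ _ _ h hw]
      push_cast
      linarith [hleaf c (weight x c P)]
    · rw [tableSteps_of_weight_eq _ _ _ _ _ _ _ _ _ h hw]
      have : ((innerTable k c (weight x c P) (leafTable k (T.child c false) 0).val
        (leafTable k (T.child c true) 0).val).steps : ℝ) ≤ 32 * k ^ 2 := by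
        exact_mod_cast innerTable_steps_le hk c _ (leafTable_length k _ 0)
      push_cast
      linarith [hleaf (T.child c false) 0, hleaf (T.child c true) 0]
    · rw [tableSteps_of_lt_weight _ _ _ _ _ _ _ _ _ h hw, splitIndicator_of_lt (by exact hw)]
      have : ((innerTable k c (weight x c P)
        (table n k Λ b T x m (T.child c false) (T.part c P false))
        (table n k Λ b T x m (T.child c true) (T.part c P true))).steps : ℝ) ≤ 32 * k ^ 2 := by
        exact_mod_cast innerTable_steps_le hk c _ (table_length n k Λ b T x m _ _)
      push_cast
      linarith [ih (T.child c false) (T.part c P false) (by positivity),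
        ih (T.child c true) (T.part c P true) (by positivity)]

/-- The expected number of steps. A nonempty cell is charged to its points, at most one cell per
point and level; the part of the tree below an empty cell is a subcritical branching process, as
the expected number of its children that are reached is at most `2 * 7 / 100`. -/
theorem integral_stepBound_le {b : ℝ} (hb : 0 < b) {A : ℝ} (hA : 0 ≤ A) (m : ℕ) (c : Cell d)
    (P : List (Pt d)) :
    NoiseVariable b (descendants c.name) (stepBound b T A m c P) ∧
      ∫ x, stepBound b T A m c P x ∂noiseLaw b ≤ 2 * A + (6 + 3 * A) * m * P.length := by
  induction m generalizing c P with
  | zero =>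
    refine ⟨NoiseVariable.const _ _, ?_⟩
    simp only [stepBound]
    simp; linarith
  | succ m ih =>
    obtain ⟨l₁, l₂⟩ := ih (T.child c false) (T.part c P false)
    obtain ⟨r₁, r₂⟩ := ih (T.child c true) (T.part c P true)
    rw [child_name] at l₁ r₁
    have hG := (l₁.mono (descendants_cons_subset _ _)).add (r₁.mono (descendants_cons_subset _ _))
    obtain ⟨h₁, h₂⟩ := NoiseVariable.node (f := fun _ => A + 6 * P.length)
      (integrable_const _) measurable_const
      (integrable_splitIndicator P.length) (measurable_splitIndicator P.length) hG
    refine ⟨h₁, ?_⟩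
    simp only [stepBound]
    rw [h₂, integral_add l₁.integrable r₁.integrable]
    simp only [integral_const, probReal_univ, one_smul]
    have hlen : (P.length : ℝ) = (T.part c P false).length + (T.part c P true).length := by
      exact_mod_cast (part_length T c P).symm
    have p₀ := integral_splitIndicator_nonneg (b := b) P.length
    rcases Nat.eq_zero_or_pos P.length with h0 | h0
    · have hl : (T.part c P false).length = 0 := by have := part_length T c P; omega
      have hr : (T.part c P true).length = 0 := by have := part_length T c P; omega
      have p₁ := integral_splitIndicator_zero hb
      rw [h0] at p₀ ⊢
      rw [hl] at l₂
      rw [hr] at r₂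
      simp only [Nat.cast_zero, mul_zero, add_zero] at l₂ r₂ ⊢
      have := mul_le_mul_of_nonneg_left (add_le_add l₂ r₂) p₀
      nlinarith
    · have p₁ := integral_splitIndicator_le_one (b := b) P.length
      have hP : (1 : ℝ) ≤ P.length := by exact_mod_cast h0
      have s0 : 0 ≤ 2 * A + (6 + 3 * A) * m * (T.part c P false).length +
          (2 * A + (6 + 3 * A) * m * (T.part c P true).length) := by positivity
      have := (mul_le_mul_of_nonneg_left (add_le_add l₂ r₂) p₀).trans
        (mul_le_of_le_one_left s0 p₁)
      push_cast
      have e : (6 + 3 * A) * m * (P.length : ℝ) = (6 + 3 * A) * m * (T.part c P false).length +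
          (6 + 3 * A) * m * (T.part c P true).length := by rw [hlen]; ring
      nlinarith

end RunningTime

section RunningTimeBound

/-- Tonelli's theorem in the form of a bound: it suffices to bound the inner integrals of a
nonnegative function by an integrable function. -/
theorem integrable_prod_of_integral_le {α β : Type*} [MeasurableSpace α] [MeasurableSpace β]
    {τ : Measure α} {ν : Measure β} [SFinite τ] [SFinite ν] {f : α × β → ℝ} (hf : Measurable f)
    (h0 : ∀ x, 0 ≤ f x) {g : α → ℝ} (hg : Integrable g τ)
    (h : ∀ᵐ a ∂τ, Integrable (fun y => f (a, y)) ν ∧ ∫ y, f (a, y) ∂ν ≤ g a) :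
    Integrable f (τ.prod ν) ∧ ∫ x, f x ∂τ.prod ν ≤ ∫ a, g a ∂τ := by
  have hi : Integrable f (τ.prod ν) := by
    rw [integrable_prod_iff hf.aestronglyMeasurable]
    refine ⟨h.mono fun a ha => ha.1, hg.mono'
      (hf.norm.aestronglyMeasurable.integral_prod_right' (μ := τ) (ν := ν)) ?_⟩
    filter_upwards [h] with a ha
    simp only [Real.norm_of_nonneg (h0 _)]
    rw [Real.norm_of_nonneg (integral_nonneg fun y => h0 _)]
    exact ha.2
  refine ⟨hi, ?_⟩
  rw [integral_prod _ hi]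
  exact integral_mono_ae hi.integral_prod_left hg (h.mono fun a ha => ha.2)

theorem log_three_halves_ge : (1 / 3 : ℝ) ≤ Real.log (3 / 2) := by
  have h := Real.log_le_sub_one_of_pos (show (0 : ℝ) < 2 / 3 by norm_num)
  rw [show (3 / 2 : ℝ) = (2 / 3)⁻¹ by norm_num, Real.log_inv]
  linarith

/-- The number of rounds is `O(log (n d))`. -/
theorem rounds_le {d n : ℕ} (hd : 1 ≤ d) (hn : 1 ≤ n) :
    (rounds d n : ℝ) ≤ 6 + 3 * Real.log n + 2 * Real.log d := by
  have hd' : (0 : ℝ) < d := by exact_mod_cast hd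
  have hn' : (1 : ℝ) ≤ n := by exact_mod_cast hn
  have hd1 : (1 : ℝ) ≤ d := by exact_mod_cast hd
  have hl := log_three_halves_ge
  have hsq : (1 : ℝ) ≤ √(d : ℝ) := Real.one_le_sqrt.mpr hd1
  have h1 : 0 ≤ Real.logb (3 / 2) (4 * √(d : ℝ) * n) :=
    (Real.logb_pos (by norm_num) (by nlinarith)).le
  refine (Nat.ceil_lt_add_one h1).le.trans ?_
  rw [Real.logb, Real.log_mul (by positivity) (by positivity),
    Real.log_mul (by norm_num) (by positivity), Real.log_sqrt hd'.le]
  have h4 : Real.log 4 < 1.4 := by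
    rw [show (4 : ℝ) = 2 ^ 2 by norm_num, Real.log_pow]
    have := Real.log_two_lt_d9
    push_cast; linarith
  have hn0 : 0 ≤ Real.log n := Real.log_nonneg hn'
  have hd0 : 0 ≤ Real.log d := Real.log_nonneg hd1
  have : (Real.log 4 + Real.log d / 2 + Real.log n) / Real.log (3 / 2) ≤
      5 + 3 * Real.log n + 2 * Real.log d := by
    rw [div_le_iff₀ (by linarith)]
    nlinarith
  linarith

theorem accessCost_le {d : ℕ} (hd : 1 ≤ d) : (accessCost d : ℝ) ≤ 1 + 3 / 2 * Real.log d := by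
  have hd' : (1 : ℝ) ≤ d := by exact_mod_cast hd
  have h : (2 : ℝ) ^ Nat.log 2 d ≤ d := by exact_mod_cast Nat.pow_log_le_self 2 (by omega)
  have h2 := Real.log_le_log (by positivity) h
  rw [Real.log_pow] at h2
  have := Real.log_two_gt_d9
  have h0 : (0 : ℝ) ≤ Nat.log 2 d := by positivity
  unfold accessCost
  push_cast
  nlinarith [Real.log_nonneg hd']

theorem runningTime_arith {n d k l α a : ℝ} (hn : 1 ≤ n) (hd : 1 ≤ d) (hk : 1 ≤ k) (hl : 1 ≤ l)
    (_ : 0 ≤ α) (hα : α ≤ 6 * l) (_ : 0 ≤ a) (ha : a ≤ 2 * l) :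
    2 * α + 28 + d * (2 * a + 4) + k * (d * (2 * a + 3) + 2) +
      (2 * (50 + 4 * a + 56 * k ^ 2) + (6 + 3 * (50 + 4 * a + 56 * k ^ 2)) * (d * α) * n) ≤
      2500 * (n * d * k ^ 2) * l ^ 2 := by
  obtain ⟨X, hX⟩ : ∃ X, X = n * d * k ^ 2 * l ^ 2 := ⟨_, rfl⟩
  have hkk : 1 ≤ k ^ 2 := one_le_pow₀ hk
  have hll : l ≤ l ^ 2 := le_self_pow₀ hl two_ne_zero
  have hk2 : k ≤ k ^ 2 := le_self_pow₀ hk two_ne_zero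
  have hnd : 1 ≤ n * d := one_le_mul_of_one_le_of_one_le hn hd
  have hdnd : d ≤ n * d := le_mul_of_one_le_left (by linarith) hn
  have x1 : k ^ 2 * l ≤ X := by
    calc k ^ 2 * l ≤ (n * d) * k ^ 2 * l ^ 2 :=
          mul_le_mul (le_mul_of_one_le_left (by positivity) hnd) hll (by linarith) (by positivity)
      _ = X := by rw [hX]
  have x2 : d * k * l ≤ X := by
    calc d * k * l ≤ (n * d) * k ^ 2 * l ^ 2 := by gcongr
      _ = X := by rw [hX]
  have x3 : l ≤ k ^ 2 * l := le_mul_of_one_le_left (by linarith) hkk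
  have x4 : k ^ 2 ≤ k ^ 2 * l := le_mul_of_one_le_right (by linarith) hl
  have x5 : d * l ≤ d * k * l :=
    mul_le_mul_of_nonneg_right (le_mul_of_one_le_right (by linarith) hk) (by linarith)
  have hA : 50 + 4 * a + 56 * k ^ 2 ≤ 114 * (k ^ 2 * l) := by linarith
  have t1 : d * (2 * a + 3) ≤ 7 * (d * l) := by
    calc d * (2 * a + 3) ≤ d * (7 * l) := by gcongr; linarith
      _ = _ := by ring
  have t2 : k * (d * (2 * a + 3) + 2) ≤ 7 * (d * k * l) + 2 * k := by
    calc k * (d * (2 * a + 3) + 2) ≤ k * (7 * (d * l) + 2) := by gcongr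
      _ = _ := by ring
  have t3 : (6 + 3 * (50 + 4 * a + 56 * k ^ 2)) * (d * α) * n ≤ 2088 * X := by
    calc (6 + 3 * (50 + 4 * a + 56 * k ^ 2)) * (d * α) * n
        ≤ (348 * (k ^ 2 * l)) * (d * (6 * l)) * n := by gcongr; linarith
      _ = 2088 * X := by rw [hX]; ring
  have t4 : d * (2 * a + 4) ≤ 8 * (d * l) := by
    calc d * (2 * a + 4) ≤ d * (8 * l) := by gcongr; linarith
      _ = _ := by ring
  have : 2500 * (n * d * k ^ 2) * l ^ 2 = 2500 * X := by rw [hX]; ring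
  rw [this]
  linarith

variable {d : ℕ} [NeZero d]

theorem integral_runningTime_le {n k : ℕ} (hn : 1 ≤ n) (hk : 1 ≤ k) {Λ ε : ℝ} (hε : 0 < ε)
    (τ : Measure (Quadtree d)) [IsProbabilityMeasure τ] {P : List (Pt d)} (hP : P.length = n) :
    Integrable (fun ω => (runningTime n k Λ ε P ω : ℝ)) (randomness τ (noiseScale d n ε)) ∧
      ∫ ω, (runningTime n k Λ ε P ω : ℝ) ∂randomness τ (noiseScale d n ε) ≤
        2500 * (n * d * k ^ 2) * (1 + Real.log (n * d * k)) ^ 2 := by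
  have hb := noiseScale_pos (d := d) hn hε
  have hm : Measurable fun ω : Quadtree d × (List Bool → ℝ) => (runningTime n k Λ ε P ω : ℝ) :=
    measurable_from_top.comp (measurable_runningTime n k Λ ε P)
  set R : ℝ := 2 * rounds d n + 28 + d * (2 * accessCost d + 4) +
    k * (d * (2 * accessCost d + 3) + 2) with hR
  set A : ℝ := 50 + 4 * accessCost d + 56 * k ^ 2 with hA
  have hA0 : 0 ≤ A := by positivity
  obtain ⟨h₁, h₂⟩ := integrable_prod_of_integral_le (τ := τ) (ν := noiseLaw (noiseScale d n ε))
    hm (fun _ => by positivity)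
    (g := fun _ => R + (2 * A + (6 + 3 * A) * (d * rounds d n : ℕ) * P.length))
    (integrable_const _) (Filter.Eventually.of_forall fun T => by
      obtain ⟨i₁, i₂⟩ := integral_stepBound_le T hb hA0 (d * rounds d n) T.rootCell P
      have hle : ∀ x, (runningTime n k Λ ε P (T, x) : ℝ) ≤
          R + stepBound (noiseScale d n ε) T A (d * rounds d n) T.rootCell P x := by
        intro x
        rw [runningTime, dpKMedian_steps]
        have := tableSteps_le_stepBound n Λ (noiseScale d n ε) T hk x (d * rounds d n)
          T.rootCell P
        push_cast
        linarith
      have hmT : Measurable fun x : List Bool → ℝ => (runningTime n k Λ ε P (T, x) : ℝ) :=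
        hm.comp measurable_prodMk_left
      have hdom := (integrable_const R).add i₁.integrable
      refine ⟨hdom.mono' hmT.aestronglyMeasurable (Filter.Eventually.of_forall fun x => ?_), ?_⟩
      · rw [Real.norm_of_nonneg (by positivity)]; exact hle x
      · refine (integral_mono_of_nonneg (Filter.Eventually.of_forall fun x => by positivity) hdom
          (Filter.Eventually.of_forall hle)).trans ?_
        simp only [Pi.add_apply]
        rw [integral_add (integrable_const R) i₁.integrable]
        simpa using i₂)
  refine ⟨h₁, h₂.trans ?_⟩
  simp only [integral_const, probReal_univ, one_smul]
  have hd1 : 1 ≤ d := NeZero.one_le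
  have hd' : (1 : ℝ) ≤ d := by exact_mod_cast hd1
  have hn' : (1 : ℝ) ≤ n := by exact_mod_cast hn
  have hk' : (1 : ℝ) ≤ k := by exact_mod_cast hk
  have ln := Real.log_nonneg hn'
  have ld := Real.log_nonneg hd'
  have lk := Real.log_nonneg hk'
  have el : Real.log (n * d * k) = Real.log n + Real.log d + Real.log k := by
    rw [Real.log_mul (by positivity) (by positivity), Real.log_mul (by positivity) (by positivity)]
  set l : ℝ := 1 + Real.log (n * d * k) with hl
  have l1 : 1 ≤ l := by linarith
  have hα : (rounds d n : ℝ) ≤ 6 * l := by have := rounds_le hd1 hn; linarith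
  have ha : (accessCost d : ℝ) ≤ 2 * l := by have := accessCost_le hd1; linarith
  rw [hP, hR, hA]
  push_cast
  exact runningTime_arith hn' hd' hk' l1 (by positivity) hα (by positivity) ha

end RunningTimeBound

/-! ### Cells of the shifted quadtree -/

section Geometry

variable {d : ℕ}

/-- How often coordinate `j` has been halved at depth `t`. -/
def halvings (d t : ℕ) (j : Fin d) : ℕ := (t + (d - 1 - j)) / d

theorem halvings_zero (j : Fin d) : halvings d 0 j = 0 := by
  have := j.2
  exact Nat.div_eq_of_lt (by omega)

theorem div_le_halvings (t : ℕ) (j : Fin d) : t / d ≤ halvings d t j :=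
  Nat.div_le_div_right (Nat.le_add_right _ _)

/-- The cells of the quadtree with shift `s`: every side is the side of the root, halved as often
as the depth tells, its left end lies on the corresponding shifted grid, and the stored squared
diameter is correct. -/
structure Dyadic (Λ : ℝ) (s : Fin d → ℝ) (c : Cell d) : Prop where
  side : ∀ j, c.hi j - c.lo j = 4 * Λ / 2 ^ halvings d c.depth j
  diamSq : c.diamSq = ∑ j, (c.hi j - c.lo j) ^ 2
  lo : ∀ j, ∃ a : ℕ, a < 2 ^ halvings d c.depth j ∧
    c.lo j = s j - 2 * Λ + a * (4 * Λ / 2 ^ halvings d c.depth j)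

variable {Λ : ℝ} {s : Fin d → ℝ} {c : Cell d}

theorem Cell.diam_nonneg (c : Cell d) : 0 ≤ c.diam := Real.sqrt_nonneg _

/-- Does the (closed) box of a cell contain the point `p`? -/
def InBox (c : Cell d) (p : Pt d) : Prop := ∀ j, c.lo j ≤ p j ∧ p j ≤ c.hi j

theorem Dyadic.dist_le_diam (hc : Dyadic Λ s c) {p q : Pt d} (hp : InBox c p) (hq : InBox c q) :
    dist p q ≤ c.diam := by
  rw [EuclideanSpace.dist_eq, Cell.diam, hc.diamSq]
  refine Real.sqrt_le_sqrt (Finset.sum_le_sum fun j _ => ?_)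
  rw [Real.dist_eq, sq_abs]
  have := hp j
  have := hq j
  exact sq_le_sq' (by linarith) (by linarith)

theorem Dyadic.inBox_center (hΛ : 0 < Λ) (hc : Dyadic Λ s c) : InBox c c.center := by
  intro j
  have h := hc.side j
  have : 0 < 4 * Λ / 2 ^ halvings d c.depth j := by positivity
  simp only [Cell.center]
  constructor <;> linarith

theorem dyadic_rootCell (Λ : ℝ) (s : Fin d → ℝ) : Dyadic Λ s (shiftedQuadtree Λ s).rootCell where
  side j := by
    simp only [Quadtree.rootCell, shiftedQuadtree, halvings_zero]; ring
  diamSq := rfl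
  lo j := ⟨0, by positivity, by simp [Quadtree.rootCell, shiftedQuadtree]⟩

theorem Dyadic.diamSq_le (hΛ : 0 < Λ) (hc : Dyadic Λ s c) :
    c.diamSq ≤ d * (4 * Λ / 2 ^ (c.depth / d)) ^ 2 := by
  rw [hc.diamSq]
  refine (Finset.sum_le_card_nsmul _ _ ((4 * Λ / 2 ^ (c.depth / d)) ^ 2) fun j _ => ?_).trans_eq
    (by simp)
  rw [hc.side]
  gcongr
  · norm_num
  · exact div_le_halvings _ _

theorem Dyadic.diam_le (hΛ : 0 < Λ) (hc : Dyadic Λ s c) :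
    c.diam ≤ √d * (4 * Λ / 2 ^ (c.depth / d)) := by
  rw [Cell.diam]
  refine (Real.sqrt_le_sqrt (hc.diamSq_le hΛ)).trans_eq ?_
  rw [Real.sqrt_mul (by positivity), Real.sqrt_sq (by positivity)]

theorem Dyadic.diamSq_le_root (hΛ : 0 < Λ) (hc : Dyadic Λ s c) : c.diamSq ≤ 16 * d * Λ ^ 2 := by
  refine (hc.diamSq_le hΛ).trans ?_
  have : 4 * Λ / 2 ^ (c.depth / d) ≤ 4 * Λ :=
    div_le_self (by positivity) (one_le_pow₀ (by norm_num))
  calc (d : ℝ) * (4 * Λ / 2 ^ (c.depth / d)) ^ 2 ≤ d * (4 * Λ) ^ 2 := by gcongr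
    _ = _ := by ring

variable [NeZero d]

theorem halvings_succ (t : ℕ) (j : Fin d) :
    halvings d (t + 1) j = halvings d t j + if Fin.ofNat d t = j then 1 else 0 := by
  have hj := j.2
  have e : t + 1 + (d - 1 - j) = t + (d - 1 - j) + 1 := by omega
  rw [halvings, halvings, e, Nat.succ_div]
  congr 1
  have h : d ∣ t + (d - 1 - j) + 1 ↔ Fin.ofNat d t = j := by
    have e2 : t + (d - 1 - j) + 1 + j = t + d := by omega
    rw [Fin.ext_iff, Fin.val_ofNat, ← Nat.mod_eq_of_lt hj]
    change _ ↔ t ≡ j [MOD d]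
    rw [Nat.mod_eq_of_lt hj, ← Nat.modEq_zero_iff_dvd]
    constructor
    · intro h
      have := h.add_right (j : ℕ)
      rw [e2, zero_add] at this
      exact (by simpa [Nat.ModEq] using this)
    · intro h
      have h2 : t + (d - 1 - j) + 1 + j ≡ 0 + j [MOD d] := by
        rw [e2, zero_add]
        simpa [Nat.ModEq] using h
      exact h2.add_right_cancel'
  simp only [h]

theorem halvings_axis (t : ℕ) : halvings d t (Fin.ofNat d t) = t / d := by
  have hd := Nat.pos_of_neZero d
  have h := Nat.mod_lt t hd
  have e : t + (d - 1 - t % d) = d - 1 + d * (t / d) := by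
    have := Nat.mod_add_div t d
    omega
  rw [halvings, Fin.val_ofNat, e, Nat.add_mul_div_left _ _ hd, Nat.div_eq_of_lt (by omega),
    zero_add]

theorem Dyadic.side_axis (hc : Dyadic Λ s c) :
    c.hi c.axis - c.lo c.axis = 4 * Λ / 2 ^ (c.depth / d) := by
  rw [hc.side, Cell.axis, halvings_axis]

theorem Dyadic.cutPos_eq (hc : Dyadic Λ s c) :
    (shiftedQuadtree Λ s).cutPos c = c.lo c.axis + 4 * Λ / 2 ^ (c.depth / d) / 2 := by
  rw [Quadtree.cutPos, hc.side_axis, shiftedQuadtree]; ring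

theorem Dyadic.child_side (hc : Dyadic Λ s c) (a : Bool) (j : Fin d) :
    ((shiftedQuadtree Λ s).child c a).hi j - ((shiftedQuadtree Λ s).child c a).lo j =
      if c.axis = j then (c.hi j - c.lo j) / 2 else c.hi j - c.lo j := by
  by_cases hj : c.axis = j
  · subst hj
    rw [if_pos rfl]
    cases a <;> simp only [Quadtree.child, Function.update_self, hc.cutPos_eq] <;>
      linarith [hc.side_axis]
  · rw [if_neg hj]
    cases a <;> simp [Quadtree.child, Function.update_of_ne (Ne.symm hj)]

theorem Dyadic.child_diamSq (hc : Dyadic Λ s c) (a : Bool) :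
    ((shiftedQuadtree Λ s).child c a).diamSq =
      c.diamSq - 3 / 4 * (4 * Λ / 2 ^ (c.depth / d)) ^ 2 := by
  cases a <;> simp only [Quadtree.child, hc.cutPos_eq, hc.side_axis]
  · ring
  · have := hc.side_axis
    rw [show c.hi c.axis = c.lo c.axis + 4 * Λ / 2 ^ (c.depth / d) by linarith]
    ring

theorem Dyadic.child (hc : Dyadic Λ s c) (a : Bool) :
    Dyadic Λ s ((shiftedQuadtree Λ s).child c a) where
  side j := by
    rw [hc.child_side, child_depth, halvings_succ, ← Cell.axis, hc.side]
    split_ifs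
    · rw [pow_succ]; field_simp
    · rw [add_zero]
  diamSq := by
    rw [hc.child_diamSq, hc.diamSq, ← hc.side_axis, ← Finset.add_sum_erase _ _
      (Finset.mem_univ c.axis), ← Finset.add_sum_erase _ (fun j =>
      (((shiftedQuadtree Λ s).child c a).hi j - ((shiftedQuadtree Λ s).child c a).lo j) ^ 2)
      (Finset.mem_univ c.axis)]
    simp only [hc.child_side, if_true]
    have : ∑ j ∈ Finset.univ.erase c.axis,
        (if c.axis = j then (c.hi j - c.lo j) / 2 else c.hi j - c.lo j) ^ 2 =
        ∑ j ∈ Finset.univ.erase c.axis, (c.hi j - c.lo j) ^ 2 :=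
      Finset.sum_congr rfl fun j hj => by rw [if_neg (Finset.ne_of_mem_erase hj).symm]
    rw [this]; ring
  lo j := by
    obtain ⟨r, hr, e⟩ := hc.lo j
    rw [child_depth, halvings_succ, ← Cell.axis]
    by_cases hj : c.axis = j
    · subst hj
      have hcut := hc.cutPos_eq
      rw [Cell.axis, ← halvings_axis, ← Cell.axis] at hcut
      rw [if_pos rfl, pow_succ]
      cases a
      · refine ⟨2 * r, by omega, ?_⟩
        simp only [Quadtree.child]
        rw [e]; push_cast; field_simp; ring
      · refine ⟨2 * r + 1, by omega, ?_⟩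
        simp only [Quadtree.child, Function.update_self]
        rw [hcut, e]; push_cast; field_simp; ring
    · rw [if_neg hj, add_zero]
      refine ⟨r, hr, ?_⟩
      cases a <;> simp [Quadtree.child, Function.update_of_ne (Ne.symm hj), e]

theorem Dyadic.le_diamSq (hc : Dyadic Λ s c) :
    (4 * Λ / 2 ^ (c.depth / d)) ^ 2 ≤ c.diamSq := by
  rw [hc.diamSq, ← hc.side_axis]
  exact Finset.single_le_sum (f := fun j => (c.hi j - c.lo j) ^ 2) (fun j _ => sq_nonneg _)
    (Finset.mem_univ c.axis)

theorem Dyadic.diamSq_nonneg (hc : Dyadic Λ s c) : 0 ≤ c.diamSq :=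
  (sq_nonneg _).trans hc.le_diamSq

theorem Dyadic.diam_sq (hc : Dyadic Λ s c) : c.diam ^ 2 = c.diamSq :=
  Real.sq_sqrt hc.diamSq_nonneg

theorem Dyadic.child_diam_le (hc : Dyadic Λ s c) (a : Bool) :
    ((shiftedQuadtree Λ s).child c a).diam ≤ c.diam :=
  Real.sqrt_le_sqrt (by rw [hc.child_diamSq]; nlinarith [sq_nonneg (4 * Λ / 2 ^ (c.depth / d))])

theorem Dyadic.diam_le_child (hc : Dyadic Λ s c) (a : Bool) :
    c.diam ≤ 2 * ((shiftedQuadtree Λ s).child c a).diam := by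
  refine abs_le_of_sq_le_sq' ?_ (by have := Cell.diam_nonneg ((shiftedQuadtree Λ s).child c a)
                                    positivity) |>.2
  rw [mul_pow, hc.diam_sq, (hc.child a).diam_sq, hc.child_diamSq]
  linarith [hc.le_diamSq]

/-- The squared diameter serves as a potential: one cut lowers it by a fraction `3 / (4 d)`. -/
theorem Dyadic.potential (hΛ : 0 < Λ) (hc : Dyadic Λ s c) (a : Bool) :
    (1 + 4 / 3 * d) * ((shiftedQuadtree Λ s).child c a).diamSq ≤ 4 / 3 * d * c.diamSq := by
  have hd : (1 : ℝ) ≤ d := by exact_mod_cast NeZero.one_le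
  rw [hc.child_diamSq]
  have := hc.diamSq_le hΛ
  nlinarith [sq_nonneg (4 * Λ / 2 ^ (c.depth / d))]

/-- Cells at the last level have diameter at most `Λ / n`. -/
theorem Dyadic.diam_le_of_depth (hΛ : 0 < Λ) {n : ℕ} (hn : 1 ≤ n) (hc : Dyadic Λ s c)
    (h : c.depth = d * rounds d n) : c.diam ≤ Λ / n := by
  have hd : (0 : ℝ) < d := by exact_mod_cast Nat.pos_of_neZero d
  have hn' : (0 : ℝ) < n := by exact_mod_cast hn
  have h1 := hc.diam_le hΛ
  rw [h, Nat.mul_div_cancel_left _ (Nat.pos_of_neZero d)] at h1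
  refine h1.trans ?_
  have h2 : 4 * √(d : ℝ) * n ≤ (3 / 2 : ℝ) ^ rounds d n := by
    rw [← Real.rpow_natCast, ← Real.logb_le_iff_le_rpow (by norm_num) (by positivity)]
    exact Nat.le_ceil _
  have h3 : (3 / 2 : ℝ) ^ rounds d n ≤ 2 ^ rounds d n := by gcongr; norm_num
  rw [← mul_div_assoc, div_le_div_iff₀ (by positivity) hn']
  nlinarith

theorem Dyadic.cutPos_mem (hΛ : 0 < Λ) (hc : Dyadic Λ s c) :
    c.lo c.axis ≤ (shiftedQuadtree Λ s).cutPos c ∧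
      (shiftedQuadtree Λ s).cutPos c ≤ c.hi c.axis := by
  have : 0 < 4 * Λ / 2 ^ (c.depth / d) := by positivity
  have := hc.side_axis
  rw [hc.cutPos_eq]
  constructor <;> linarith

theorem Dyadic.inBox_of_child (hΛ : 0 < Λ) (hc : Dyadic Λ s c) {a : Bool} {p : Pt d}
    (hp : InBox ((shiftedQuadtree Λ s).child c a) p) : InBox c p := by
  intro j
  have h := hp j
  have hcut := hc.cutPos_mem hΛ
  by_cases hj : j = c.axis
  · subst hj
    cases a <;> simp only [Quadtree.child, Function.update_self] at h <;>
      constructor <;> linarith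
  · cases a <;> simpa [Quadtree.child, Function.update_of_ne hj] using h

theorem inBox_child_side {p : Pt d} (T : Quadtree d) (hp : InBox c p) :
    InBox (T.child c (T.side c p)) p := by
  intro j
  have h := hp j
  by_cases hj : j = c.axis
  · subst hj
    by_cases hcut : p c.axis ≤ T.cutPos c
    · have : T.side c p = false := by simp [Quadtree.side, hcut]
      rw [this]
      simpa [Quadtree.child] using ⟨h.1, hcut⟩
    · have : T.side c p = true := by simp [Quadtree.side, hcut]
      rw [this]
      simpa [Quadtree.child] using ⟨(not_le.mp hcut).le, h.2⟩
  · cases T.side c p <;> simpa [Quadtree.child, Function.update_of_ne hj] using h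

theorem inBox_part (T : Quadtree d) {P : List (Pt d)} (hP : ∀ p ∈ P, InBox c p) (a : Bool) :
    ∀ p ∈ T.part c P a, InBox (T.child c a) p := by
  intro p hp
  simp only [Quadtree.part, List.mem_filter, beq_iff_eq] at hp
  rw [← hp.2]
  exact inBox_child_side T (hP p hp.1)

theorem sum_part (T : Quadtree d) (c : Cell d) (P : List (Pt d)) (f : Pt d → ℝ) :
    (P.map f).sum = ((T.part c P false).map f).sum + ((T.part c P true).map f).sum := by
  induction P with
  | nil => simp [Quadtree.part]
  | cons p P ih =>
    unfold Quadtree.part at ih ⊢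
    cases h : T.side c p <;> simp [h] at ih ⊢ <;> linarith

end Geometry

/-! ### The true cost against the value found by the dynamic program -/

section Domination

variable {d : ℕ}

/-- The cost of the points `P` for the centers of the cells in `S`. -/
noncomputable def coverCost (P : List (Pt d)) (S : List (Cell d)) : ℝ :=
  (P.map fun p => Metric.infDist p {x | ∃ c ∈ S, c.center = x}).sum

theorem coverCost_le_of_subset (P : List (Pt d)) {S S' : List (Cell d)} (h : ∀ c ∈ S, c ∈ S')
    (hS : S ≠ []) : coverCost P S' ≤ coverCost P S := by
  refine List.sum_le_sum fun p _ => Metric.infDist_le_infDist_of_subset ?_ ?_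
  · rintro x ⟨c, hc, rfl⟩; exact ⟨c, h c hc, rfl⟩
  · obtain ⟨c, hc⟩ := List.exists_mem_of_ne_nil S hS
    exact ⟨_, c, hc, rfl⟩

theorem coverCost_le_of_dist_le {P : List (Pt d)} {S : List (Cell d)} {D : ℝ} (hS : S ≠ [])
    (h : ∀ p ∈ P, ∀ c ∈ S, dist p c.center ≤ D) : coverCost P S ≤ P.length * D := by
  obtain ⟨c, hc⟩ := List.exists_mem_of_ne_nil S hS
  have : coverCost P S ≤ (P.map fun _ => D).sum :=
    List.sum_le_sum fun p hp => (Metric.infDist_le_dist_of_mem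
      (s := {x | ∃ c ∈ S, c.center = x}) ⟨c, hc, rfl⟩).trans (h p hp c hc)
  simpa using this

variable (n : ℕ) (Λ : ℝ)

/-- The factor by which the noise of a cell without centers enters the exponential of the error
of the dynamic program. -/
noncomputable def zeroFactor (lam : ℝ) (m : ℕ) (c : Cell d) (x : List Bool → ℝ) : ℝ :=
  open Classical in
  if m = 0 ∨ ¬ Λ / n < c.diam then 1 else Real.exp (-2 * lam * c.diam * x c.name)

theorem zeroFactor_nonneg (lam : ℝ) (m : ℕ) (c : Cell d) (x : List Bool → ℝ) :
    0 ≤ zeroFactor n Λ lam m c x := by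
  unfold zeroFactor; split_ifs <;> positivity

variable [NeZero d]

theorem coverCost_part (T : Quadtree d) (c : Cell d) (P : List (Pt d)) (S : List (Cell d)) :
    coverCost P S = coverCost (T.part c P false) S + coverCost (T.part c P true) S :=
  sum_part T c P _

variable {n} {Λ} {k : ℕ} {b : ℝ} {s : Fin d → ℝ}

local notation "T" => shiftedQuadtree Λ s

/-- The centers chosen for a cell lie in its box. -/
theorem inBox_table (hΛ : 0 < Λ) (x : List Bool → ℝ) (m : ℕ) {c : Cell d} (hc : Dyadic Λ s c)
    (P : List (Pt d)) (k' : ℕ) :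
    ∀ c' ∈ (table n k Λ b T x m c P k').2, InBox c c'.center := by
  have hleaf : ∀ {c : Cell d}, Dyadic Λ s c → ∀ w k', ∀ c' ∈ ((leafTable k c w).val k').2,
      InBox c c'.center := by
    intro c hc w k' c' h
    rcases eq_or_ne k' 0 with rfl | hk
    · simp [leafTable_val_zero] at h
    · rw [leafTable_val _ _ _ hk] at h
      rw [List.eq_of_mem_replicate h]
      exact hc.inBox_center hΛ
  have hinner : ∀ {c : Cell d}, Dyadic Λ s c → ∀ (w : ℝ) (V₁ V₂ : ℕ → ℝ × List (Cell d)),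
      (∀ k', ∀ c' ∈ (V₁ k').2, InBox (Quadtree.child T c false) c'.center) →
      (∀ k', ∀ c' ∈ (V₂ k').2, InBox (Quadtree.child T c true) c'.center) →
      ∀ k', ∀ c' ∈ ((innerTable k c w V₁ V₂).val k').2, InBox c c'.center := by
    intro c hc w V₁ V₂ h₁ h₂ k' c' h
    rcases eq_or_ne k' 0 with rfl | hk
    · simp [innerTable_val_zero] at h
    · rw [innerTable_val _ _ _ _ _ hk] at h
      rcases List.mem_append.mp h with h | h
      · exact hc.inBox_of_child hΛ (h₁ _ _ h)
      · exact hc.inBox_of_child hΛ (h₂ _ _ h)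
  induction m generalizing c P k' with
  | zero => exact hleaf hc 0 k'
  | succ m ih =>
    by_cases h : Λ / n < c.diam
    swap
    · rw [table_of_diam_le _ _ _ _ _ _ _ _ _ h]; exact hleaf hc 0 k'
    rcases lt_trichotomy (weight x c P) (2 * b) with hw | hw | hw
    · rw [table_of_weight_lt _ _ _ _ _ _ _ _ _ h hw]; exact hleaf hc _ k'
    · rw [table_of_weight_eq _ _ _ _ _ _ _ _ _ h hw]
      exact hinner hc _ _ _ (hleaf (hc.child false) 0) (hleaf (hc.child true) 0) k'
    · rw [table_of_lt_weight _ _ _ _ _ _ _ _ _ h hw]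
      exact hinner hc _ _ _ (ih (hc.child false) _) (ih (hc.child true) _) k'

/-- The table of a cell that is not subdivided because its noisy count is at most `2 b`. -/
theorem table_value_of_weight_le (x : List Bool → ℝ) (m : ℕ) (c : Cell d) (P : List (Pt d))
    (h : Λ / n < c.diam) (hw : ¬ 2 * b < weight x c P) {k' : ℕ} (hk : k' ≠ 0) :
    (table n k Λ b T x (m + 1) c P k').1 = 0 := by
  rcases lt_or_eq_of_le (not_lt.mp hw) with hw | hw
  · rw [table_of_weight_lt _ _ _ _ _ _ _ _ _ h hw, leafTable_val _ _ _ hk]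
  · rw [table_of_weight_eq _ _ _ _ _ _ _ _ _ h hw, innerTable_val _ _ _ _ _ hk]
    have h0 : ∀ (c : Cell d) i, ((leafTable k c 0).val i).1 = 0 := by
      intro c i
      rcases eq_or_ne i 0 with rfl | hi
      · simp [leafTable_val_zero]
      · rw [leafTable_val _ _ _ hi]
    rw [(argmin_spec _ _).1]
    simp [h0]

theorem table_value_zero (x : List Bool → ℝ) (m : ℕ) (c : Cell d) (P : List (Pt d))
    (h : Λ / n < c.diam) : (table n k Λ b T x (m + 1) c P 0).1 = weight x c P * c.diam := by
  rcases lt_trichotomy (weight x c P) (2 * b) with hw | hw | hw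
  · rw [table_of_weight_lt _ _ _ _ _ _ _ _ _ h hw, leafTable_val_zero]
  · rw [table_of_weight_eq _ _ _ _ _ _ _ _ _ h hw, innerTable_val_zero]
  · rw [table_of_lt_weight _ _ _ _ _ _ _ _ _ h hw, innerTable_val_zero]

/-- The table of a cell that was not given a count. -/
theorem table_of_pruned (x : List Bool → ℝ) (m : ℕ) (c : Cell d) (P : List (Pt d))
    (h : m = 0 ∨ ¬ Λ / n < c.diam) : table n k Λ b T x m c P = (leafTable k c 0).val := by
  cases m with
  | zero => rfl
  | succ m => exact table_of_diam_le _ _ _ _ _ _ _ _ _ (h.resolve_left (Nat.succ_ne_zero m))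

variable (n Λ s)

/-- A random variable that dominates `z ^ k' * exp (lam * error)` for all `k' ≥ 1`, where `error`
is the excess of the true cost inside a cell over (twice) the value that the dynamic program found
with `k'` centers. Weighting by `z ^ k'` turns the maximum over all ways to distribute the centers
into a product over the two children. -/
noncomputable def expError (b lam z : ℝ) : ℕ → Cell d → List (Pt d) → (List Bool → ℝ) → ℝ
  | 0, _, _, _ => z
  | m + 1, c, P, x =>
    open Classical in
    if Λ / n < c.diam then
      z * Real.exp (lam * (2 * b - x c.name) * c.diam) + splitIndicator b P.length (x c.name) *
        (expError b lam z m (Quadtree.child T c false) (Quadtree.part T c P false) x *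
            zeroFactor n Λ lam m (Quadtree.child T c true) x +
          zeroFactor n Λ lam m (Quadtree.child T c false) x *
            expError b lam z m (Quadtree.child T c true) (Quadtree.part T c P true) x +
          expError b lam z m (Quadtree.child T c false) (Quadtree.part T c P false) x *
            expError b lam z m (Quadtree.child T c true) (Quadtree.part T c P true) x)
    else z

theorem expError_nonneg (b lam : ℝ) {z : ℝ} (hz : 0 ≤ z) (m : ℕ) (c : Cell d) (P : List (Pt d))
    (x : List Bool → ℝ) : 0 ≤ expError n Λ s b lam z m c P x := by
  induction m generalizing c P with
  | zero => exact hz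
  | succ m ih =>
    rw [expError]
    split_ifs
    · have h₁ := ih (Quadtree.child T c false) (Quadtree.part T c P false)
      have h₂ := ih (Quadtree.child T c true) (Quadtree.part T c P true)
      have h₃ := zeroFactor_nonneg n Λ lam m (Quadtree.child T c false) x
      have h₄ := zeroFactor_nonneg n Λ lam m (Quadtree.child T c true) x
      have h₅ := splitIndicator_nonneg (b := b) P.length (x c.name)
      positivity
    · exact hz

variable {n Λ s}

theorem le_zeroFactor {lam : ℝ} (hlam : 0 ≤ lam) (hΛ : 0 < Λ) (x : List Bool → ℝ) (m : ℕ)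
    {c : Cell d} (hm : m = 0 → c.diam ≤ Λ / n) (P : List (Pt d)) :
    Real.exp (lam * (2 * (P.length * c.diam) - 2 * (table n k Λ b T x m c P 0).1 -
      2 * P.length * (Λ / n))) ≤ zeroFactor n Λ lam m c x := by
  have h0 : 0 ≤ 2 * P.length * (Λ / n) := by positivity
  unfold zeroFactor
  split_ifs with h
  · rw [table_of_pruned x m c P h, leafTable_val_zero, Real.exp_le_one_iff]
    have hd : c.diam ≤ Λ / n := h.elim hm not_lt.mp
    refine mul_nonpos_of_nonneg_of_nonpos hlam ?_
    have : (P.length : ℝ) * c.diam ≤ P.length * (Λ / n) := by gcongr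
    simp only [zero_mul]
    linarith
  · push Not at h
    obtain ⟨m, rfl⟩ := Nat.exists_eq_succ_of_ne_zero h.1
    rw [table_value_zero x m c P h.2, weight]
    refine Real.exp_le_exp.mpr ?_
    calc lam * (2 * (P.length * c.diam) - 2 * ((P.length + x c.name) * c.diam) -
          2 * P.length * (Λ / n))
        = -2 * lam * c.diam * x c.name - lam * (2 * P.length * (Λ / n)) := by ring
      _ ≤ _ := by have := mul_nonneg hlam h0; linarith

/-- The error of the dynamic program is dominated by `expError`. The nearest center of a point in
a cell without centers lies in the sibling cell, at distance at most the diameter of the parent,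
which is at most twice the diameter of the cell. -/
theorem le_expError {lam z : ℝ} (hlam : 0 ≤ lam) (hz : 0 ≤ z) (hz1 : z ≤ 1) (hΛ : 0 < Λ)
    (hn : 1 ≤ n) (x : List Bool → ℝ) (m : ℕ) {c : Cell d} (hc : Dyadic Λ s c)
    (hm : c.depth + m = d * rounds d n) {P : List (Pt d)} (hP : ∀ p ∈ P, InBox c p) {k' : ℕ}
    (hk : k' ≠ 0) :
    z ^ k' * Real.exp (lam * (coverCost P (table n k Λ b T x m c P k').2 -
      2 * (table n k Λ b T x m c P k').1 - 2 * P.length * (Λ / n))) ≤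
      expError n Λ s b lam z m c P x := by
  have hzk : z ^ k' ≤ z := pow_le_of_le_one hz hz1 hk
  have hzk0 : 0 ≤ z ^ k' := pow_nonneg hz k'
  have hne : ∀ m (c : Cell d) P k', k' ≠ 0 → (table n k Λ b T x m c P k').2 ≠ [] := by
    intro m c P k' hk h
    have := table_length n k Λ b T x m c P k'
    rw [h] at this
    exact hk this.symm
  -- a crude bound, good enough for cells that are not subdivided
  have hcost : ∀ m {c : Cell d}, Dyadic Λ s c → ∀ P : List (Pt d), (∀ p ∈ P, InBox c p) →
      ∀ k', k' ≠ 0 → coverCost P (table n k Λ b T x m c P k').2 ≤ P.length * c.diam :=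
    fun m c hc P hP k' hk => coverCost_le_of_dist_le (hne m c P k' hk) fun p hp c' hc' =>
      hc.dist_le_diam (hP p hp) (inBox_table hΛ x m hc P k' c' hc')
  have hpruned : ∀ m {c : Cell d}, Dyadic Λ s c → ∀ P : List (Pt d), (∀ p ∈ P, InBox c p) →
      (m = 0 ∨ ¬ Λ / n < c.diam) → c.diam ≤ Λ / n → ∀ k', k' ≠ 0 → z ^ k' ≤ z → 0 ≤ z ^ k' →
      z ^ k' * Real.exp (lam * (coverCost P (table n k Λ b T x m c P k').2 -
        2 * (table n k Λ b T x m c P k').1 - 2 * P.length * (Λ / n))) ≤ z := by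
    intro m c hc P hP h hd k' hk hzk hzk0
    refine (mul_le_of_le_one_right hzk0 ?_).trans hzk
    have h1 := hcost m hc P hP k' hk
    rw [table_of_pruned x m c P h] at h1 ⊢
    rw [leafTable_val _ _ _ hk] at h1 ⊢
    rw [Real.exp_le_one_iff]
    refine mul_nonpos_of_nonneg_of_nonpos hlam ?_
    have h2 : (P.length : ℝ) * c.diam ≤ P.length * (Λ / n) := by gcongr
    have h3 : (0 : ℝ) ≤ P.length * (Λ / n) := by positivity
    simp only at h1 ⊢
    linarith
  induction m generalizing c P k' with
  | zero =>
    exact hpruned 0 hc P hP (Or.inl rfl) (hc.diam_le_of_depth hΛ hn hm) k' hk hzk hzk0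
  | succ m ih =>
    rw [expError]
    split_ifs with h
    swap
    · exact hpruned (m + 1) hc P hP (Or.inr h) (not_lt.mp h) k' hk hzk hzk0
    have e₁ := expError_nonneg n Λ s b lam hz m (Quadtree.child T c false)
      (Quadtree.part T c P false) x
    have e₂ := expError_nonneg n Λ s b lam hz m (Quadtree.child T c true)
      (Quadtree.part T c P true) x
    have f₁ := zeroFactor_nonneg n Λ lam m (Quadtree.child T c false) x
    have f₂ := zeroFactor_nonneg n Λ lam m (Quadtree.child T c true) x
    have m₁ := mul_nonneg e₁ f₂
    have m₂ := mul_nonneg f₁ e₂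
    have m₃ := mul_nonneg e₁ e₂
    have hΛn : (0 : ℝ) ≤ Λ / n := by positivity
    by_cases hw : 2 * b < weight x c P
    swap
    · have h1 := hcost (m + 1) hc P hP k' hk
      refine le_trans ?_ (le_add_of_nonneg_right
        (mul_nonneg (splitIndicator_nonneg _ _) (by positivity)))
      refine mul_le_mul hzk (Real.exp_le_exp.mpr ?_) (Real.exp_pos _).le hz
      rw [table_value_of_weight_le x m c P h hw hk, mul_assoc lam]
      refine mul_le_mul_of_nonneg_left ?_ hlam
      have h2 : (P.length : ℝ) ≤ 2 * b - x c.name := by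
        have := not_lt.mp hw
        rw [weight] at this; linarith
      have h3 := mul_le_mul_of_nonneg_right h2 c.diam_nonneg
      have h4 : (0 : ℝ) ≤ P.length * (Λ / n) := by positivity
      linarith
    · rw [splitIndicator_of_lt (by exact hw), one_mul]
      refine le_trans ?_ (le_add_of_nonneg_left (by positivity))
      rw [table_of_lt_weight _ _ _ _ _ _ _ _ _ h hw, innerTable_val _ _ _ _ _ hk]
      obtain ⟨V₁, hV₁⟩ : ∃ V, V = table n k Λ b T x m (Quadtree.child T c false)
        (Quadtree.part T c P false) := ⟨_, rfl⟩
      obtain ⟨V₂, hV₂⟩ : ∃ V, V = table n k Λ b T x m (Quadtree.child T c true)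
        (Quadtree.part T c P true) := ⟨_, rfl⟩
      rw [← hV₁, ← hV₂]
      have hi := argmin_le (fun i => (V₁ i).1 + (V₂ (k' - i)).1) k'
      have hv := (argmin_spec (fun i => (V₁ i).1 + (V₂ (k' - i)).1) k').1
      simp only [hv]
      obtain ⟨i, hi'⟩ : ∃ i, i = (argmin (fun i => (V₁ i).1 + (V₂ (k' - i)).1) k').val.1 :=
        ⟨_, rfl⟩
      rw [← hi'] at hi ⊢
      have hc₁ := hc.child false
      have hc₂ := hc.child true
      have hP₁ := inBox_part T hP false
      have hP₂ := inBox_part T hP true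
      have d₁ : (Quadtree.child T c false).depth + m = d * rounds d n := by
        rw [child_depth]; omega
      have d₂ : (Quadtree.child T c true).depth + m = d * rounds d n := by
        rw [child_depth]; omega
      have hlen : (P.length : ℝ) = (Quadtree.part T c P false).length +
          (Quadtree.part T c P true).length := by exact_mod_cast (part_length T c P).symm
      have hsum := coverCost_part T c P ((V₁ i).2 ++ (V₂ (k' - i)).2)
      have hbox₁ := fun i => inBox_table (n := n) (k := k) (b := b) hΛ x m hc₁
        (Quadtree.part T c P false) i
      have hbox₂ := fun i => inBox_table (n := n) (k := k) (b := b) hΛ x m hc₂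
        (Quadtree.part T c P true) i
      have l₁ := fun i => table_length n k Λ b T x m (Quadtree.child T c false)
        (Quadtree.part T c P false) i
      have l₂ := fun i => table_length n k Λ b T x m (Quadtree.child T c true)
        (Quadtree.part T c P true) i
      have z₁ := le_zeroFactor (s := s) (k := k) (b := b) hlam hΛ x m
        (fun h0 => hc₁.diam_le_of_depth hΛ hn (by rw [h0] at d₁; exact d₁))
        (Quadtree.part T c P false)
      have z₂ := le_zeroFactor (s := s) (k := k) (b := b) hlam hΛ x m
        (fun h0 => hc₂.diam_le_of_depth hΛ hn (by rw [h0] at d₂; exact d₂))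
        (Quadtree.part T c P true)
      have i₁ := fun (i : ℕ) (hi : i ≠ 0) => ih hc₁ d₁ hP₁ hi
        (pow_le_of_le_one hz hz1 hi) (pow_nonneg hz i)
      have i₂ := fun (i : ℕ) (hi : i ≠ 0) => ih hc₂ d₂ hP₂ hi
        (pow_le_of_le_one hz hz1 hi) (pow_nonneg hz i)
      rw [← hV₁] at hbox₁ l₁ z₁ i₁
      rw [← hV₂] at hbox₂ l₂ z₂ i₂
      rcases Nat.eq_zero_or_pos i with h0 | h0
      · have hS : (V₁ i).2 = [] := List.length_eq_zero_iff.mp ((l₁ i).trans h0)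
        rw [hS, List.nil_append] at hsum ⊢
        rw [h0, Nat.sub_zero] at hsum ⊢
        have hfar : coverCost (Quadtree.part T c P false) (V₂ k').2 ≤
            2 * ((Quadtree.part T c P false).length * (Quadtree.child T c false).diam) := by
          refine (coverCost_le_of_dist_le (D := 2 * (Quadtree.child T c false).diam)
            (fun h => hk (by rw [← l₂ k', h]; rfl)) fun p hp c' hc' => ?_).trans_eq (by ring)
          exact (hc.dist_le_diam (hP p (List.mem_filter.mp hp).1)
            (hc.inBox_of_child hΛ (hbox₂ k' c' hc'))).trans (hc.diam_le_child false)
        refine le_trans ?_ (le_add_of_le_of_nonneg (le_add_of_nonneg_left m₁) m₃)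
        refine le_trans ?_ (mul_le_mul z₁ (i₂ k' hk) (by positivity) f₁)
        rw [mul_left_comm, ← Real.exp_add, ← mul_add, hsum, hlen]
        gcongr
        linarith
      rcases Nat.eq_zero_or_pos (k' - i) with h1 | h1
      · have hS : (V₂ (k' - i)).2 = [] := List.length_eq_zero_iff.mp ((l₂ _).trans h1)
        rw [hS, List.append_nil] at hsum ⊢
        have hik : i = k' := by omega
        rw [hik] at hsum
        rw [h1, hik]
        have hfar : coverCost (Quadtree.part T c P true) (V₁ k').2 ≤
            2 * ((Quadtree.part T c P true).length * (Quadtree.child T c true).diam) := by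
          refine (coverCost_le_of_dist_le (D := 2 * (Quadtree.child T c true).diam)
            (fun h => hk (by rw [← l₁ k', h]; rfl)) fun p hp c' hc' => ?_).trans_eq (by ring)
          exact (hc.dist_le_diam (hP p (List.mem_filter.mp hp).1)
            (hc.inBox_of_child hΛ (hbox₁ k' c' hc'))).trans (hc.diam_le_child true)
        refine le_trans ?_ (le_add_of_le_of_nonneg (le_add_of_nonneg_right m₂) m₃)
        refine le_trans ?_ (mul_le_mul (i₁ k' hk) z₂ (by positivity) e₁)
        rw [mul_assoc (z ^ k') (Real.exp _) (Real.exp _), ← Real.exp_add, ← mul_add, hsum, hlen]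
        gcongr
        linarith
      · have hS₁ : coverCost (Quadtree.part T c P false) ((V₁ i).2 ++ (V₂ (k' - i)).2) ≤
            coverCost (Quadtree.part T c P false) (V₁ i).2 :=
          coverCost_le_of_subset _ (fun _ h => List.mem_append_left _ h)
            (fun h => h0.ne' (by rw [← l₁ i, h]; rfl))
        have hS₂ : coverCost (Quadtree.part T c P true) ((V₁ i).2 ++ (V₂ (k' - i)).2) ≤
            coverCost (Quadtree.part T c P true) (V₂ (k' - i)).2 :=
          coverCost_le_of_subset _ (fun _ h => List.mem_append_right _ h)
            (fun h => h1.ne' (by rw [← l₂ (k' - i), h]; rfl))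
        refine le_trans ?_ (le_add_of_nonneg_left (add_nonneg m₁ m₂))
        refine le_trans ?_ (mul_le_mul (i₁ i h0.ne') (i₂ (k' - i) h1.ne') (by positivity) e₁)
        rw [mul_mul_mul_comm, ← pow_add, Nat.add_sub_cancel' hi, ← Real.exp_add, ← mul_add, hsum,
          hlen]
        gcongr
        linarith

end Domination

/-! ### The expected error of the dynamic program -/

section ExpectedError

variable {d : ℕ} {b : ℝ}

theorem exp_one_lt_three : Real.exp 1 < 3 := lt_trans Real.exp_one_lt_d9 (by norm_num)

theorem leafFactor_expectation (hb : 0 < b) {lam : ℝ} (hlam : 0 ≤ lam) {c : Cell d}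
    (hd : lam * b * c.diam ≤ 1 / 8) :
    Integrable (fun t => Real.exp (lam * (2 * b - t) * c.diam)) (laplace b) ∧
      ∫ t, Real.exp (lam * (2 * b - t) * c.diam) ∂laplace b ≤ 2 := by
  have h0 : 0 ≤ lam * b * c.diam := mul_nonneg (mul_nonneg hlam hb.le) c.diam_nonneg
  have hsq : (-lam * c.diam) ^ 2 * b ^ 2 = (lam * b * c.diam) ^ 2 := by ring
  obtain ⟨h₁, h₂⟩ := exp_laplace_le (t := -lam * c.diam) hb (by rw [hsq]; nlinarith)
  have e : (fun t => Real.exp (lam * (2 * b - t) * c.diam)) = fun t =>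
      Real.exp (2 * (lam * b * c.diam)) * Real.exp (-lam * c.diam * t) := by
    funext t; rw [← Real.exp_add]; congr 1; ring
  rw [e]
  refine ⟨h₁.const_mul _, ?_⟩
  rw [integral_const_mul]
  refine (mul_le_mul_of_nonneg_left h₂ (Real.exp_pos _).le).trans ?_
  rw [← Real.exp_add, hsq]
  have : Real.exp (2 * (lam * b * c.diam) + 2 * (lam * b * c.diam) ^ 2) ≤ Real.exp (1 / 2) :=
    Real.exp_le_exp.mpr (by nlinarith)
  refine this.trans ?_
  rw [Real.exp_half]
  rw [Real.sqrt_le_iff]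
  exact ⟨by norm_num, by linarith [exp_one_lt_three]⟩

variable [NeZero d] {n : ℕ} {Λ : ℝ} {s : Fin d → ℝ}

local notation "T" => shiftedQuadtree Λ s

/-- The noise of a cell without centers contributes a factor that grows with the squared
diameter. -/
theorem zeroFactor_expectation (hb : 0 < b) {lam : ℝ} {m : ℕ} {c : Cell d}
    (hc : Dyadic Λ s c) (h : 8 * (lam ^ 2 * b ^ 2) * c.diamSq ≤ 1) :
    NoiseVariable b (descendants c.name) (zeroFactor n Λ lam m c) ∧
      ∫ x, zeroFactor n Λ lam m c x ∂noiseLaw b ≤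
        Real.exp (8 * (lam ^ 2 * b ^ 2) * c.diamSq) := by
  by_cases hm : m = 0 ∨ ¬ Λ / n < c.diam
  · have e : zeroFactor n Λ lam m c = fun _ => 1 := by
      funext x; rw [zeroFactor, if_pos hm]
    rw [e]
    refine ⟨NoiseVariable.const _ _, ?_⟩
    have := hc.diamSq_nonneg
    simpa using by positivity
  · have e : zeroFactor n Λ lam m c = fun x => Real.exp (-2 * lam * c.diam * x c.name) +
        (fun _ => (0 : ℝ)) (x c.name) * (fun _ => (0 : ℝ)) x := by
      funext x; rw [zeroFactor, if_neg hm]; ring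
    have hsq : (-2 * lam * c.diam) ^ 2 * b ^ 2 = 4 * (lam ^ 2 * b ^ 2) * c.diamSq := by
      rw [← hc.diam_sq]; ring
    obtain ⟨h₁, h₂⟩ := exp_laplace_le (t := -2 * lam * c.diam) hb (by rw [hsq]; linarith)
    obtain ⟨h₃, h₄⟩ := NoiseVariable.node (s := c.name) h₁ (by fun_prop)
      (integrable_const (μ := laplace b) (0 : ℝ)) measurable_const
      (NoiseVariable.const (b := b) _ (0 : ℝ))
    rw [e]
    refine ⟨h₃, h₄.trans_le ?_⟩
    simp only [integral_zero, zero_mul, add_zero]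
    refine h₂.trans_eq ?_
    rw [hsq]; ring_nf

/-- The arithmetic of one level in the estimate of the expected error. Here `L`, `R` stand for the
expected errors of the two children, `V`, `U` for their expected factors without centers, `F` for
the factor of a leaf, and `p` for the probability of a subdivision. -/
theorem expError_step {z L R U V F p E E' g r e m A B : ℝ} (hz : 0 ≤ z) (hL : 0 ≤ L) (hR : 0 ≤ R)
    (hV : 0 ≤ V) (hU : 0 ≤ U) (hr : 0 ≤ r) (hRr : R ≤ r) (hUg : U ≤ g) (hVg : V ≤ g) (hF : F ≤ 2)
    (_ : 0 ≤ p) (hp1 : p ≤ 1) (hL' : L ≤ z * E * (4 + 6 * m * A))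
    (hR' : R ≤ z * E * (4 + 6 * m * B)) (he : g + r ≤ e) (hE : e * E ≤ E') (he0 : 0 ≤ e)
    (hE' : 1 ≤ E') (hm : 0 ≤ m) (hAB : 1 ≤ A + B) :
    z * F + p * (L * V + U * R + L * R) ≤ z * E' * (4 + 6 * (m + 1) * (A + B)) := by
  obtain ⟨W, hW⟩ : ∃ W, W = 8 + 6 * m * (A + B) := ⟨_, rfl⟩
  have hg : 0 ≤ g := hU.trans hUg
  have hG0 : 0 ≤ L * V + U * R + L * R := by positivity
  have h0 : L + R ≤ z * E * W := by rw [hW]; linarith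
  have h1 : L * V + U * R + L * R ≤ (g + r) * (L + R) := by
    have i1 : L * V ≤ L * g := mul_le_mul_of_nonneg_left hVg hL
    have i2 : U * R ≤ g * R := mul_le_mul_of_nonneg_right hUg hR
    have i3 : L * R ≤ L * r := mul_le_mul_of_nonneg_left hRr hL
    have i4 : 0 ≤ r * R := by positivity
    linarith
  have h2 : (g + r) * (L + R) ≤ e * (z * E * W) :=
    mul_le_mul he h0 (add_nonneg hL hR) he0
  have h3 : e * (z * E * W) ≤ z * E' * W := by
    have hW0 : 0 ≤ W := by rw [hW]; positivity
    calc e * (z * E * W) = z * (e * E) * W := by ring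
      _ ≤ z * E' * W := by gcongr
  have h4 : p * (L * V + U * R + L * R) ≤ L * V + U * R + L * R := mul_le_of_le_one_left hG0 hp1
  have hzE : z ≤ z * E' := le_mul_of_one_le_right hz hE'
  have h5 : z * F ≤ z * E' * 2 := by
    have := mul_le_mul_of_nonneg_left hF hz
    linarith
  have h6 : z * E' * 6 ≤ z * E' * (6 * (A + B)) :=
    mul_le_mul_of_nonneg_left (by linarith) (hz.trans hzE)
  have h7 : z * E' * (4 + 6 * (m + 1) * (A + B)) =
      z * E' * W + z * E' * (6 * (A + B)) - z * E' * 4 := by rw [hW]; ring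
  rw [h7]
  linarith

/-- Below an empty cell the tree is a subcritical branching process; otherwise one node per point
and level adds one way to place a center. The growth factor `exp (κ diamSq)` of a level is
absorbed by the potential `4 / 3 * d * κ * diamSq`. -/
theorem expError_expectation (hb : 0 < b) (hΛ : 0 < Λ) {lam z κ : ℝ} {N M : ℕ} (hlam : 0 ≤ lam)
    (hz : 0 ≤ z) (hN : 1 ≤ N) (hM : 1 ≤ M) (hzM : z * (40 * M ^ 2 * N) ≤ 1)
    (hκ : κ = 8 * (lam ^ 2 * b ^ 2)) (hd : lam * b * (4 * Λ * √d) ≤ 1 / 8)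
    (hκd : κ * (d * (16 * d * Λ ^ 2)) ≤ 1 / 8)
    (m : ℕ) (hm : m ≤ M) {c : Cell d} (hc : Dyadic Λ s c) (P : List (Pt d)) (hP : P.length ≤ N) :
    NoiseVariable b (descendants c.name) (expError n Λ s b lam z m c P) ∧
      (P.length = 0 → ∫ x, expError n Λ s b lam z m c P x ∂noiseLaw b ≤ 4 * z) ∧
      ∫ x, expError n Λ s b lam z m c P x ∂noiseLaw b ≤
        z * Real.exp (κ * (4 / 3 * d * c.diamSq) + m / M) * (4 + 6 * m * P.length) := by
  have hd1 : (1 : ℝ) ≤ d := by exact_mod_cast NeZero.one_le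
  have hM0 : (0 : ℝ) < M := by exact_mod_cast hM
  have hM1 : (1 : ℝ) ≤ M := by exact_mod_cast hM
  have hN1 : (1 : ℝ) ≤ N := by exact_mod_cast hN
  have hκ0 : 0 ≤ κ := by rw [hκ]; positivity
  -- estimates valid at every cell
  have hκc : ∀ {c : Cell d}, Dyadic Λ s c → κ * c.diamSq ≤ 1 / 8 := by
    intro c hc
    refine le_trans ?_ hκd
    refine mul_le_mul_of_nonneg_left ((hc.diamSq_le_root hΛ).trans ?_) hκ0
    exact le_mul_of_one_le_left (by positivity) hd1
  have hκd' : ∀ {c : Cell d}, Dyadic Λ s c → κ * (4 / 3 * d * c.diamSq) ≤ 1 / 4 := by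
    intro c hc
    have h1 : (d : ℝ) * c.diamSq ≤ d * (16 * d * Λ ^ 2) :=
      mul_le_mul_of_nonneg_left (hc.diamSq_le_root hΛ) (by positivity)
    have h2 := mul_le_mul_of_nonneg_left h1 hκ0
    linarith
  have hΓ : ∀ {c : Cell d}, Dyadic Λ s c → ∀ m ≤ M,
      Real.exp (κ * (4 / 3 * d * c.diamSq) + m / M) ≤ 4 := by
    intro c hc m hm
    have h1 : (m : ℝ) / M ≤ 1 := (div_le_one hM0).mpr (by exact_mod_cast hm)
    have h2 := hκd' hc
    have h3 : Real.exp (1 / 4) ≤ 4 / 3 := by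
      rw [show (1 / 4 : ℝ) = 1 * (1 / 4) by ring, Real.exp_mul]
      have : Real.exp 1 ≤ (4 / 3 : ℝ) ^ (4 : ℝ) := by
        rw [show (4 : ℝ) = ((4 : ℕ) : ℝ) by norm_num, Real.rpow_natCast]
        exact Real.exp_one_lt_d9.le.trans (by norm_num)
      refine (Real.rpow_le_rpow (Real.exp_pos 1).le this (by norm_num)).trans_eq ?_
      rw [← Real.rpow_mul (by norm_num)]; norm_num
    calc Real.exp (κ * (4 / 3 * d * c.diamSq) + m / M) ≤ Real.exp (1 / 4 + 1) :=
          Real.exp_le_exp.mpr (add_le_add h2 h1)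
      _ = Real.exp (1 / 4) * Real.exp 1 := Real.exp_add _ _
      _ ≤ 4 / 3 * 3 := mul_le_mul h3 exp_one_lt_three.le (Real.exp_pos _).le (by norm_num)
      _ = 4 := by norm_num
  have hleaf : ∀ {c : Cell d}, Dyadic Λ s c → lam * b * c.diam ≤ 1 / 8 := by
    intro c hc
    refine le_trans (mul_le_mul_of_nonneg_left ?_ (mul_nonneg hlam hb.le)) hd
    refine Real.sqrt_le_iff.mpr ⟨by positivity, (hc.diamSq_le_root hΛ).trans_eq ?_⟩
    rw [mul_pow, Real.sq_sqrt (by positivity)]; ring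
  have hz40 : z ≤ 1 / 40 := by
    have : (40 : ℝ) ≤ 40 * M ^ 2 * N := by
      have := one_le_mul_of_one_le_of_one_le (one_le_pow₀ hM1 (n := 2)) hN1
      linarith
    have := mul_le_mul_of_nonneg_left this hz
    linarith
  have hΓ1 : ∀ {c : Cell d}, Dyadic Λ s c → ∀ m : ℕ,
      1 ≤ Real.exp (κ * (4 / 3 * d * c.diamSq) + m / M) := fun {c} hc m =>
    Real.one_le_exp (by have := hc.diamSq_nonneg; positivity)
  induction m generalizing c P with
  | zero =>
    refine ⟨NoiseVariable.const _ _, fun _ => ?_, ?_⟩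
    · simp only [expError]; simp; linarith
    · have := hΓ1 hc 0
      simp only [expError, integral_const, probReal_univ, one_smul, Nat.cast_zero, mul_zero,
        zero_mul, add_zero] at this ⊢
      nlinarith
  | succ m ih =>
    by_cases hcd : Λ / n < c.diam
    swap
    · have e : expError n Λ s b lam z (m + 1) c P = fun _ => z := by
        funext x; rw [expError, if_neg hcd]
      rw [e]
      refine ⟨NoiseVariable.const _ _, fun _ => by simp; linarith, ?_⟩
      have h1 := hΓ1 hc (m + 1)
      have h2 : (1 : ℝ) ≤ 4 + 6 * ((m + 1 : ℕ) : ℝ) * P.length := by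
        have : (0 : ℝ) ≤ 6 * ((m + 1 : ℕ) : ℝ) * P.length := by positivity
        linarith
      simp only [integral_const, probReal_univ, one_smul]
      rw [mul_assoc]
      exact le_mul_of_one_le_right hz (one_le_mul_of_one_le_of_one_le h1 h2)
    have hm' : m ≤ M := by omega
    have hpl := part_length T c P
    have c₁ := hc.child false
    have c₂ := hc.child true
    obtain ⟨l₁, l₀, l₂⟩ := ih hm' c₁ (Quadtree.part T c P false) (by omega)
    obtain ⟨r₁, r₀, r₂⟩ := ih hm' c₂ (Quadtree.part T c P true) (by omega)
    obtain ⟨u₁, u₂⟩ := zeroFactor_expectation (n := n) (m := m) hb c₁ (lam := lam)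
      (by rw [← hκ]; linarith [hκc c₁])
    obtain ⟨v₁, v₂⟩ := zeroFactor_expectation (n := n) (m := m) hb c₂ (lam := lam)
      (by rw [← hκ]; linarith [hκc c₂])
    rw [child_name] at l₁ r₁ u₁ v₁
    rw [← hκ] at u₂ v₂
    have hdj := disjoint_descendants c.name
    obtain ⟨a₁, a₂⟩ := l₁.mul v₁ hdj
    obtain ⟨b₁, b₂⟩ := u₁.mul r₁ hdj
    obtain ⟨e₁, e₂⟩ := l₁.mul r₁ hdj
    have hsub := Set.union_subset (descendants_cons_subset false c.name)
      (descendants_cons_subset true c.name)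
    have hG := ((a₁.mono hsub).add (b₁.mono hsub)).add (e₁.mono hsub)
    obtain ⟨f₁, f₂⟩ := leafFactor_expectation hb hlam (hleaf hc)
    obtain ⟨g₁, g₂⟩ := NoiseVariable.node (s := c.name) (f₁.const_mul z) (by fun_prop)
      (integrable_splitIndicator P.length) (measurable_splitIndicator P.length) hG
    have e : expError n Λ s b lam z (m + 1) c P = fun x =>
        z * Real.exp (lam * (2 * b - x c.name) * c.diam) +
          splitIndicator b P.length (x c.name) *
        (expError n Λ s b lam z m (Quadtree.child T c false) (Quadtree.part T c P false) x *
            zeroFactor n Λ lam m (Quadtree.child T c true) x +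
          zeroFactor n Λ lam m (Quadtree.child T c false) x *
            expError n Λ s b lam z m (Quadtree.child T c true) (Quadtree.part T c P true) x +
          expError n Λ s b lam z m (Quadtree.child T c false) (Quadtree.part T c P false) x *
            expError n Λ s b lam z m (Quadtree.child T c true) (Quadtree.part T c P true) x) := by
      funext x; rw [expError, if_pos hcd]
    rw [integral_add ((a₁.mono hsub).add (b₁.mono hsub)).integrable e₁.integrable,
      integral_add a₁.integrable b₁.integrable, a₂, b₂, e₂, integral_const_mul] at g₂
    rw [e]
    refine ⟨g₁, ?_⟩
    rw [g₂]
    have p₀ := integral_splitIndicator_nonneg (b := b) P.length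
    have L0 : 0 ≤ ∫ x, expError n Λ s b lam z m (Quadtree.child T c false)
        (Quadtree.part T c P false) x ∂noiseLaw b :=
      integral_nonneg (expError_nonneg n Λ s b lam hz m _ _)
    have R0 : 0 ≤ ∫ x, expError n Λ s b lam z m (Quadtree.child T c true)
        (Quadtree.part T c P true) x ∂noiseLaw b :=
      integral_nonneg (expError_nonneg n Λ s b lam hz m _ _)
    have U0 : 0 ≤ ∫ x, zeroFactor n Λ lam m (Quadtree.child T c false) x ∂noiseLaw b :=
      integral_nonneg (zeroFactor_nonneg n Λ lam m _)
    have V0 : 0 ≤ ∫ x, zeroFactor n Λ lam m (Quadtree.child T c true) x ∂noiseLaw b :=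
      integral_nonneg (zeroFactor_nonneg n Λ lam m _)
    -- both children have the same diameter
    have hdq : (Quadtree.child T c true).diamSq = (Quadtree.child T c false).diamSq := by
      rw [hc.child_diamSq, hc.child_diamSq]
    rw [hdq] at v₂ r₂
    have hpot := hc.potential hΛ false
    have hκ₁ := hκc c₁
    have hΓm := hΓ c₁ m hm'
    have hΓm1 := hΓ1 c₁ m
    generalize (∫ x, expError n Λ s b lam z m (Quadtree.child T c false)
        (Quadtree.part T c P false) x ∂noiseLaw b) = L at *
    generalize (∫ x, expError n Λ s b lam z m (Quadtree.child T c true)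
        (Quadtree.part T c P true) x ∂noiseLaw b) = R at *
    generalize (∫ x, zeroFactor n Λ lam m (Quadtree.child T c false) x ∂noiseLaw b) = U at *
    generalize (∫ x, zeroFactor n Λ lam m (Quadtree.child T c true) x ∂noiseLaw b) = V at *
    generalize (∫ t, Real.exp (lam * (2 * b - t) * c.diam) ∂laplace b) = F at *
    generalize (Quadtree.child T c false).diamSq = δ at *
    have hempty : P.length = 0 → z * F + (∫ t, splitIndicator b P.length t ∂laplace b) *
        (L * V + U * R + L * R) ≤ 4 * z := by
      intro h0
      have p₁ := integral_splitIndicator_zero hb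
      rw [h0] at p₀ ⊢
      replace l₀ := l₀ (by omega)
      replace r₀ := r₀ (by omega)
      have hE : Real.exp (κ * δ) ≤ 3 :=
        (Real.exp_le_exp.mpr (by linarith)).trans exp_one_lt_three.le
      have hU3 := u₂.trans hE
      have hV3 := v₂.trans hE
      have h1 : L * V ≤ 4 * z * 3 := mul_le_mul l₀ hV3 V0 (by linarith)
      have h2 : U * R ≤ 3 * (4 * z) := mul_le_mul hU3 r₀ R0 (by norm_num)
      have h3 : L * R ≤ 4 * z * (4 * (1 / 40)) :=
        mul_le_mul l₀ (r₀.trans (by linarith)) R0 (by linarith)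
      have h4 : (∫ t, splitIndicator b 0 t ∂laplace b) * (L * V + U * R + L * R) ≤
          7 / 100 * (25 * z) := mul_le_mul p₁ (by linarith) (by positivity) (by norm_num)
      have h5 : z * F ≤ z * 2 := mul_le_mul_of_nonneg_left f₂ hz
      linarith
    refine ⟨hempty, ?_⟩
    rcases Nat.eq_zero_or_pos P.length with h0 | h0
    · refine (hempty h0).trans ?_
      rw [h0]
      have := mul_le_mul_of_nonneg_left (hΓ1 hc (m + 1)) hz
      simp only [Nat.cast_zero, mul_zero, add_zero]
      linarith
    · have p₁ := integral_splitIndicator_le_one (b := b) P.length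
      have hP1 : (1 : ℝ) ≤ P.length := by exact_mod_cast h0
      have hlen : (P.length : ℝ) = (Quadtree.part T c P false).length +
          (Quadtree.part T c P true).length := by exact_mod_cast hpl.symm
      have hr : ((Quadtree.part T c P true).length : ℝ) ≤ N := by
        exact_mod_cast (by omega : (Quadtree.part T c P true).length ≤ N)
      have hmM : (m : ℝ) ≤ M := by exact_mod_cast hm'
      generalize ((Quadtree.part T c P false).length : ℝ) = A at *
      have hB0 : (0 : ℝ) ≤ ((Quadtree.part T c P true).length : ℝ) := by positivity
      generalize ((Quadtree.part T c P true).length : ℝ) = B at *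
      obtain ⟨E, hE⟩ : ∃ E, E = Real.exp (κ * (4 / 3 * d * δ) + m / M) := ⟨_, rfl⟩
      rw [← hE] at l₂ r₂ hΓm hΓm1
      have hE0 : 0 ≤ E := by linarith
      -- the product of the two children is negligible, by the choice of `z`
      have hR : R ≤ 1 / M := by
        refine r₂.trans ?_
        rw [le_div_iff₀ hM0]
        have hmB : 4 + 6 * m * B ≤ 10 * (M * N) := by
          have h1 : (m : ℝ) * B ≤ M * N := mul_le_mul hmM hr hB0 hM0.le
          have h2 : 1 ≤ (M : ℝ) * N := one_le_mul_of_one_le_of_one_le hM1 hN1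
          linarith
        calc z * E * (4 + 6 * m * B) * M ≤ z * 4 * (10 * (M * N)) * M := by gcongr
          _ = z * (40 * M ^ 2 * N) := by ring
          _ ≤ 1 := hzM
      have hexp : Real.exp (κ * δ) + 1 / M ≤ Real.exp (κ * δ + 1 / M) := by
        rw [Real.exp_add]
        have h1 := Real.add_one_le_exp (1 / (M : ℝ))
        have h2 : 1 ≤ Real.exp (κ * δ) :=
          Real.one_le_exp (mul_nonneg hκ0 (hdq ▸ c₂.diamSq_nonneg))
        have h3 : (1 : ℝ) / M ≤ Real.exp (κ * δ) * (1 / M) :=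
          le_mul_of_one_le_left (by positivity) h2
        have h4 := mul_le_mul_of_nonneg_left h1 (zero_le_one.trans h2)
        linarith only [h3, h4]
      have hgrow : Real.exp (κ * δ + 1 / M) * E ≤
          Real.exp (κ * (4 / 3 * d * c.diamSq) + (m + 1 : ℕ) / M) := by
        rw [hE, ← Real.exp_add]
        refine Real.exp_le_exp.mpr ?_
        have := mul_le_mul_of_nonneg_left hpot hκ0
        push_cast
        rw [add_div]
        linarith only [this]
      obtain ⟨E', hE'⟩ : ∃ E', E' =
        Real.exp (κ * (4 / 3 * d * c.diamSq) + (m + 1 : ℕ) / M) := ⟨_, rfl⟩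
      rw [← hE'] at hgrow ⊢
      have hE'1 : 1 ≤ E' := by rw [hE']; exact hΓ1 hc (m + 1)
      rw [hlen] at hP1 ⊢
      push_cast
      exact expError_step hz L0 R0 V0 U0 (by positivity) hR u₂ v₂ f₂ p₀ p₁ l₂ r₂ hexp hgrow
        (Real.exp_pos _).le hE'1 (by positivity) hP1

end ExpectedError

/-! ### The value of the dynamic program against the optimal cost -/

section Comparator

variable {d : ℕ} [NeZero d]

/-- The diameter of the cell in which `p` and `q` are separated, within `m` levels below `c`
(and `0` if they are not). -/
noncomputable def separation (T : Quadtree d) : ℕ → Cell d → Pt d → Pt d → ℝ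
  | 0, _, _, _ => 0
  | m + 1, c, p, q =>
    if T.side c p = T.side c q then separation T m (T.child c (T.side c p)) p q else c.diam

theorem separation_nonneg (T : Quadtree d) (m : ℕ) (c : Cell d) (p q : Pt d) :
    0 ≤ separation T m c p q := by
  induction m generalizing c with
  | zero => exact le_rfl
  | succ m ih =>
    rw [separation]; split_ifs
    · exact ih _
    · exact c.diam_nonneg

variable {n k : ℕ} {Λ b : ℝ} {s : Fin d → ℝ}

local notation "T" => shiftedQuadtree Λ s

variable (n Λ b s)

open Classical in
/-- The value, for the noisy counts, of the solution that distributes the centers according to a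
given list `C` of points. -/
noncomputable def comparator : ℕ → Cell d → List (Pt d) → List (Pt d) → (List Bool → ℝ) → ℝ
  | 0, _, _, _, _ => 0
  | m + 1, c, P, C, x =>
    if Λ / n < c.diam then
      if C = [] then (P.length + x c.name) * c.diam
      else splitIndicator b P.length (x c.name) *
        (comparator m (Quadtree.child T c false) (Quadtree.part T c P false)
            (Quadtree.part T c C false) x +
          comparator m (Quadtree.child T c true) (Quadtree.part T c P true)
            (Quadtree.part T c C true) x)
    else 0

variable {n Λ b s}

theorem table_value_le_comparator (x : List Bool → ℝ) (m : ℕ) (c : Cell d) (P C : List (Pt d)) :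
    (table n k Λ b T x m c P C.length).1 ≤ comparator n Λ b s m c P C x := by
  have hpruned : ∀ (c : Cell d) i, ((leafTable k c 0).val i).1 = 0 := by
    intro c i
    rcases eq_or_ne i 0 with rfl | hi
    · simp [leafTable_val_zero]
    · rw [leafTable_val _ _ _ hi]
  induction m generalizing c P C with
  | zero => rw [table_zero, comparator, hpruned]
  | succ m ih =>
    rw [comparator]
    split_ifs with h hC
    · rw [hC, List.length_nil, table_value_zero x m c P h, weight]
    · have hk : C.length ≠ 0 := by simpa using hC
      by_cases hw : 2 * b < weight x c P
      · rw [splitIndicator_of_lt (by exact hw), one_mul,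
          table_of_lt_weight _ _ _ _ _ _ _ _ _ h hw, innerTable_val _ _ _ _ _ hk]
        have hl := part_length T c C
        refine ((argmin_spec _ _).2 (Quadtree.part T c C false).length (by omega)).trans ?_
        rw [show C.length - (Quadtree.part T c C false).length =
          (Quadtree.part T c C true).length by omega]
        exact add_le_add (ih _ _ _) (ih _ _ _)
      · rw [splitIndicator_of_not_lt (by exact hw), zero_mul,
          table_value_of_weight_le x m c P h hw hk]
    · rw [table_of_diam_le _ _ _ _ _ _ _ _ _ h, hpruned]

/-- The noise has mean zero, also at a cell that is reached, so that in expectation the comparator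
pays for each point the diameter of a cell in which it is separated from its center. -/
theorem comparator_expectation (hb : 0 < b) (q : Pt d → Pt d) (m : ℕ) {c : Cell d}
    (hc : Dyadic Λ s c) (P C : List (Pt d)) :
    NoiseVariable b (descendants c.name) (comparator n Λ b s m c P C) ∧
      ∫ x, comparator n Λ b s m c P C x ∂noiseLaw b ≤
        (P.map fun p => open Classical in
          if q p ∈ C then separation T m c p (q p) else c.diam).sum := by
  classical
  have hnonneg : ∀ (m : ℕ) (c : Cell d) (P C : List (Pt d)), 0 ≤ (P.map fun p =>
      if q p ∈ C then separation T m c p (q p) else c.diam).sum := by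
    intro m c P C
    refine List.sum_nonneg fun y hy => ?_
    obtain ⟨p, -, rfl⟩ := List.mem_map.mp hy
    split_ifs
    · exact separation_nonneg _ _ _ _ _
    · exact c.diam_nonneg
  induction m generalizing c P C with
  | zero =>
    refine ⟨NoiseVariable.const _ _, ?_⟩
    simp only [comparator, integral_zero]
    exact hnonneg 0 c P C
  | succ m ih =>
    by_cases h : Λ / n < c.diam
    swap
    · have e : comparator n Λ b s (m + 1) c P C = fun _ => 0 := by
        funext x; rw [comparator, if_neg h]
      rw [e]
      refine ⟨NoiseVariable.const _ _, ?_⟩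
      rw [integral_zero]
      exact hnonneg (m + 1) c P C
    by_cases hC : C = []
    · have e : comparator n Λ b s (m + 1) c P C = fun x =>
          (fun t => (P.length + t) * c.diam) (x c.name) +
            (fun _ => (0 : ℝ)) (x c.name) * (fun _ => (0 : ℝ)) x := by
        funext x; rw [comparator, if_pos h, if_pos hC]; ring
      have hint := integrable_id_laplace hb
      obtain ⟨h₁, h₂⟩ := NoiseVariable.node (s := c.name)
        (f := fun t => (P.length + t) * c.diam)
        (((integrable_const (P.length : ℝ)).add hint).mul_const c.diam) (by fun_prop)
        (integrable_const (μ := laplace b) (0 : ℝ)) measurable_const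
        (NoiseVariable.const (b := b) _ (0 : ℝ))
      rw [e]
      refine ⟨h₁, h₂.trans_le ?_⟩
      rw [integral_mul_const, integral_add (integrable_const _) hint, integral_id_laplace hb, hC]
      simp
    · have hch := fun a => ih (hc.child a) (Quadtree.part T c P a) (Quadtree.part T c C a)
      obtain ⟨l₁, l₂⟩ := hch false
      obtain ⟨r₁, r₂⟩ := hch true
      rw [child_name] at l₁ r₁
      have hG := (l₁.mono (descendants_cons_subset _ _)).add
        (r₁.mono (descendants_cons_subset _ _))
      obtain ⟨h₁, h₂⟩ := NoiseVariable.node (f := fun _ => (0 : ℝ))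
        (integrable_const _) measurable_const
        (integrable_splitIndicator P.length) (measurable_splitIndicator P.length) hG
      have e : comparator n Λ b s (m + 1) c P C = fun x =>
          (fun _ => (0 : ℝ)) (x c.name) + splitIndicator b P.length (x c.name) *
            (comparator n Λ b s m (Quadtree.child T c false) (Quadtree.part T c P false)
                (Quadtree.part T c C false) x +
              comparator n Λ b s m (Quadtree.child T c true) (Quadtree.part T c P true)
                (Quadtree.part T c C true) x) := by
        funext x; rw [comparator, if_pos h, if_neg hC, zero_add]
      rw [e]
      refine ⟨h₁, h₂.trans_le ?_⟩
      rw [integral_zero, zero_add, integral_add l₁.integrable r₁.integrable]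
      have hpoint : ∀ a, ∀ p ∈ Quadtree.part T c P a,
          (if q p ∈ Quadtree.part T c C a then
            separation T m (Quadtree.child T c a) p (q p) else (Quadtree.child T c a).diam) ≤
          if q p ∈ C then separation T (m + 1) c p (q p) else c.diam := by
        intro a p hp
        simp only [Quadtree.part, List.mem_filter, beq_iff_eq] at hp ⊢
        by_cases hq : q p ∈ C
        · rw [if_pos hq, separation]
          by_cases hs : Quadtree.side T c p = Quadtree.side T c (q p)
          · rw [if_pos hs, if_pos ⟨hq, hs ▸ hp.2⟩, hp.2]
          · rw [if_neg hs, if_neg fun h => hs (hp.2.trans h.2.symm)]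
            exact hc.child_diam_le a
        · rw [if_neg hq, if_neg fun h => hq h.1]
          exact hc.child_diam_le a
      have hle : (∫ x, comparator n Λ b s m (Quadtree.child T c false) (Quadtree.part T c P false)
            (Quadtree.part T c C false) x ∂noiseLaw b) +
          ∫ x, comparator n Λ b s m (Quadtree.child T c true) (Quadtree.part T c P true)
            (Quadtree.part T c C true) x ∂noiseLaw b ≤
          (P.map fun p => if q p ∈ C then separation T (m + 1) c p (q p) else c.diam).sum := by
        rw [sum_part T c P]
        exact add_le_add (l₂.trans (List.sum_le_sum (hpoint false)))
          (r₂.trans (List.sum_le_sum (hpoint true)))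
      exact (mul_le_mul_of_nonneg_left hle (integral_splitIndicator_nonneg _)).trans
        (mul_le_of_le_one_left (hnonneg _ _ _ _) (integral_splitIndicator_le_one _))

variable (Λ)

/-- The shifts for which `p` and `q` are separated by a cut at depth `t`: one of the `2 ^ (t / d)`
cuts of that depth in coordinate `t mod d` lies between them. -/
def crossing (t : ℕ) (p q : Pt d) : Set ℝ :=
  ⋃ a ∈ Finset.range (2 ^ (t / d)),
    Set.uIcc (p (Fin.ofNat d t) + 2 * Λ - 4 * Λ / 2 ^ (t / d) * (a + 1 / 2))
      (q (Fin.ofNat d t) + 2 * Λ - 4 * Λ / 2 ^ (t / d) * (a + 1 / 2))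

/-- The part of the separation of `p` and `q` that is due to the cuts at depth `t`. -/
noncomputable def crossingCost (t : ℕ) (p q : Pt d) (s : Fin d → ℝ) : ℝ :=
  (crossing Λ t p q).indicator (fun _ => √d * (4 * Λ / 2 ^ (t / d))) (s (Fin.ofNat d t))

variable {Λ}

theorem measurableSet_crossing (t : ℕ) (p q : Pt d) : MeasurableSet (crossing Λ t p q) :=
  Finset.measurableSet_biUnion _ fun _ _ => measurableSet_uIcc

theorem crossingCost_nonneg (hΛ : 0 < Λ) (t : ℕ) (p q : Pt d) (s : Fin d → ℝ) :
    0 ≤ crossingCost Λ t p q s :=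
  Set.indicator_nonneg (fun _ _ => by positivity) _

theorem separation_le (hΛ : 0 < Λ) (m : ℕ) {c : Cell d} (hc : Dyadic Λ s c) (p q : Pt d) :
    separation T m c p q ≤ ∑ i ∈ Finset.range m, crossingCost Λ (c.depth + i) p q s := by
  induction m generalizing c with
  | zero => simp [separation]
  | succ m ih =>
    rw [separation, Finset.sum_range_succ']
    split_ifs with h
    · refine (ih (hc.child _)).trans ?_
      rw [child_depth]
      refine le_trans (le_of_eq (Finset.sum_congr rfl fun i _ => ?_))
        (le_add_of_nonneg_right (crossingCost_nonneg hΛ _ _ _ _))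
      congr 1; ring
    · refine le_add_of_nonneg_of_le (Finset.sum_nonneg fun i _ => crossingCost_nonneg hΛ _ _ _ _) ?_
      rw [add_zero, crossingCost, Set.indicator_of_mem]
      · exact hc.diam_le hΛ
      · obtain ⟨a, ha, e⟩ := hc.lo c.axis
        have hax : halvings d c.depth c.axis = c.depth / d := halvings_axis _
        rw [hax] at ha e
        refine Set.mem_biUnion (Finset.mem_coe.mpr (Finset.mem_range.mpr ha)) ?_
        change s c.axis ∈ Set.uIcc (p c.axis + 2 * Λ - 4 * Λ / 2 ^ (c.depth / d) * (a + 1 / 2))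
          (q c.axis + 2 * Λ - 4 * Λ / 2 ^ (c.depth / d) * (a + 1 / 2))
        have hcut := hc.cutPos_eq
        rw [e] at hcut
        rw [Set.mem_uIcc]
        by_cases hp : p c.axis ≤ Quadtree.cutPos T c
        · have hq : ¬ q c.axis ≤ Quadtree.cutPos T c :=
            fun hq => h (by simp [Quadtree.side, hp, hq])
          left
          constructor <;> linarith
        · have hq : q c.axis ≤ Quadtree.cutPos T c := by
            by_contra hq; exact h (by simp [Quadtree.side, hp, hq])
          right
          constructor <;> linarith

end Comparator

/-! ### Random shifts -/

section RandomShift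

variable {d : ℕ}

/-- The law of the random shift. -/
noncomputable abbrev shiftLaw (d : ℕ) (Λ : ℝ) : Measure (Fin d → ℝ) :=
  cond volume (Set.Icc (fun _ : Fin d => -Λ) fun _ => Λ)

theorem volume_cube {Λ : ℝ} :
    volume (Set.Icc (fun _ : Fin d => -Λ) fun _ => Λ) = ENNReal.ofReal (2 * Λ) ^ d := by
  rw [Real.volume_Icc_pi]
  simp [two_mul]

theorem isProbabilityMeasure_shiftLaw (d : ℕ) {Λ : ℝ} (hΛ : 0 < Λ) :
    IsProbabilityMeasure (shiftLaw d Λ) := by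
  refine cond_isProbabilityMeasure_of_finite ?_ isCompact_Icc.measure_lt_top.ne
  rw [volume_cube]
  exact pow_ne_zero _ (by simpa using hΛ)

/-- One coordinate of the shift has density at most `1 / (2 Λ)`. -/
theorem shiftLaw_coordinate_le {Λ : ℝ} (hΛ : 0 < Λ) (j : Fin d) (I : Set ℝ) :
    shiftLaw d Λ {s | s j ∈ I} ≤ (ENNReal.ofReal (2 * Λ))⁻¹ * volume I := by
  have hd : 1 ≤ d := by have := j.2; omega
  have h0 : ENNReal.ofReal (2 * Λ) ≠ 0 := by simpa using hΛ
  rw [cond_apply measurableSet_Icc, volume_cube]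
  have hsub : (Set.Icc (fun _ : Fin d => -Λ) fun _ => Λ) ∩ {s | s j ∈ I} ⊆
      Set.pi Set.univ (Function.update (fun _ => Set.Icc (-Λ) Λ) j I) := by
    rintro s ⟨hs, hsj⟩ i -
    by_cases hi : i = j
    · subst hi; simpa using hsj
    · simpa [Function.update_of_ne hi] using ⟨hs.1 i, hs.2 i⟩
  refine (mul_le_mul_right (measure_mono hsub) _).trans ?_
  rw [volume_pi_pi, ← Finset.mul_prod_erase _ _ (Finset.mem_univ j), Function.update_self]
  have : ∏ i ∈ Finset.univ.erase j, volume (Function.update (fun _ => Set.Icc (-Λ) Λ) j I i) =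
      ENNReal.ofReal (2 * Λ) ^ (d - 1) := by
    rw [Finset.prod_congr rfl fun i hi => by
      rw [Function.update_of_ne (Finset.ne_of_mem_erase hi), Real.volume_Icc]]
    simp [two_mul]
  rw [this, mul_comm (volume I), ← mul_assoc]
  refine le_of_eq ?_
  congr 1
  obtain ⟨e, rfl⟩ := Nat.exists_eq_add_of_le' hd
  rw [Nat.add_sub_cancel, pow_succ, ENNReal.mul_inv (Or.inr ENNReal.ofReal_ne_top) (Or.inr h0),
    mul_right_comm, ENNReal.inv_mul_cancel (pow_ne_zero _ h0)
      (ENNReal.pow_ne_top ENNReal.ofReal_ne_top), one_mul]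

theorem sum_abs_le_sqrt_mul_dist (p q : Pt d) : ∑ j, |p j - q j| ≤ √d * dist p q := by
  rw [EuclideanSpace.dist_eq, ← Real.sqrt_mul (by positivity)]
  refine Real.le_sqrt_of_sq_le ?_
  have := sq_sum_le_card_mul_sum_sq (s := Finset.univ) (f := fun j => |p j - q j|)
  simpa [Real.dist_eq] using this

variable [NeZero d]

theorem integral_crossingCost_le {Λ : ℝ} (hΛ : 0 < Λ) (t : ℕ) (p q : Pt d) :
    Integrable (crossingCost Λ t p q) (shiftLaw d Λ) ∧
      ∫ s, crossingCost Λ t p q s ∂shiftLaw d Λ ≤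
        2 * √d * |p (Fin.ofNat d t) - q (Fin.ofNat d t)| := by
  have := isProbabilityMeasure_shiftLaw d hΛ
  set j := Fin.ofNat d t
  set D : ℝ := √d * (4 * Λ / 2 ^ (t / d)) with hD
  have hD0 : 0 ≤ D := by positivity
  have e : crossingCost Λ t p q = {s : Fin d → ℝ | s j ∈ crossing Λ t p q}.indicator
      fun _ => D := by
    funext s; rfl
  have hm : MeasurableSet {s : Fin d → ℝ | s j ∈ crossing Λ t p q} :=
    (measurableSet_crossing t p q).preimage (measurable_pi_apply j)
  have hvol : volume (crossing Λ t p q) ≤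
      ENNReal.ofReal (2 ^ (t / d) * |p j - q j|) := by
    refine (measure_biUnion_finset_le _ _).trans ?_
    have h1 : ∀ a : ℕ, volume (Set.uIcc (p j + 2 * Λ - 4 * Λ / 2 ^ (t / d) * (a + 1 / 2))
        (q j + 2 * Λ - 4 * Λ / 2 ^ (t / d) * (a + 1 / 2))) = ENNReal.ofReal |p j - q j| := by
      intro a
      rw [Real.volume_interval, abs_sub_comm]
      congr 2; ring
    simp only [j] at h1
    simp only [h1, Finset.sum_const, Finset.card_range, nsmul_eq_mul]
    rw [ENNReal.ofReal_mul (by positivity), ENNReal.ofReal_pow (by norm_num)]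
    simp [j]
  rw [e]
  refine ⟨(integrable_const D).indicator hm, ?_⟩
  rw [integral_indicator_const _ hm, smul_eq_mul, Measure.real]
  have h2 : shiftLaw d Λ {s : Fin d → ℝ | s j ∈ crossing Λ t p q} ≤
      ENNReal.ofReal ((2 * Λ)⁻¹ * (2 ^ (t / d) * |p j - q j|)) := by
    refine (shiftLaw_coordinate_le hΛ j _).trans ?_
    rw [ENNReal.ofReal_mul (p := (2 * Λ)⁻¹) (by positivity),
      ENNReal.ofReal_inv_of_pos (by positivity)]
    gcongr
  have h3 := ENNReal.toReal_mono ENNReal.ofReal_ne_top h2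
  rw [ENNReal.toReal_ofReal (by positivity)] at h3
  refine (mul_le_mul_of_nonneg_right h3 hD0).trans_eq ?_
  rw [hD]; field_simp; ring

theorem sum_range_mul_mod (α : ℕ) (f : Fin d → ℝ) :
    ∑ t ∈ Finset.range (d * α), f (Fin.ofNat d t) = α * ∑ j, f j := by
  induction α with
  | zero => simp
  | succ α ih =>
    rw [Nat.mul_succ, Finset.sum_range_add, ih, ← Fin.sum_univ_eq_sum_range]
    have : ∀ i : Fin d, Fin.ofNat d (d * α + i) = i := fun i => by
      ext; simp [Nat.mod_eq_of_lt i.2]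
    simp only [this]
    push_cast; ring

/-- The expected diameter of the cell in which two points are separated is `O(d α)` times their
distance, where `α` is the number of rounds. -/
theorem integral_sum_crossingCost_le {Λ : ℝ} (hΛ : 0 < Λ) (α : ℕ) (p q : Pt d) :
    Integrable (fun s => ∑ t ∈ Finset.range (d * α), crossingCost Λ t p q s) (shiftLaw d Λ) ∧
      ∫ s, ∑ t ∈ Finset.range (d * α), crossingCost Λ t p q s ∂shiftLaw d Λ ≤
        2 * d * α * dist p q := by
  refine ⟨integrable_finsetSum _ fun t _ => (integral_crossingCost_le hΛ t p q).1, ?_⟩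
  rw [integral_finsetSum _ fun t _ => (integral_crossingCost_le hΛ t p q).1]
  refine (Finset.sum_le_sum fun t _ => (integral_crossingCost_le hΛ t p q).2).trans ?_
  rw [← Finset.mul_sum, sum_range_mul_mod α fun j => |p j - q j|]
  calc 2 * √(d : ℝ) * (α * ∑ j, |p j - q j|) ≤ 2 * √(d : ℝ) * (α * (√d * dist p q)) := by
        gcongr; exact sum_abs_le_sqrt_mul_dist p q
    _ = 2 * (√(d : ℝ) * √d) * α * dist p q := by ring
    _ = _ := by rw [Real.mul_self_sqrt (by positivity)]

end RandomShift

/-! ### The expected cost -/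

section ExpectedCost

variable {d : ℕ} {k : ℕ}

theorem cost_eq_sum_infDist (P : List (Pt d)) (C : Fin k → Pt d) :
    cost P C = (P.map fun p => Metric.infDist p (Set.range C)).sum := by
  unfold cost
  congr 1
  refine List.map_congr_left fun p _ => ?_
  rw [Metric.infDist_eq_iInf]
  exact (iInf_range' (fun x => dist p x) C).symm

theorem cost_nonneg (P : List (Pt d)) (C : Fin k → Pt d) : 0 ≤ cost P C := by
  refine List.sum_nonneg fun y hy => ?_
  obtain ⟨p, -, rfl⟩ := List.mem_map.mp hy
  exact Real.iInf_nonneg fun _ => dist_nonneg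

theorem opt_nonneg (P : List (Pt d)) : 0 ≤ opt k P := Real.iInf_nonneg fun C => cost_nonneg P C

theorem measurable_cost (P : List (Pt d)) : Measurable (cost P : (Fin k → Pt d) → ℝ) := by
  unfold cost
  induction P with
  | nil => simp
  | cons p P ih =>
    simp only [List.map_cons, List.sum_cons]
    exact (Measurable.iInf fun i => measurable_const.dist (measurable_pi_apply i)).add ih

theorem inBox_root {Λ : ℝ} {s : Fin d → ℝ} (hs : s ∈ Set.Icc (fun _ : Fin d => -Λ) fun _ => Λ)
    {p : Pt d} (hp : p ∈ Metric.ball 0 Λ) : InBox (shiftedQuadtree Λ s).rootCell p := by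
  intro j
  have h1 := hs.1 j
  have h2 := hs.2 j
  have h3 : |p j| ≤ ‖p‖ := PiLp.norm_apply_le p j
  have h4 := abs_le.mp (h3.trans (mem_ball_zero_iff.mp hp).le)
  simp only [Quadtree.rootCell, shiftedQuadtree]
  simp only at h1 h2
  constructor <;> linarith

variable [NeZero d] {n : ℕ} {Λ ε : ℝ} {P : List (Pt d)}

theorem cost_centers (ω : Quadtree d × (List Bool → ℝ)) :
    cost P (centers n k Λ ε P ω) = coverCost P
      (table n k Λ (noiseScale d n ε) ω.1 ω.2 (d * rounds d n) ω.1.rootCell P k).2 := by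
  rw [cost_eq_sum_infDist, coverCost]
  congr 3
  funext p
  congr 1
  ext x
  simp only [Set.mem_range, centers_apply, Set.mem_ofPred_eq, List.mem_iff_get]
  have hl := table_length n k Λ (noiseScale d n ε) ω.1 ω.2 (d * rounds d n) ω.1.rootCell P k
  constructor
  · rintro ⟨i, rfl⟩
    exact ⟨_, ⟨_, rfl⟩, rfl⟩
  · rintro ⟨c, ⟨i, rfl⟩, rfl⟩
    exact ⟨i.cast hl, rfl⟩

/-- It suffices to bound the expected cost for fixed shifts. -/
theorem expectation_cost_le (hΛ : 0 < Λ) {g : (Fin d → ℝ) → ℝ} (hg : Integrable g (shiftLaw d Λ))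
    (h : ∀ s ∈ Set.Icc (fun _ : Fin d => -Λ) fun _ => Λ,
      Integrable (fun x => cost P (centers n k Λ ε P (shiftedQuadtree Λ s, x)))
        (noiseLaw (noiseScale d n ε)) ∧
      ∫ x, cost P (centers n k Λ ε P (shiftedQuadtree Λ s, x)) ∂noiseLaw (noiseScale d n ε) ≤
        g s) :
    Integrable (fun ω => cost P (centers n k Λ ε P ω))
        (randomness (shiftedLaw d Λ) (noiseScale d n ε)) ∧
      ∫ ω, cost P (centers n k Λ ε P ω) ∂randomness (shiftedLaw d Λ) (noiseScale d n ε) ≤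
        ∫ s, g s ∂shiftLaw d Λ := by
  have := isProbabilityMeasure_shiftLaw d hΛ
  have := isProbabilityMeasure_shiftedLaw d hΛ
  have hmp : MeasurePreserving (Prod.map (shiftedQuadtree Λ) id)
      ((shiftLaw d Λ).prod (noiseLaw (noiseScale d n ε)))
      (randomness (shiftedLaw d Λ) (noiseScale d n ε)) :=
    ((measurable_shiftedQuadtree Λ).measurePreserving _).prod (MeasurePreserving.id _)
  have hf : Measurable fun ω => cost P (centers n k Λ ε P ω) :=
    (measurable_cost P).comp (measurable_centers n k Λ ε P)
  obtain ⟨h₁, h₂⟩ := integrable_prod_of_integral_le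
    (ν := noiseLaw (noiseScale d n ε)) (hf.comp hmp.measurable) (fun _ => cost_nonneg _ _) hg
    ((ae_cond_mem measurableSet_Icc).mono h)
  refine ⟨(hmp.integrable_comp hf.aestronglyMeasurable).mp h₁, ?_⟩
  rw [← hmp.map_eq, integral_map hmp.measurable.aemeasurable hf.aestronglyMeasurable]
  exact h₂

theorem cost_centers_le (hk : 1 ≤ k) (hΛ : 0 < Λ) (hPn : P.length = n)
    (hP : ∀ p ∈ P, p ∈ Metric.ball 0 Λ) {s : Fin d → ℝ}
    (hs : s ∈ Set.Icc (fun _ : Fin d => -Λ) fun _ => Λ) (x : List Bool → ℝ) :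
    cost P (centers n k Λ ε P (shiftedQuadtree Λ s, x)) ≤ n * (√d * (4 * Λ)) := by
  have hroot := dyadic_rootCell Λ s
  rw [cost_centers, ← hPn]
  refine coverCost_le_of_dist_le (fun h => ?_) fun p hp c hc => ?_
  · have := table_length P.length k Λ (noiseScale d P.length ε) (shiftedQuadtree Λ s) x
      (d * rounds d P.length) (shiftedQuadtree Λ s).rootCell P k
    subst hPn
    rw [h] at this
    simp at this
    omega
  · refine (hroot.dist_le_diam (inBox_root hs (hP p hp)) (inBox_table hΛ x _ hroot P k c hc)).trans
      ((hroot.diam_le hΛ).trans_eq ?_)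
    simp [Quadtree.rootCell]

/-- The expected cost for a fixed shift, against an assignment `q` of the points to `k` centers. -/
theorem expectation_cost_shift_le (hk : 1 ≤ k) (hΛ : 0 < Λ) (hε : 0 < ε) (hn : 1 ≤ n)
    (hPn : P.length = n) (hP : ∀ p ∈ P, p ∈ Metric.ball 0 Λ) (C : Fin k → Pt d)
    (q : Pt d → Fin k) {s : Fin d → ℝ}
    (hs : s ∈ Set.Icc (fun _ : Fin d => -Λ) fun _ => Λ) :
    Integrable (fun x => cost P (centers n k Λ ε P (shiftedQuadtree Λ s, x)))
        (noiseLaw (noiseScale d n ε)) ∧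
      ∫ x, cost P (centers n k Λ ε P (shiftedQuadtree Λ s, x)) ∂noiseLaw (noiseScale d n ε) ≤
        (k * Real.log (40 * n * (d * rounds d n) ^ 2) + 1) * (32 * noiseScale d n ε * d * Λ) +
          2 * Λ + 2 * (P.map fun p =>
            ∑ t ∈ Finset.range (d * rounds d n), crossingCost Λ t p (C (q p)) s).sum := by
  have hb := noiseScale_pos (d := d) hn hε
  have hα : 0 < rounds d n := rounds_pos hn
  have hd0 : 0 < d := Nat.pos_of_neZero d
  have hd1 : (1 : ℝ) ≤ d := by exact_mod_cast hd0
  have hn1 : (1 : ℝ) ≤ n := by exact_mod_cast hn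
  obtain ⟨M, hM⟩ : ∃ M, M = d * rounds d n := ⟨_, rfl⟩
  have hM1 : 1 ≤ M := by rw [hM]; exact Nat.mul_pos hd0 hα
  have hM1' : (1 : ℝ) ≤ M := by exact_mod_cast hM1
  have hMc : (M : ℝ) = d * rounds d n := by rw [hM]; push_cast; rfl
  rw [← hMc]
  obtain ⟨b, hb'⟩ : ∃ b, b = noiseScale d n ε := ⟨_, rfl⟩
  have hroot := dyadic_rootCell Λ s
  have hbox : ∀ p ∈ P, InBox (shiftedQuadtree Λ s).rootCell p := fun p hp => inBox_root hs (hP p hp)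
  have hcost := fun x => cost_centers (n := n) (k := k) (Λ := Λ) (ε := ε) (P := P)
    (shiftedQuadtree Λ s, x)
  simp only [← hb', ← hM] at hb hcost ⊢
  obtain ⟨z, hz⟩ : ∃ z : ℝ, z = (40 * (n : ℝ) * (M : ℝ) ^ 2)⁻¹ := ⟨_, rfl⟩
  obtain ⟨lam, hlam⟩ : ∃ lam : ℝ, lam = (32 * b * d * Λ)⁻¹ := ⟨_, rfl⟩
  have hZ1 : (1 : ℝ) ≤ 40 * n * M ^ 2 := by
    have := one_le_pow₀ (n := 2) hM1'
    nlinarith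
  have hz0 : 0 < z := by rw [hz]; positivity
  have hz1 : z ≤ 1 := by rw [hz]; exact inv_le_one_of_one_le₀ hZ1
  have hlam0 : 0 < lam := by rw [hlam]; positivity
  have hlog : Real.log z = -Real.log (40 * n * M ^ 2) := by rw [hz, Real.log_inv]
  -- the part of the cost that exceeds the value of the dynamic program
  have hE := expError_expectation (n := n) (s := s) (lam := lam) (z := z)
    (κ := 8 * (lam ^ 2 * b ^ 2)) (N := n) (M := M) hb hΛ hlam0.le hz0.le hn hM1
    (by rw [hz]; refine le_of_eq ?_; field_simp) rfl
    (by
      have : √(d : ℝ) ≤ d := Real.sqrt_le_iff.mpr ⟨by positivity, by nlinarith⟩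
      rw [hlam]
      calc (32 * b * d * Λ)⁻¹ * b * (4 * Λ * √d) ≤ (32 * b * d * Λ)⁻¹ * b * (4 * Λ * d) := by
            gcongr
        _ = 1 / 8 := by field_simp; norm_num)
    (by rw [hlam]; refine le_of_eq ?_; field_simp; norm_num)
    M le_rfl hroot P hPn.le
  have hEle : ∫ x, expError n Λ s b lam z M (shiftedQuadtree Λ s).rootCell P x ∂noiseLaw b ≤ 1 := by
    refine hE.2.2.trans ?_
    have h1 : 8 * (lam ^ 2 * b ^ 2) * (4 / 3 * d * (shiftedQuadtree Λ s).rootCell.diamSq) + M / M ≤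
        7 / 6 := by
      rw [div_self (by positivity)]
      have : 8 * (lam ^ 2 * b ^ 2) * (4 / 3 * d * (shiftedQuadtree Λ s).rootCell.diamSq) ≤
          8 * (lam ^ 2 * b ^ 2) * (4 / 3 * d * (16 * d * Λ ^ 2)) := by
        gcongr; exact hroot.diamSq_le_root hΛ
      have e : 8 * (lam ^ 2 * b ^ 2) * (4 / 3 * d * (16 * d * Λ ^ 2)) = 1 / 6 := by
        rw [hlam]; field_simp; norm_num
      linarith
    have h2 : Real.exp (7 / 6) ≤ 4 := by
      have h3 := Real.exp_one_lt_d9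
      have h4 : Real.exp (7 / 6 : ℝ) ^ 6 ≤ 4 ^ 6 := by
        rw [← Real.exp_nat_mul, show ((6 : ℕ) : ℝ) * (7 / 6) = (7 : ℕ) * 1 by norm_num,
          Real.exp_nat_mul]
        exact (pow_le_pow_left₀ (Real.exp_pos 1).le h3.le 7).trans (by norm_num)
      exact le_of_pow_le_pow_left₀ (by norm_num) (by norm_num) h4
    have h5 : (4 : ℝ) + 6 * M * P.length ≤ 10 * (M * n) := by
      rw [hPn]
      have : (1 : ℝ) ≤ M * n := one_le_mul_of_one_le_of_one_le hM1' hn1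
      linarith
    calc _ ≤ z * 4 * (10 * (M * n)) := by
          gcongr
          exact (Real.exp_le_exp.mpr h1).trans h2
      _ = (M : ℝ)⁻¹ := by rw [hz]; field_simp; norm_num
      _ ≤ 1 := inv_le_one_of_one_le₀ hM1'
  have hV := comparator_expectation (n := n) (s := s) hb (fun p => C (q p)) M hroot P (List.ofFn C)
  have hVle : (P.map fun p => open Classical in
      if C (q p) ∈ List.ofFn C then
        separation (shiftedQuadtree Λ s) M (shiftedQuadtree Λ s).rootCell p (C (q p))
      else (shiftedQuadtree Λ s).rootCell.diam).sum ≤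
      (P.map fun p => ∑ t ∈ Finset.range M, crossingCost Λ t p (C (q p)) s).sum := by
    refine List.sum_le_sum fun p _ => ?_
    rw [if_pos (by simp [List.mem_ofFn])]
    refine (separation_le hΛ M hroot p (C (q p))).trans_eq ?_
    simp [Quadtree.rootCell]
  have hpoint : ∀ x, cost P (centers n k Λ ε P (shiftedQuadtree Λ s, x)) ≤
      (k * Real.log (40 * n * M ^ 2) +
        expError n Λ s b lam z M (shiftedQuadtree Λ s).rootCell P x) * (32 * b * d * Λ) +
      2 * Λ + 2 * comparator n Λ b s M (shiftedQuadtree Λ s).rootCell P (List.ofFn C) x := by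
    intro x
    have h1 := le_expError (k := k) (b := b) hlam0.le hz0.le hz1 hΛ hn x M hroot
      (by rw [hM]; simp [Quadtree.rootCell]) hbox (k' := k) (by omega)
    have h2 := table_value_le_comparator (n := n) (k := k) (Λ := Λ) (b := b) (s := s) x M
      (shiftedQuadtree Λ s).rootCell P (List.ofFn C)
    rw [List.length_ofFn] at h2
    rw [hcost]
    generalize coverCost P _ = A at *
    generalize (table n k Λ b (shiftedQuadtree Λ s) x M _ P k).1 = v at *
    generalize expError n Λ s b lam z M _ P x = E at *
    rw [← Real.exp_log (pow_pos hz0 k), ← Real.exp_add, Real.log_pow, hlog] at h1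
    have h3 := Real.add_one_le_exp
      (k * -Real.log (40 * n * M ^ 2) + lam * (A - 2 * v - 2 * P.length * (Λ / n)))
    have h4 : lam * (A - 2 * v - 2 * Λ) ≤ k * Real.log (40 * n * M ^ 2) + E := by
      have e : 2 * (P.length : ℝ) * (Λ / n) = 2 * Λ := by rw [hPn]; field_simp
      rw [e] at h1 h3
      linarith
    have h5 : A - 2 * v - 2 * Λ ≤ (k * Real.log (40 * n * M ^ 2) + E) * (32 * b * d * Λ) := by
      rw [← div_le_iff₀ (by positivity)]
      rwa [hlam, mul_comm, ← div_eq_mul_inv] at h4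
    linarith
  have hint₁ : Integrable (fun x => (k * Real.log (40 * n * M ^ 2) +
      expError n Λ s b lam z M (shiftedQuadtree Λ s).rootCell P x) * (32 * b * d * Λ))
      (noiseLaw b) := ((integrable_const _).add hE.1.integrable).mul_const _
  have hint₂ : Integrable (fun x => (k * Real.log (40 * n * M ^ 2) +
      expError n Λ s b lam z M (shiftedQuadtree Λ s).rootCell P x) * (32 * b * d * Λ) + 2 * Λ)
      (noiseLaw b) := hint₁.add (integrable_const _)
  have hint := hint₂.add (hV.1.integrable.const_mul 2)
  have hmeas : Measurable fun x => cost P (centers n k Λ ε P (shiftedQuadtree Λ s, x)) :=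
    (measurable_cost P).comp ((measurable_centers n k Λ ε P).comp measurable_prodMk_left)
  have hci : Integrable (fun x => cost P (centers n k Λ ε P (shiftedQuadtree Λ s, x)))
      (noiseLaw b) := by
    refine hint.mono' hmeas.aestronglyMeasurable (Filter.Eventually.of_forall fun x => ?_)
    rw [Real.norm_of_nonneg (cost_nonneg _ _)]
    exact hpoint x
  refine ⟨hci, (integral_mono hci hint hpoint).trans ?_⟩
  refine (integral_add hint₂ (hV.1.integrable.const_mul 2)).trans_le ?_
  rw [integral_add hint₁ (integrable_const _), integral_mul_const,
    integral_add (integrable_const _) hE.1.integrable]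
  simp only [integral_const_mul, integral_const, probReal_univ, one_smul]
  gcongr
  exact hV.2.trans hVle

/-- The expected cost of the algorithm, before the constants are worked out. -/
theorem expectation_cost_le_cost (hk : 1 ≤ k) (hΛ : 0 < Λ) (hε : 0 < ε) (hn : 1 ≤ n)
    (hPn : P.length = n) (hP : ∀ p ∈ P, p ∈ Metric.ball 0 Λ) (C : Fin k → Pt d) :
    Integrable (fun ω => cost P (centers n k Λ ε P ω))
        (randomness (shiftedLaw d Λ) (noiseScale d n ε)) ∧
      ∫ ω, cost P (centers n k Λ ε P ω) ∂randomness (shiftedLaw d Λ) (noiseScale d n ε) ≤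
        (k * Real.log (40 * n * (d * rounds d n) ^ 2) + 1) * (32 * noiseScale d n ε * d * Λ) +
          2 * Λ + 4 * d * rounds d n * cost P C := by
  have := isProbabilityMeasure_shiftLaw d hΛ
  have : Nonempty (Fin k) := ⟨⟨0, hk⟩⟩
  choose q hq using fun p : Pt d => Finite.exists_min fun i => dist p (C i)
  have hsum : ∀ Q : List (Pt d), Integrable (fun s => (Q.map fun p =>
      ∑ t ∈ Finset.range (d * rounds d n), crossingCost Λ t p (C (q p)) s).sum) (shiftLaw d Λ) ∧
      ∫ s, (Q.map fun p =>
        ∑ t ∈ Finset.range (d * rounds d n), crossingCost Λ t p (C (q p)) s).sum ∂shiftLaw d Λ ≤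
        2 * d * rounds d n * cost Q C := by
    intro Q
    induction Q with
    | nil => simp [cost]
    | cons p Q ih =>
      obtain ⟨h₁, h₂⟩ := integral_sum_crossingCost_le hΛ (rounds d n) p (C (q p))
      have hcons : cost (p :: Q) C = dist p (C (q p)) + cost Q C := by
        simp only [cost, List.map_cons, List.sum_cons]
        congr 1
        exact le_antisymm (ciInf_le (Set.finite_range _).bddBelow _) (le_ciInf (hq p))
      simp only [List.map_cons, List.sum_cons]
      refine ⟨h₁.add ih.1, ?_⟩
      rw [integral_add h₁ ih.1, hcons, mul_add]
      exact add_le_add h₂ ih.2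
  obtain ⟨h₁, h₂⟩ := hsum P
  obtain ⟨h₃, h₄⟩ := expectation_cost_le hΛ ((integrable_const _).add (h₁.const_mul 2)) fun s hs =>
    expectation_cost_shift_le hk hΛ hε hn hPn hP C q hs
  refine ⟨h₃, h₄.trans ?_⟩
  refine (integral_add (integrable_const _) (h₁.const_mul 2)).trans_le ?_
  rw [integral_const_mul]
  simp only [integral_const, probReal_univ, one_smul]
  linarith

theorem expectation_cost_le_opt (hk : 1 ≤ k) (hΛ : 0 < Λ) (hε : 0 < ε) (hn : 2 ≤ n)
    (hPn : P.length = n) (hP : ∀ p ∈ P, p ∈ Metric.ball 0 Λ) :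
    Integrable (fun ω => cost P (centers n k Λ ε P ω))
        (randomness (shiftedLaw d Λ) (noiseScale d n ε)) ∧
      ∫ ω, cost P (centers n k Λ ε P ω) ∂randomness (shiftedLaw d Λ) (noiseScale d n ε) ≤
        20000 * ((d : ℝ) ^ (3 / 2 : ℝ) * Real.log n) * opt k P +
          20000 * ((d : ℝ) ^ 2 * Real.log n ^ 2 * k * (1 + 1 / ε)) * Λ := by
  have := isProbabilityMeasure_shiftLaw d hΛ
  have hd0 : 0 < d := Nat.pos_of_neZero d
  have hd1 : (1 : ℝ) ≤ d := by exact_mod_cast hd0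
  have hn2 : (2 : ℝ) ≤ n := by exact_mod_cast hn
  have hk1 : (1 : ℝ) ≤ k := by exact_mod_cast hk
  have hl2 : (0.69 : ℝ) < Real.log 2 := by linarith [Real.log_two_gt_d9]
  have hL : Real.log 2 ≤ Real.log n := Real.log_le_log (by norm_num) hn2
  have hopt : 0 ≤ opt k P := opt_nonneg P
  rcases lt_or_ge n d with hnd | hnd
  · -- few points: the diameter of the root bounds the distance of every point to the centers
    obtain ⟨h₁, h₂⟩ := expectation_cost_le (ε := ε) (P := P) (n := n) (k := k) hΛ
      (integrable_const ((n : ℝ) * (√d * (4 * Λ)))) fun s hs => by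
        have hle := cost_centers_le (ε := ε) hk hΛ hPn hP hs
        have hmeas : Measurable fun x => cost P (centers n k Λ ε P (shiftedQuadtree Λ s, x)) :=
          (measurable_cost P).comp ((measurable_centers n k Λ ε P).comp measurable_prodMk_left)
        have hi : Integrable (fun x => cost P (centers n k Λ ε P (shiftedQuadtree Λ s, x)))
            (noiseLaw (noiseScale d n ε)) := by
          refine (integrable_const ((n : ℝ) * (√d * (4 * Λ)))).mono' hmeas.aestronglyMeasurable
            (Filter.Eventually.of_forall fun x => ?_)
          rw [Real.norm_of_nonneg (cost_nonneg _ _)]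
          exact hle x
        refine ⟨hi, (integral_mono hi (integrable_const _) hle).trans ?_⟩
        simp
    refine ⟨h₁, h₂.trans ?_⟩
    simp only [integral_const, probReal_univ, one_smul]
    have hnd' : (n : ℝ) ≤ d := by exact_mod_cast hnd.le
    have hsq : √(d : ℝ) ≤ d := Real.sqrt_le_iff.mpr ⟨by positivity, by nlinarith⟩
    have h3 : (1 / 4 : ℝ) ≤ Real.log n ^ 2 := by nlinarith
    have h4 : (1 : ℝ) ≤ 1 + 1 / ε := le_add_of_nonneg_right (by positivity)
    have h5 : (d : ℝ) ^ 2 * (1 / 4) * 1 * 1 ≤ (d : ℝ) ^ 2 * Real.log n ^ 2 * k * (1 + 1 / ε) := by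
      gcongr
    have h6 : (n : ℝ) * (√d * (4 * Λ)) ≤ d * (d * (4 * Λ)) := by gcongr
    have h7 : (0 : ℝ) ≤ 20000 * ((d : ℝ) ^ (3 / 2 : ℝ) * Real.log n) * opt k P := by
      have : 0 ≤ Real.log n := by linarith
      positivity
    have h8 := mul_le_mul_of_nonneg_right h5 hΛ.le
    have h9 : (0 : ℝ) ≤ (d : ℝ) ^ 2 * Λ := by positivity
    linarith
  · have hα := rounds_le (d := d) (n := n) hd0 (by omega)
    have hld : Real.log d ≤ Real.log n :=
      Real.log_le_log (by positivity) (by exact_mod_cast hnd)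
    have hLn : Real.log n ≤ n := (Real.log_le_sub_one_of_pos (by positivity)).trans (by linarith)
    obtain ⟨L, hL'⟩ : ∃ L, L = Real.log n := ⟨_, rfl⟩
    rw [← hL'] at hα hld hLn hL ⊢
    have hL0 : 0 < L := by linarith
    have hα' : (rounds d n : ℝ) ≤ 15 * L := by linarith
    have hα0 : (0 : ℝ) < rounds d n := by exact_mod_cast rounds_pos (d := d) (by omega : 1 ≤ n)
    have hlog : Real.log (40 * n * (d * rounds d n) ^ 2) ≤ 19 * L := by
      have hnd' : (d : ℝ) ≤ n := by exact_mod_cast hnd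
      have h1 : (40 : ℝ) * n * ((d : ℝ) * rounds d n) ^ 2 ≤ 2 ^ 14 * (n : ℝ) ^ 5 := by
        calc (40 : ℝ) * n * ((d : ℝ) * rounds d n) ^ 2 ≤ 40 * n * (n * (15 * (n : ℝ))) ^ 2 := by
              gcongr; exact hα'.trans (by linarith)
          _ = 9000 * (n : ℝ) ^ 5 := by ring
          _ ≤ _ := by gcongr; norm_num
      refine (Real.log_le_log (by positivity) h1).trans ?_
      rw [Real.log_mul (by positivity) (by positivity), Real.log_pow, Real.log_pow, ← hL']
      push_cast
      linarith
    have hcoef : 4 * d * rounds d n ≤ 20000 * ((d : ℝ) ^ (3 / 2 : ℝ) * L) := by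
      have h1 : (d : ℝ) ≤ (d : ℝ) ^ (3 / 2 : ℝ) := by
        conv_lhs => rw [← Real.rpow_one (d : ℝ)]
        exact Real.rpow_le_rpow_of_exponent_le hd1 (by norm_num)
      calc (4 : ℝ) * d * rounds d n ≤ 4 * (d : ℝ) ^ (3 / 2 : ℝ) * (15 * L) := by gcongr
        _ = 60 * ((d : ℝ) ^ (3 / 2 : ℝ) * L) := by ring
        _ ≤ _ := by gcongr; norm_num
    have hadd : (k * Real.log (40 * n * (d * rounds d n) ^ 2) + 1) *
        (32 * noiseScale d n ε * d * Λ) + 2 * Λ ≤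
        20000 * ((d : ℝ) ^ 2 * L ^ 2 * k * (1 + 1 / ε)) * Λ := by
      have h1 : k * Real.log (40 * n * (d * rounds d n) ^ 2) + 1 ≤ 21 * (k * L) := by
        have h2 : k * Real.log (40 * n * (d * rounds d n) ^ 2) ≤ k * (19 * L) := by gcongr
        have h3 : (1 / 2 : ℝ) ≤ k * L := by nlinarith
        linarith
      have h4 : noiseScale d n ε ≤ d * (15 * L) / ε := by unfold noiseScale; gcongr
      have h5 : (k * Real.log (40 * n * (d * rounds d n) ^ 2) + 1) *
          (32 * noiseScale d n ε * d * Λ) ≤ 21 * (k * L) * (32 * (d * (15 * L) / ε) * d * Λ) := by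
        have : 0 ≤ noiseScale d n ε := by unfold noiseScale; positivity
        gcongr
      have h6 : 21 * (k * L) * (32 * (d * (15 * L) / ε) * d * Λ) =
          10080 * ((d : ℝ) ^ 2 * L ^ 2 * k * Λ * (1 / ε)) := by field_simp; norm_num
      have h7 : (1 : ℝ) ^ 2 * (1 / 4) * 1 * Λ ≤ (d : ℝ) ^ 2 * L ^ 2 * k * Λ := by
        have : (1 / 4 : ℝ) ≤ L ^ 2 := by nlinarith
        gcongr
      have h8 : 0 ≤ (d : ℝ) ^ 2 * L ^ 2 * k * Λ * (1 / ε) := by positivity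
      rw [h6] at h5
      linarith
    have h := fun C => expectation_cost_le_cost (ε := ε) hk hΛ hε (by omega : 1 ≤ n) hPn hP
      (C : Fin k → Pt d)
    refine ⟨(h 0).1, ?_⟩
    have hA : (0 : ℝ) ≤ 20000 * ((d : ℝ) ^ (3 / 2 : ℝ) * L) := by positivity
    rw [← sub_le_iff_le_add, opt, Real.mul_iInf_of_nonneg hA]
    refine le_ciInf fun C => ?_
    have h1 := mul_le_mul_of_nonneg_right hcoef (cost_nonneg P C)
    linarith [(h C).2]

end ExpectedCost

end DPKMedian

theorem theorem1 :
    -- privacy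
    (∀ (d n k : ℕ) [NeZero d] (Λ ε : ℝ) (τ : MeasureTheory.Measure (DPKMedian.Quadtree d))
      [MeasureTheory.IsProbabilityMeasure τ],
      1 ≤ n → 0 < Λ → 0 < ε → (∀ᵐ T ∂τ, T.Valid Λ) →
      DPKMedian.IsDifferentiallyPrivate ε (Metric.ball (0 : DPKMedian.Pt d) Λ)
        (DPKMedian.randomness τ (DPKMedian.noiseScale d n ε))
        (DPKMedian.centers n k Λ ε)) ∧
    -- expected cost
    (∃ C : ℝ, ∀ (d n k : ℕ) [NeZero d] (Λ ε : ℝ) (P : List (DPKMedian.Pt d)),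
      2 ≤ n → 1 ≤ k → 0 < Λ → 0 < ε → P.length = n → (∀ p ∈ P, p ∈ Metric.ball 0 Λ) →
      MeasureTheory.Integrable (fun ω => DPKMedian.cost P (DPKMedian.centers n k Λ ε P ω))
        (DPKMedian.randomness (DPKMedian.shiftedLaw d Λ) (DPKMedian.noiseScale d n ε)) ∧
      ∫ ω, DPKMedian.cost P (DPKMedian.centers n k Λ ε P ω)
          ∂(DPKMedian.randomness (DPKMedian.shiftedLaw d Λ) (DPKMedian.noiseScale d n ε))
        ≤ C * ((d : ℝ) ^ (3 / 2 : ℝ) * Real.log n) * DPKMedian.opt k P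
          + C * ((d : ℝ) ^ 2 * Real.log n ^ 2 * k * (1 + 1 / ε)) * Λ) ∧
    -- expected running time
    (∃ (C : ℝ) (a : ℕ), ∀ (d n k : ℕ) [NeZero d] (Λ ε : ℝ)
      (τ : MeasureTheory.Measure (DPKMedian.Quadtree d)) [MeasureTheory.IsProbabilityMeasure τ]
      (P : List (DPKMedian.Pt d)),
      1 ≤ n → 1 ≤ k → 0 < Λ → 0 < ε → (∀ᵐ T ∂τ, T.Valid Λ) →
      P.length = n → (∀ p ∈ P, p ∈ Metric.ball 0 Λ) →
      MeasureTheory.Integrable (fun ω => (DPKMedian.runningTime n k Λ ε P ω : ℝ))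
        (DPKMedian.randomness τ (DPKMedian.noiseScale d n ε)) ∧
      ∫ ω, (DPKMedian.runningTime n k Λ ε P ω : ℝ)
          ∂(DPKMedian.randomness τ (DPKMedian.noiseScale d n ε))
        ≤ C * (n * d * k ^ 2) * (1 + Real.log (n * d * k)) ^ a) := by
  refine ⟨fun d n k _ Λ ε τ _ hn _ hε _ => DPKMedian.isDifferentiallyPrivate_centers k hn hε τ _,
    ⟨20000, fun d n k _ Λ ε P hn hk hΛ hε hPn hP =>
      DPKMedian.expectation_cost_le_opt hk hΛ hε hn hPn hP⟩,
    ⟨2500, 2, fun d n k _ Λ ε τ _ P hn hk _ hε _ hPn _ =>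
      DPKMedian.integral_runningTime_le hn hk hε τ hPn⟩⟩
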